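/- **Definitions.** An edge-coloured graph $G$ is a finite simple graph with a colouring $c$ of its edges. The colour degree $d^c_G(v)$ is the number of distinct colours on edges at $v$, and $\delta^c(G)=\min_v d^c_G(v)$. $G$ is *critical* if for every edge $uv$ we have $d^c_{G-uv}(u)<d^c_G(u)$ or $d^c_{G-uv}(v)<d^c_G(v)$. A graph is *properly coloured* if no two adjacent edges have the same colour. A *1-path-cycle* is a vertex-disjoint union of cycles and at most one path (a single vertex counts as a path); $|H|$ is the number of vertices of $H$. For real $\delta,\varepsilon$, a graph $G$ on $n$ vertices is *$(\delta,\varepsilon)$-extremal* if there are disjoint $A,B\subseteq V(G)$ and pairwise distinct colours $c_a$ $(a\in A)$ such that * $|A|\ge(\delta-\varepsilon)n$ and $|B|\ge(1-\delta-\varepsilon)n$; * for each $a\in A$ there are at least $|B|-\varepsilon n$ vertices $b\in B$ such that $ab$ is an edge with $c(ab)=c_a$; * for each $b\in B$, $d_G(b)\le(\delta+\varepsilon)n$ and $b$ has at least $|A|-\varepsilon n$ neighbours $a\in A$ with $c(ab)=c_a$. **Statement.** There is $\varepsilon_0>0$ such that for all $0<\varepsilon\le\varepsilon_0$ and all $\eta>0$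 there is $\beta_0=\beta_0(\varepsilon,\eta)>0$ such that for all $0<\beta\le\beta_0$ there is $n_0=n_0(\varepsilon,\eta,\beta)$ such that the following holds for all $n\ge n_0$ and all real $\delta\ge\frac12+\eta$. Let $G$ be a critical edge-coloured graph on $n$ vertices with $\delta^c(G)\ge\delta n+1$. Then 1. $G$ is $(\delta,\varepsilon)$-extremal, or $G$ contains a properly coloured 1-path-cycle $H$ with $|H|\ge\min\{(3\delta+\beta)n/2,\,n\}$ in which every cycle has length at least $\beta n/100$ (or both); 2. if $G$ is not $(\delta,\varepsilon)$-extremal, then $G$ contains pairwise vertex-disjoint properly coloured paths $P_1,\dots,P_k$ with $k\le 100/\beta$ that together cover at least $\min\{(3\delta+\beta)n/2,\,n\}$ vertices. -/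

import Mathlib

namespace EdgeColoured

/- An edge-coloured graph is a pair `(G, c)`: a simple graph `G` on `V` and a map `c` giving
a colour to every unordered pair.  Every definition below reads `c` on edges of `G` only, so
the values of `c` on non-edges are irrelevant. -/

/-- The colour degree of `v`: the number of distinct colours on the edges at `v`. -/
noncomputable def colourDegree {V K : Type*} (G : SimpleGraph V) (c : Sym2 V → K) (v : V) : ℕ :=
  ((fun u => c s(v, u)) '' G.neighborSet v).ncard

/-- The minimum colour degree of a (non-empty) edge-coloured graph. -/
noncomputable def minColourDegree {V K : Type*} (G : SimpleGraph V) (c : Sym2 V → K) : ℕ :=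
  ⨅ v : V, colourDegree G c v

/-- Deleting any edge lowers the colour degree of at least one of its two ends. -/
def IsCritical {V K : Type*} (G : SimpleGraph V) (c : Sym2 V → K) : Prop :=
  ∀ u v : V, G.Adj u v →
    colourDegree (G.deleteEdges {s(u, v)}) c u < colourDegree G c u ∨
    colourDegree (G.deleteEdges {s(u, v)}) c v < colourDegree G c v

/-- `(δ, ε)`-extremality.  The colours `c_a` for `a ∈ A` are given by `col`; that they are
distinct is injectivity of `col` on `A`. -/
def IsExtremal {V K : Type*} (G : SimpleGraph V) (c : Sym2 V → K) (δ ε : ℝ) : Prop :=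
  ∃ (A B : Set V) (col : V → K), Disjoint A B ∧
    (δ - ε) * (Nat.card V : ℝ) ≤ (A.ncard : ℝ) ∧
    (1 - δ - ε) * (Nat.card V : ℝ) ≤ (B.ncard : ℝ) ∧
    Set.InjOn col A ∧
    (∀ a ∈ A, (B.ncard : ℝ) - ε * (Nat.card V : ℝ) ≤
      ({b | b ∈ B ∧ G.Adj a b ∧ c s(a, b) = col a}.ncard : ℝ)) ∧
    (∀ b ∈ B, ((G.neighborSet b).ncard : ℝ) ≤ (δ + ε) * (Nat.card V : ℝ) ∧
      (A.ncard : ℝ) - ε * (Nat.card V : ℝ) ≤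
        ({a | a ∈ A ∧ G.Adj a b ∧ c s(a, b) = col a}.ncard : ℝ))

/-- Any two distinct edges of `H` with a common end have different colours. -/
def IsProperlyColoured {V K : Type*} {G : SimpleGraph V} (c : Sym2 V → K)
    (H : G.Subgraph) : Prop :=
  ∀ u v w : V, H.Adj u v → H.Adj u w → v ≠ w → c s(u, v) ≠ c s(u, w)

/-- `P` is a path (possibly a single vertex). -/
def IsPathSubgraph {V : Type*} {G : SimpleGraph V} (P : G.Subgraph) : Prop :=
  ∃ (u v : V) (p : G.Walk u v), p.IsPath ∧ p.toSubgraph = P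

/-- `C` is a cycle. -/
def IsCycleSubgraph {V : Type*} {G : SimpleGraph V} (C : G.Subgraph) : Prop :=
  ∃ (v : V) (p : G.Walk v v), p.IsCycle ∧ p.toSubgraph = C

/-- A `1`-path-cycle: a vertex-disjoint union of cycles (the members of `S`) and at most one
path (`P`, where `P = ⊥` means that there is no path). -/
def IsOnePathCycle {V : Type*} {G : SimpleGraph V} (H : G.Subgraph) : Prop :=
  ∃ (S : Set G.Subgraph) (P : G.Subgraph),
    (∀ C ∈ S, IsCycleSubgraph C) ∧
    (P = ⊥ ∨ IsPathSubgraph P) ∧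
    (∀ C ∈ S, ∀ D ∈ S, C ≠ D → Disjoint C.verts D.verts) ∧
    (∀ C ∈ S, Disjoint C.verts P.verts) ∧
    H = sSup S ⊔ P

end EdgeColoured

namespace EdgeColoured

open SimpleGraph

set_option linter.unusedSectionVars false

/-! Among the properly coloured subgraphs of maximum degree two, with all cycles of length at least
`ℓ` (about `βn/50`) and at most one path component, take one whose vertex set `U` is largest. If `U`
is large enough, this subgraph is the required 1-path-cycle, and opening each of its cycles gives
the paths of part 2, which are few because the cycles are long. Otherwise `U` is not everything and
`|U|` is below about `3δn/2`; then `G` is shown to be extremal, which settles both parts.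

The tool is Pósa rotation. If an end `x` has an edge `xy` of a colour new at `x`, then one of the
two edges at `y`, say `yz`, can be dropped so that the colours at `y` stay distinct, and `z` becomes
an end; this is the arrow `(y, z)`. Rotations may close cycles. These are harmless when long, and
they are long if all changes happen far apart (`Modif.cyclesGe`). Keeping only arrows that arise in
many ways (`Reach`) allows them to be realised away from any small set (`Reach.exists_attains`), so
the rotations at the two ends `x` and `x'` do not interfere. Maximality now says that a reachable
end has no suitable neighbour outside `U`, and that ends reached from the two sides are not joined
by a suitable edge: such an edge would leave only cycles on `U`, with room for an outside vertex as
a one-vertex path (`IsBase.not_free_pair`).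

Let `d` be about `δn`. A reachable end has at least `d` suitable neighbours, nearly all of them
popular, i.e. suitable for many reachable ends, and every popular vertex is the tail of an arrow. A
vertex popular for one side is the head of at most one arrow of the other side. Together with `|U|`
being at most about `3d/2`, double counting forces, for one of the sides, about `d` popular
vertices, at most about `d/2` heads, and `|U|` about `3d/2` (`overlap_le_or_le`,
`IsBase.exists_isStable`). Hence most heads are hubs, with all arrows into them reachable, and most
popular vertices `a` are emitters, with a single arrow, towards `t a`. An edge from a hub to `a` in
a colour other than that of `a (t a)` would help to reach the opposite arrow at `a`, so nearly all
hub-emitter edges at `a` have the colour of `a (t a)` (`IsStable.ncard_bad_le`). Criticality makes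
these colours distinct (`injOn_tame`).

Finally an outside vertex can take the place of a hub. This shows that the outside vertices are
independent and see nearly all emitters in the same colours as the hubs do
(`IsCore.ncard_not_matches_le`). The emitters, and the hubs together with the outside vertices, are
the two classes of the extremal structure; the second has size about `d/2 + (n - 3d/2) = n - d`. -/

/-- Every vertex of `F` has at most two neighbours. -/
def DegLeTwo {V : Type*} (F : SimpleGraph V) : Prop :=
  ∀ u v₁ v₂ v₃, F.Adj u v₁ → F.Adj u v₂ → F.Adj u v₃ → v₁ = v₂ ∨ v₁ = v₃ ∨ v₂ = v₃

/-- Adjacent edges of `F` have different colours. -/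
def ProperOn {V K : Type*} (c : Sym2 V → K) (F : SimpleGraph V) : Prop :=
  ∀ u v w, F.Adj u v → F.Adj u w → v ≠ w → c s(u, v) ≠ c s(u, w)

/-- Every cycle of `F` has length at least `ℓ`. -/
def CyclesGe {V : Type*} (ℓ : ℕ) (F : SimpleGraph V) : Prop :=
  ∀ (v : V) (p : F.Walk v v), p.IsCycle → ℓ ≤ p.length

/-! ### Cycles and distances in graphs of maximum degree two -/

section Cycles

variable {V : Type*} {F F' : SimpleGraph V}

theorem exists_cons_of_mem_darts {v u t : V} {p : F.Walk v v} (hp : p.IsCycle) (h : F.Adj u t)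
    (hd : (⟨(u, t), h⟩ : F.Dart) ∈ p.darts) :
    ∃ q : F.Walk t u, (Walk.cons h q).IsCycle ∧ q.length + 1 = p.length := by
  obtain ⟨a, b, rfl⟩ := (p.isSubwalk_toWalk_iff_mem_darts h).2 hd
  refine ⟨b.append a, ?_, ?_⟩
  · rw [Walk.isCycle_def] at hp ⊢
    obtain ⟨h1, h2, h3⟩ := hp
    refine ⟨?_, by simp, ?_⟩
    · rw [Walk.isTrail_def] at h1 ⊢
      refine (List.Perm.nodup_iff ?_).1 h1
      simp only [Walk.edges_append, Walk.edges_cons, Walk.edges_nil, Adj.toWalk]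
      rw [List.append_assoc]
      refine List.perm_append_comm.trans ?_
      simp
    · refine (List.Perm.nodup_iff ?_).1 h3
      simp only [Walk.tail_support_append, Walk.support_cons, Adj.toWalk, List.tail_cons,
        Walk.support_nil]
      rw [List.append_assoc]
      refine List.perm_append_comm.trans ?_
      rw [Walk.support_append, ← Walk.cons_tail_support b]
      simp
  · simp [Adj.toWalk]; omega

theorem exists_cons_of_mem_edges {v u t : V} {p : F.Walk v v} (hp : p.IsCycle)
    (hd : s(u, t) ∈ p.edges) :
    ∃ (h : F.Adj u t) (q : F.Walk t u), (Walk.cons h q).IsCycle ∧ q.length + 1 = p.length := by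
  have h : F.Adj u t := p.adj_of_mem_edges hd
  obtain ⟨d, hd1, hd2⟩ := List.mem_map.1 hd
  rcases d with ⟨⟨a, b⟩, hab⟩
  rcases (Sym2.eq_iff.1 hd2) with ⟨rfl, rfl⟩ | ⟨rfl, rfl⟩
  · obtain ⟨q, hq⟩ := exists_cons_of_mem_darts hp hab hd1
    exact ⟨hab, q, hq⟩
  · have : (⟨(b, a), h⟩ : F.Dart) ∈ p.reverse.darts := by
      rw [Walk.darts_reverse, List.mem_reverse, List.mem_map]
      exact ⟨_, hd1, rfl⟩
    obtain ⟨q, hq⟩ := exists_cons_of_mem_darts hp.reverse h this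
    exact ⟨h, q, by simpa using hq⟩

theorem exists_two_neighbours_of_isCycle {v w : V} {p : F.Walk v v} (hp : p.IsCycle)
    (hw : w ∈ p.support) : ∃ a b, a ≠ b ∧ F.Adj w a ∧ F.Adj w b := by
  classical
  have h := (Walk.isCycle_rotate hw).2 hp
  exact ⟨_, _, h.snd_ne_penultimate, Walk.adj_snd h.not_nil,
    (Walk.adj_penultimate h.not_nil).symm⟩

/-- If `w` has at most one neighbour in `F'` and all edges of `F'` missing `w` are edges of `F`,
then every cycle of `F'` is a cycle of `F`. -/
theorem CyclesGe.of_pendant {ℓ : ℕ} (hF : CyclesGe ℓ F) (w : V)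
    (h1 : ∀ a b, F'.Adj w a → F'.Adj w b → a = b)
    (h2 : ∀ a b, a ≠ w → b ≠ w → F'.Adj a b → F.Adj a b) : CyclesGe ℓ F' := by
  intro v p hp
  have hw : w ∉ p.support := by
    intro hw
    obtain ⟨a, b, hab, ha, hb⟩ := exists_two_neighbours_of_isCycle hp hw
    exact hab (h1 a b ha hb)
  have he : ∀ e ∈ p.edges, e ∈ F.edgeSet := by
    intro e
    induction e with | _ a b =>
    intro he
    refine h2 a b ?_ ?_ (p.adj_of_mem_edges he)
    · rintro rfl; exact hw (p.fst_mem_support_of_mem_edges he)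
    · rintro rfl; exact hw (p.snd_mem_support_of_mem_edges he)
  have := hF v (p.transfer F he) (hp.transfer he)
  simpa using this

/-- In a graph without short cycles, a walk joining the ends of a deleted edge is long. -/
theorem CyclesGe.le_length_of_not_adj {ℓ : ℕ} (hF : CyclesGe ℓ F) (hle : F' ≤ F) {y z : V}
    (hyz : F.Adj y z) (hn : ¬ F'.Adj y z) (p : F'.Walk y z) : ℓ ≤ p.length + 1 := by
  classical
  have hpath := p.bypass_isPath
  have hnot : s(z, y) ∉ (p.bypass.mapLe hle).edges := by
    rw [Walk.edges_mapLe_eq_edges]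
    intro h
    exact hn (p.bypass.adj_of_mem_edges h).symm
  have hc : (Walk.cons hyz.symm (p.bypass.mapLe hle)).IsCycle := by
    rw [Walk.cons_isCycle_iff]
    exact ⟨(Walk.isPath_mapLe hle).2 hpath, hnot⟩
  have h1 := hF z _ hc
  have h2 := p.length_bypass_le_length
  simp at h1
  omega

end Cycles

section Near

variable {V : Type*} {F : SimpleGraph V}

/-- `u` and `v` are joined by a walk of `F` of length at most `m`. -/
def Near (F : SimpleGraph V) (m : ℕ) (u v : V) : Prop := ∃ p : F.Walk u v, p.length ≤ m

theorem Near.refl (F : SimpleGraph V) (m : ℕ) (u : V) : Near F m u u := ⟨Walk.nil, by simp⟩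

theorem Near.symm {m : ℕ} {u v : V} (h : Near F m u v) : Near F m v u := by
  obtain ⟨p, hp⟩ := h
  exact ⟨p.reverse, by simpa using hp⟩

theorem Near.mono {m m' : ℕ} {u v : V} (h : Near F m u v) (hm : m ≤ m') : Near F m' u v := by
  obtain ⟨p, hp⟩ := h
  exact ⟨p, hp.trans hm⟩

theorem Near.trans {m m' : ℕ} {u v w : V} (h : Near F m u v) (h' : Near F m' v w) :
    Near F (m + m') u w := by
  obtain ⟨p, hp⟩ := h
  obtain ⟨q, hq⟩ := h'
  exact ⟨p.append q, by rw [Walk.length_append]; omega⟩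

theorem Near.of_adj {u v : V} (h : F.Adj u v) : Near F 1 u v := ⟨h.toWalk, by simp⟩

theorem near_zero {u v : V} : Near F 0 u v ↔ u = v := by
  constructor
  · rintro ⟨p, hp⟩
    exact p.eq_of_length_eq_zero (by omega)
  · rintro rfl; exact Near.refl _ _ _

theorem near_succ {m : ℕ} {u v : V} :
    Near F (m + 1) u v ↔ u = v ∨ ∃ w, Near F m u w ∧ F.Adj w v := by
  constructor
  · rintro ⟨p, hp⟩
    by_cases hn : p.Nil
    · left; exact hn.eq
    · right
      refine ⟨p.penultimate, ⟨p.dropLast, ?_⟩, p.adj_penultimate hn⟩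
      rw [Walk.length_dropLast]; omega
  · rintro (rfl | ⟨w, hw, h⟩)
    · exact Near.refl _ _ _
    · exact hw.trans (Near.of_adj h)

open Classical in
-- Every sphere has at most two vertices. Each vertex of a sphere chooses a neighbour in the
-- preceding sphere; this choice is injective, since a vertex chosen twice would have a third
-- neighbour, one step closer to `u`.
theorem card_near_le [Fintype V] (hF : DegLeTwo F) (u : V) (m : ℕ) :
    (Finset.univ.filter (fun v => Near F m u v)).card ≤ 2 * m + 1 := by
  -- spheres
  have key : ∀ m, (Finset.univ.filter (fun v => Near F (m+1) u v ∧ ¬ Near F m u v)).card ≤ 2 := by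
    intro m
    induction m with
    | zero =>
      by_contra! h
      obtain ⟨a, b, d, ha, hb, hd, hab, had, hbd⟩ := Finset.two_lt_card_iff.1 h
      simp only [Finset.mem_filter, Finset.mem_univ, true_and, near_succ, near_zero] at ha hb hd
      have f : ∀ a, (u = a ∨ ∃ w, u = w ∧ F.Adj w a) ∧ ¬ u = a → F.Adj u a := by
        rintro a ⟨h | ⟨w, rfl, h⟩, h'⟩
        · exact absurd h h'
        · exact h
      rcases hF u a b d (f _ ha) (f _ hb) (f _ hd) with h | h | h <;> contradiction
    | succ m ih =>
      refine le_trans ?_ ih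
      have hex : ∀ v ∈ Finset.univ.filter (fun v => Near F (m+1+1) u v ∧ ¬ Near F (m+1) u v),
          ∃ w, w ∈ Finset.univ.filter (fun v => Near F (m+1) u v ∧ ¬ Near F m u v) ∧
            F.Adj w v := by
        intro v hv
        simp only [Finset.mem_filter, Finset.mem_univ, true_and] at hv
        obtain ⟨h1, h2⟩ := hv
        rcases near_succ.1 h1 with rfl | ⟨w, hw, hwv⟩
        · exact absurd (Near.refl _ _ _) h2
        · refine ⟨w, ?_, hwv⟩
          simp only [Finset.mem_filter, Finset.mem_univ, true_and]
          exact ⟨hw, fun h => h2 (near_succ.2 (Or.inr ⟨w, h, hwv⟩))⟩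
      choose! f hf1 hf2 using hex
      refine Finset.card_le_card_of_injOn f hf1 ?_
      intro a ha b hb hab
      have h1 := hf1 a ha
      have ha2 := hf2 a ha
      have hb2 := hf2 b hb
      rw [← hab] at hb2
      simp only [Finset.coe_filter, Finset.mem_filter, Finset.mem_univ, true_and,
        Set.mem_ofPred_eq] at h1 ha hb
      rcases near_succ.1 h1.1 with h | ⟨w, hw, hwv⟩
      · exact absurd (h ▸ Near.refl _ _ _) h1.2
      · rcases hF _ _ _ _ ha2 hb2 hwv.symm with h | h | h
        · exact h
        · exact absurd (h ▸ hw.mono (by omega)) ha.2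
        · exact absurd (h ▸ hw.mono (by omega)) hb.2
  induction m with
  | zero =>
    simp only [near_zero]
    rw [Finset.filter_eq]
    simp
  | succ m ih =>
    have : Finset.univ.filter (fun v => Near F (m+1) u v) ⊆
        Finset.univ.filter (fun v => Near F m u v) ∪
        Finset.univ.filter (fun v => Near F (m+1) u v ∧ ¬ Near F m u v) := by
      intro v hv
      simp only [Finset.mem_union, Finset.mem_filter, Finset.mem_univ, true_and] at hv ⊢
      tauto
    have h1 := (Finset.card_le_card this).trans (Finset.card_union_le _ _)
    have h2 := key m
    omega

end Near

/-! ### Criticality -/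

section Critical

variable {V K : Type*} {G : SimpleGraph V} {c : Sym2 V → K}

theorem colourDegree_deleteEdges_eq {u v u₁ : V} (h : G.Adj u u₁) (hne : u₁ ≠ v)
    (hc : c s(u, u₁) = c s(u, v)) :
    colourDegree (G.deleteEdges {s(u, v)}) c u = colourDegree G c u := by
  unfold colourDegree
  congr 1
  ext k
  simp only [Set.mem_image, mem_neighborSet, deleteEdges_adj, Set.mem_singleton_iff]
  constructor
  · rintro ⟨w, ⟨h1, -⟩, h2⟩
    exact ⟨w, h1, h2⟩
  · rintro ⟨w, h1, h2⟩
    by_cases hw : w = v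
    · subst hw
      refine ⟨u₁, ⟨h, ?_⟩, hc.trans h2⟩
      intro h3
      exact hne (Sym2.congr_right.1 h3)
    · exact ⟨w, ⟨h1, fun h3 => hw (Sym2.congr_right.1 h3)⟩, h2⟩

/-- In a critical graph, no edge has the colour of another edge at each of its two ends. -/
theorem IsCritical.false_of_repeated (hG : IsCritical G c) {u v u₁ v₁ : V} (h : G.Adj u v)
    (hu : G.Adj u u₁) (hv : G.Adj v v₁) (h1 : u₁ ≠ v) (h2 : v₁ ≠ u)
    (hcu : c s(u, u₁) = c s(u, v)) (hcv : c s(v, v₁) = c s(u, v)) : False := by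
  have e1 := colourDegree_deleteEdges_eq hu h1 hcu
  have e2 := colourDegree_deleteEdges_eq hv h2 (by rw [hcv, Sym2.eq_swap] : c s(v, v₁) = c s(v, u))
  rw [Sym2.eq_swap] at e2
  rcases hG u v h with h3 | h3 <;> omega

end Critical

/-! ### Configurations and their decomposition into paths and cycles -/

/-- `F` is a properly coloured subgraph of `G` with vertex set `U` whose components are paths and
cycles of length at least `ℓ`, with at most one path among them. -/
structure IsConfig {V K : Type*} (G : SimpleGraph V) (c : Sym2 V → K) (ℓ : ℕ)
    (F : SimpleGraph V) (U : Set V) : Prop where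
  le : F ≤ G
  proper : ProperOn c F
  deg : DegLeTwo F
  cyc : CyclesGe ℓ F
  supp : ∀ u v, F.Adj u v → u ∈ U
  card : U.ncard ≤ F.edgeSet.ncard + 1

section Decomposition

variable {V : Type*} {F : SimpleGraph V}

theorem mem_of_reachable_of_closed {S : Set V} (hS : ∀ a b, a ∈ S → F.Adj a b → b ∈ S) {a b : V}
    (ha : a ∈ S) (h : F.Reachable a b) : b ∈ S := by
  obtain ⟨p⟩ := h
  induction p with
  | nil => exact ha
  | cons h p ih => exact ih (hS _ _ ha h)

/-- The cycle already uses two neighbours of `a`, and there is no third. So a cycle is a whole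
component. -/
theorem DegLeTwo.mem_edges_of_isCycle (hF : DegLeTwo F) {v : V} {q : F.Walk v v} (hq : q.IsCycle)
    {a b : V} (ha : a ∈ q.support) (hab : F.Adj a b) : s(a, b) ∈ q.edges := by
  obtain ⟨x, y, hxy, h⟩ := Set.ncard_eq_two.1 (hq.ncard_neighborSet_toSubgraph_eq_two ha)
  have hx : q.toSubgraph.Adj a x := by
    have : x ∈ q.toSubgraph.neighborSet a := by rw [h]; simp
    exact this
  have hy : q.toSubgraph.Adj a y := by
    have : y ∈ q.toSubgraph.neighborSet a := by rw [h]; simp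
    exact this
  rw [← Walk.adj_toSubgraph_iff_mem_edges]
  rcases hF a x y b hx.adj_sub hy.adj_sub hab with h | h | h
  · exact absurd h hxy
  · exact h ▸ hx
  · exact h ▸ hy

theorem DegLeTwo.mem_support_of_isCycle (hF : DegLeTwo F) {v : V} {q : F.Walk v v}
    (hq : q.IsCycle) {a b : V} (ha : a ∈ q.support) (hab : F.Reachable a b) : b ∈ q.support :=
  mem_of_reachable_of_closed (S := {a | a ∈ q.support})
    (fun _ _ ha hab => q.snd_mem_support_of_mem_edges (hF.mem_edges_of_isCycle hq ha hab)) ha hab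

theorem reachable_of_mem_support {u v a : V} (p : F.Walk u v) (h : a ∈ p.support) :
    F.Reachable u a := by
  classical exact ⟨p.takeUntil a h⟩

/-- `v` has at most one neighbour in `F`. -/
def IsLow (F : SimpleGraph V) (v : V) : Prop := ∀ a b, F.Adj v a → F.Adj v b → a = b

theorem exists_maximal_path [Finite V] (F : SimpleGraph V) (u : V) :
    ∃ (w : V) (p : F.Walk u w), p.IsPath ∧ ∀ b, F.Adj w b → b ∈ p.support := by
  classical
  have := Fintype.ofFinite V
  have hbdd : ∃ m, ∀ (w : V) (p : F.Walk u w), p.IsPath → p.length ≤ m :=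
    ⟨Fintype.card V, fun w p hp => hp.length_lt.le⟩
  let Q : ℕ → Prop := fun m => ∀ (w : V) (p : F.Walk u w), p.IsPath → p.length ≤ m
  have hm := Nat.find_spec (p := Q) hbdd
  set m := Nat.find (p := Q) hbdd with hmdef
  have : ∃ (w : V) (p : F.Walk u w), p.IsPath ∧ p.length = m := by
    by_contra! hcon
    rcases Nat.eq_zero_or_pos m with h0 | h0
    · exact hcon u Walk.nil Walk.IsPath.nil (by simp [h0])
    · have : Q (m - 1) := by
        intro w p hp
        have h1 := hm w p hp
        have h2 := hcon w p hp
        omega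
      have := Nat.find_min' hbdd this
      omega
  obtain ⟨w, p, hp, hlen⟩ := this
  refine ⟨w, p, hp, fun b hb => ?_⟩
  by_contra hn
  have := hm b (p.concat hb) (hp.concat hn hb)
  rw [Walk.length_concat] at this
  omega

/-- A path that cannot be extended either ends in a vertex of degree at most one or closes up to a
cycle. -/
theorem isLow_or_exists_isCycle (F : SimpleGraph V) {u w : V} (p : F.Walk u w) (hp : p.IsPath)
    (hmax : ∀ b, F.Adj w b → b ∈ p.support) :
    IsLow F w ∨ ∃ (v : V) (q : F.Walk v v), q.IsCycle ∧ w ∈ q.support := by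
  classical
  by_contra! hcon
  obtain ⟨h1, h2⟩ := hcon
  have key : ∀ a, F.Adj w a → a = p.penultimate := by
    intro a ha
    by_contra hne
    have hmem := hmax a ha
    have hd := hp.dropUntil hmem
    refine h2 w (Walk.cons ha (p.dropUntil a hmem)) ?_ (by simp)
    rw [Walk.cons_isCycle_iff]
    refine ⟨hd, fun he => hne ?_⟩
    have he' := p.edges_dropUntil_subset_edges hmem he
    exact hp.eq_penultimate_of_mem_edges (by rwa [Sym2.eq_swap] at he' ⊢)
  exact h1 fun a b ha hb => (key a ha).trans (key b hb).symm

/-- An inner vertex of the path has both its neighbours on the path, and an end has only one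
neighbour. The one-vertex path needs `hnil`, because `IsLow` still permits one edge there. -/
theorem mem_edges_of_isPath (hF : DegLeTwo F) {x w : V} {p : F.Walk x w} (hp : p.IsPath)
    (hx : IsLow F x) (hw : IsLow F w) (hnil : p.Nil → ∀ b, ¬ F.Adj x b) {a b : V}
    (ha : a ∈ p.support) (hab : F.Adj a b) : s(a, b) ∈ p.edges := by
  rw [← Walk.adj_toSubgraph_iff_mem_edges]
  by_cases hn : p.Nil
  · have : a = x := by
      cases hn; simpa using ha
    exact absurd hab (this ▸ hnil hn b)
  · obtain ⟨i, rfl, hi⟩ := Walk.mem_support_iff_exists_getVert.1 ha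
    have hpos : 0 < p.length := Walk.not_nil_iff_lt_length.1 hn
    rcases Nat.eq_zero_or_pos i with rfl | hi0
    · have h1 := p.toSubgraph_adj_getVert hpos
      rw [Walk.getVert_zero] at h1 hab ⊢
      exact hx _ _ h1.adj_sub hab ▸ h1
    · rcases hi.lt_or_eq with hlt | rfl
      · have h1 := p.toSubgraph_adj_getVert hlt
        have h2 := (p.toSubgraph_adj_getVert (i := i - 1) (by omega)).symm
        rw [Nat.sub_add_cancel hi0] at h2
        have hne : p.getVert (i - 1) ≠ p.getVert (i + 1) := by
          intro h
          have := hp.getVert_injOn (by simp; omega) (by simp; omega) h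
          omega
        rcases hF _ _ _ b h2.adj_sub h1.adj_sub hab with h | h | h
        · exact absurd h hne
        · exact h ▸ h2
        · exact h ▸ h1
      · have h2 := (p.toSubgraph_adj_getVert (i := p.length - 1) (by omega)).symm
        rw [Nat.sub_add_cancel hpos] at h2
        rw [Walk.getVert_length] at h2 hab ⊢
        exact hw _ _ h2.adj_sub hab ▸ h2

end Decomposition

section Handshake

variable {V : Type*} [Fintype V] {F : SimpleGraph V}

open Classical in
theorem degree_le_two (hF : DegLeTwo F) (v : V) : F.degree v ≤ 2 := by
  by_contra! h
  rw [← F.card_neighborFinset_eq_degree] at h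
  obtain ⟨a, b, d, ha, hb, hd, hab, had, hbd⟩ := Finset.two_lt_card_iff.1 h
  rw [mem_neighborFinset] at ha hb hd
  rcases hF v a b d ha hb hd with h | h | h <;> contradiction

open Classical in
theorem isLow_iff_degree_le_one {v : V} : IsLow F v ↔ F.degree v ≤ 1 := by
  rw [← F.card_neighborFinset_eq_degree, Finset.card_le_one]
  simp only [mem_neighborFinset, IsLow]
  constructor
  · intro h a ha b hb; exact h a b ha hb
  · intro h a b ha hb; exact h a ha b hb

open Classical in
theorem sum_degree_eq {U : Set V} (hU : ∀ u v, F.Adj u v → u ∈ U) :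
    ∑ v ∈ U.toFinset, F.degree v = 2 * F.edgeSet.ncard := by
  have h1 := F.sum_degrees_eq_twice_card_edges
  have h2 : F.edgeSet.ncard = F.edgeFinset.card := by
    rw [Set.ncard_eq_toFinset_card']
    rfl
  rw [h2, ← h1]
  refine Finset.sum_subset (Finset.subset_univ _) ?_
  intro v _ hv
  rw [← F.card_neighborFinset_eq_degree, Finset.card_eq_zero, Finset.eq_empty_iff_forall_notMem]
  intro w hw
  rw [mem_neighborFinset] at hw
  exact hv (by simpa using hU v w hw)

end Handshake

section Deficiency

variable {V : Type*} [Fintype V] {F : SimpleGraph V} {U : Set V}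

open Classical in
-- The sum equals `2(|U| - |E(F)|)`, twice the number of path components. A bound of two therefore
-- leaves room for two ends of degree one or for a single isolated vertex.
theorem sum_deficiency_le (hF : DegLeTwo F) (hU : ∀ u v, F.Adj u v → u ∈ U)
    (hcard : U.ncard ≤ F.edgeSet.ncard + 1) :
    ∑ v ∈ U.toFinset, (2 - F.degree v) ≤ 2 := by
  have h1 := sum_degree_eq hU
  have h2 : ∑ v ∈ U.toFinset, (2 - F.degree v) + ∑ v ∈ U.toFinset, F.degree v
      = 2 * U.toFinset.card := by
    rw [← Finset.sum_add_distrib, Finset.sum_congr rfl (g := fun _ => 2)]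
    · simp [mul_comm]
    · intro v _
      have := degree_le_two hF v
      omega
  rw [Set.ncard_eq_toFinset_card'] at hcard
  omega

/-- If `x ≠ w` both have degree at most one then all other vertices have degree two. -/
theorem eq_or_eq_of_isLow (hF : DegLeTwo F) (hU : ∀ u v, F.Adj u v → u ∈ U)
    (hcard : U.ncard ≤ F.edgeSet.ncard + 1) {x w y : V} (hx : x ∈ U) (hw : w ∈ U) (hy : y ∈ U)
    (lx : IsLow F x) (lw : IsLow F w) (ly : IsLow F y) (hxw : x ≠ w) : y = x ∨ y = w := by
  classical
  by_contra! hcon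
  have h := sum_deficiency_le hF hU hcard
  have hsub : ({x, w, y} : Finset V) ⊆ U.toFinset := by
    intro z hz
    simp only [Finset.mem_insert, Finset.mem_singleton] at hz
    rcases hz with rfl | rfl | rfl <;> simpa
  have h2 := (Finset.sum_le_sum_of_subset (f := fun v => 2 - F.degree v) hsub).trans h
  rw [Finset.sum_insert (by simp [hxw, hcon.1.symm]), Finset.sum_insert (by simp [hcon.2.symm]),
    Finset.sum_singleton] at h2
  rw [isLow_iff_degree_le_one] at lx lw ly
  omega

theorem eq_of_isolated (hF : DegLeTwo F) (hU : ∀ u v, F.Adj u v → u ∈ U)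
    (hcard : U.ncard ≤ F.edgeSet.ncard + 1) {x y : V} (hx : x ∈ U) (hy : y ∈ U)
    (lx : ∀ b, ¬ F.Adj x b) (ly : IsLow F y) : y = x := by
  classical
  by_contra! hcon
  have h := sum_deficiency_le hF hU hcard
  have hsub : ({x, y} : Finset V) ⊆ U.toFinset := by
    intro z hz
    simp only [Finset.mem_insert, Finset.mem_singleton] at hz
    rcases hz with rfl | rfl <;> simpa
  have h2 := (Finset.sum_le_sum_of_subset (f := fun v => 2 - F.degree v) hsub).trans h
  rw [Finset.sum_insert (by simp [hcon.symm]), Finset.sum_singleton] at h2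
  rw [isLow_iff_degree_le_one] at ly
  have : F.degree x = 0 := by
    rw [← F.card_neighborFinset_eq_degree, Finset.card_eq_zero, Finset.eq_empty_iff_forall_notMem]
    intro w hw
    rw [mem_neighborFinset] at hw
    exact lx w hw
  omega

end Deficiency

section Proper

variable {V K : Type*} {G F : SimpleGraph V} {c : Sym2 V → K} {ℓ : ℕ} {U : Set V}

theorem IsConfig.isProperlyColoured (h : IsConfig G c ℓ F U) {H : G.Subgraph}
    (hH : ∀ a b, H.Adj a b → F.Adj a b) : IsProperlyColoured c H :=
  fun u v w huv huw hne => h.proper u v w (hH _ _ huv) (hH _ _ huw) hne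

end Proper

section Structure

variable {V K : Type*} [Fintype V] {G F : SimpleGraph V} {c : Sym2 V → K} {ℓ : ℕ} {U : Set V}

/-- The possible path component: no vertex of low degree, or a path containing all of them. -/
theorem IsConfig.exists_path (h : IsConfig G c ℓ F U) :
    (∀ x ∈ U, ¬ IsLow F x) ∨ ∃ (x w : V) (p : F.Walk x w), p.IsPath ∧ x ∈ U ∧ IsLow F x ∧
      (∀ y ∈ U, IsLow F y → y ∈ p.support) ∧
      (∀ a b, a ∈ p.support → F.Adj a b → s(a, b) ∈ p.edges) := by
  classical
  by_cases hlow : ∀ x ∈ U, ¬ IsLow F x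
  · exact Or.inl hlow
  right
  push Not at hlow
  obtain ⟨x, hxU, hx⟩ := hlow
  obtain ⟨w, p, hp, hmax⟩ := exists_maximal_path F x
  have hw : IsLow F w := by
    rcases isLow_or_exists_isCycle F p hp hmax with h1 | ⟨v, q, hq, hwq⟩
    · exact h1
    · exfalso
      have hxq : x ∈ q.support := h.deg.mem_support_of_isCycle hq hwq ⟨p.reverse⟩
      obtain ⟨a, b, hab, ha, hb⟩ := exists_two_neighbours_of_isCycle hq hxq
      exact hab (hx a b ha hb)
  have hnil : p.Nil → ∀ b, ¬ F.Adj x b := by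
    intro hn b hb
    cases hn
    have := hmax b hb
    simp at this
    exact F.loopless.irrefl x (this ▸ hb)
  refine ⟨x, w, p, hp, hxU, hx, ?_, fun a b ha hab => mem_edges_of_isPath h.deg hp hx hw hnil ha hab⟩
  intro y hyU hy
  by_cases hn : p.Nil
  · have := eq_of_isolated h.deg h.supp h.card hxU hyU (hnil hn) hy
    rw [this]; simp
  · have hxw : x ≠ w := fun e => hn (hp.nil_iff_eq.2 e)
    have hwU : w ∈ U := h.supp _ _ (p.adj_penultimate hn).symm
    rcases eq_or_eq_of_isLow h.deg h.supp h.card hxU hwU hyU hx hw hy hxw with rfl | rfl <;> simp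

/-- A vertex that is not on the path component lies on a cycle. -/
theorem IsConfig.exists_cycle (h : IsConfig G c ℓ F U) {T : Set V}
    (hT : ∀ a b, a ∈ T → F.Adj a b → b ∈ T) (hlow : ∀ y ∈ U, IsLow F y → y ∈ T) {u : V}
    (hu : u ∈ U) (huT : u ∉ T) : ∃ (v : V) (q : F.Walk v v), q.IsCycle ∧ u ∈ q.support := by
  obtain ⟨w, p, hp, hmax⟩ := exists_maximal_path F u
  rcases isLow_or_exists_isCycle F p hp hmax with h1 | ⟨v, q, hq, hwq⟩
  · exfalso
    have hwU : w ∈ U := mem_of_reachable_of_closed (fun a b _ hab => h.supp b a hab.symm) hu ⟨p⟩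
    exact huT (mem_of_reachable_of_closed hT (hlow w hwU h1) ⟨p.reverse⟩)
  · exact ⟨v, q, hq, h.deg.mem_support_of_isCycle hq hwq ⟨p.reverse⟩⟩

/-- The components of a configuration. -/
theorem IsConfig.exists_components (h : IsConfig G c ℓ F U) :
    ∃ (S : Set G.Subgraph) (P : G.Subgraph),
      (∀ C ∈ S, ∃ (v : V) (q : F.Walk v v), q.IsCycle ∧ (q.mapLe h.le).toSubgraph = C) ∧
      (P = ⊥ ∨ ∃ (u v : V) (p : F.Walk u v), p.IsPath ∧ (p.mapLe h.le).toSubgraph = P) ∧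
      (∀ C ∈ S, ∀ D ∈ S, C ≠ D → Disjoint C.verts D.verts) ∧
      (∀ C ∈ S, Disjoint C.verts P.verts) ∧
      (∀ a, a ∈ U ↔ (∃ C ∈ S, a ∈ C.verts) ∨ a ∈ P.verts) ∧
      (∀ a b, F.Adj a b ↔ (∃ C ∈ S, C.Adj a b) ∨ P.Adj a b) := by
  let S : Set G.Subgraph :=
    {C | ∃ (v : V) (q : F.Walk v v), q.IsCycle ∧ (q.mapLe h.le).toSubgraph = C}
  have hSmem : ∀ {v : V} {q : F.Walk v v} (a : V), a ∈ (q.mapLe h.le).toSubgraph.verts ↔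
      a ∈ q.support := by
    intro v q a
    rw [Walk.mem_verts_toSubgraph, Walk.support_mapLe_eq_support]
  have hSadj : ∀ {v w : V} {q : F.Walk v w} (a b : V), (q.mapLe h.le).toSubgraph.Adj a b ↔
      s(a, b) ∈ q.edges := by
    intro v w q a b
    rw [Walk.adj_toSubgraph_iff_mem_edges, Walk.edges_mapLe_eq_edges]
  have hsubU : ∀ {v : V} {q : F.Walk v v}, q.IsCycle → ∀ a ∈ q.support, a ∈ U := by
    intro v q hq a ha
    obtain ⟨x, y, -, hx, -⟩ := exists_two_neighbours_of_isCycle hq ha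
    exact h.supp _ _ hx
  have hdisj : ∀ C ∈ S, ∀ D ∈ S, C ≠ D → Disjoint C.verts D.verts := by
    rintro _ ⟨v, q, hq, rfl⟩ _ ⟨v', q', hq', rfl⟩ hne
    rw [Set.disjoint_left]
    intro a ha ha'
    rw [hSmem] at ha ha'
    apply hne
    have hmem : ∀ b, b ∈ q.support ↔ b ∈ q'.support := by
      intro b
      constructor
      · intro hb
        exact h.deg.mem_support_of_isCycle hq' ha'
          ((reachable_of_mem_support q ha).symm.trans (reachable_of_mem_support q hb))
      · intro hb
        exact h.deg.mem_support_of_isCycle hq ha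
          ((reachable_of_mem_support q' ha').symm.trans (reachable_of_mem_support q' hb))
    ext a b
    · rw [hSmem, hSmem]; exact hmem a
    · rw [hSadj, hSadj]
      constructor
      · intro he
        exact h.deg.mem_edges_of_isCycle hq' ((hmem a).1 (q.fst_mem_support_of_mem_edges he))
          (q.adj_of_mem_edges he)
      · intro he
        exact h.deg.mem_edges_of_isCycle hq ((hmem a).2 (q'.fst_mem_support_of_mem_edges he))
          (q'.adj_of_mem_edges he)
  rcases h.exists_path with hlow | ⟨x, w, p, hp, hxU, hx, hlow, hclosed⟩
  · have hcy : ∀ u ∈ U, ∃ (v : V) (q : F.Walk v v), q.IsCycle ∧ u ∈ q.support := fun u hu =>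
      h.exists_cycle (T := ∅) (by simp) (fun y hy hl => absurd hl (hlow y hy)) hu (by simp)
    refine ⟨S, ⊥, fun C hC => hC, Or.inl rfl, hdisj, by simp, ?_, ?_⟩
    · intro a
      constructor
      · intro ha
        obtain ⟨v, q, hq, haq⟩ := hcy a ha
        exact Or.inl ⟨_, ⟨v, q, hq, rfl⟩, (hSmem a).2 haq⟩
      · rintro (⟨_, ⟨v, q, hq, rfl⟩, ha⟩ | ha)
        · exact hsubU hq a ((hSmem a).1 ha)
        · simp at ha
    · intro a b
      constructor
      · intro hab
        obtain ⟨v, q, hq, haq⟩ := hcy a (h.supp a b hab)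
        exact Or.inl ⟨_, ⟨v, q, hq, rfl⟩, (hSadj a b).2 (h.deg.mem_edges_of_isCycle hq haq hab)⟩
      · rintro (⟨_, ⟨v, q, hq, rfl⟩, ha⟩ | ha)
        · exact q.adj_of_mem_edges ((hSadj a b).1 ha)
        · simp at ha
  · have hT : ∀ a b, a ∈ {a | a ∈ p.support} → F.Adj a b → b ∈ {a | a ∈ p.support} :=
      fun a b ha hab => p.snd_mem_support_of_mem_edges (hclosed a b ha hab)
    have hcy : ∀ u ∈ U, u ∉ p.support → ∃ (v : V) (q : F.Walk v v), q.IsCycle ∧ u ∈ q.support :=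
      fun u hu hn => h.exists_cycle hT hlow hu hn
    have hpm : ∀ a, a ∈ (p.mapLe h.le).toSubgraph.verts ↔ a ∈ p.support := by
      intro a
      rw [Walk.mem_verts_toSubgraph, Walk.support_mapLe_eq_support]
    refine ⟨S, (p.mapLe h.le).toSubgraph, fun C hC => hC, Or.inr ⟨x, w, p, hp, rfl⟩, hdisj,
      ?_, ?_, ?_⟩
    · rintro _ ⟨v, q, hq, rfl⟩
      rw [Set.disjoint_left]
      intro a ha ha'
      rw [hSmem] at ha
      rw [hpm] at ha'
      have hxq := h.deg.mem_support_of_isCycle hq ha (reachable_of_mem_support p ha').symm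
      obtain ⟨a, b, hab, ha, hb⟩ := exists_two_neighbours_of_isCycle hq hxq
      exact hab (hx a b ha hb)
    · intro a
      constructor
      · intro ha
        by_cases hap : a ∈ p.support
        · exact Or.inr ((hpm a).2 hap)
        · obtain ⟨v, q, hq, haq⟩ := hcy a ha hap
          exact Or.inl ⟨_, ⟨v, q, hq, rfl⟩, (hSmem a).2 haq⟩
      · rintro (⟨_, ⟨v, q, hq, rfl⟩, ha⟩ | ha)
        · exact hsubU hq a ((hSmem a).1 ha)
        · exact mem_of_reachable_of_closed (fun a b _ hab => h.supp b a hab.symm) hxU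
            (reachable_of_mem_support p ((hpm a).1 ha))
    · intro a b
      constructor
      · intro hab
        by_cases hap : a ∈ p.support
        · exact Or.inr ((hSadj a b).2 (hclosed a b hap hab))
        · obtain ⟨v, q, hq, haq⟩ := hcy a (h.supp a b hab) hap
          exact Or.inl ⟨_, ⟨v, q, hq, rfl⟩, (hSadj a b).2 (h.deg.mem_edges_of_isCycle hq haq hab)⟩
      · rintro (⟨_, ⟨v, q, hq, rfl⟩, ha⟩ | ha)
        · exact q.adj_of_mem_edges ((hSadj a b).1 ha)
        · exact p.adj_of_mem_edges ((hSadj a b).1 ha)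

/-- A configuration is a properly coloured `1`-path-cycle without short cycles. -/
theorem IsConfig.exists_onePathCycle (h : IsConfig G c ℓ F U) :
    ∃ H : G.Subgraph, IsOnePathCycle H ∧ IsProperlyColoured c H ∧ H.verts = U ∧
      ∀ (x : V) (p : G.Walk x x), p.IsCycle → p.toSubgraph ≤ H → ℓ ≤ p.length := by
  obtain ⟨S, P, hS, hP, hd, hdP, hU, hadj⟩ := h.exists_components
  have hadj' : ∀ a b, (sSup S ⊔ P).Adj a b ↔ F.Adj a b := by
    intro a b
    rw [hadj, Subgraph.sup_adj, Subgraph.sSup_adj]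
  refine ⟨sSup S ⊔ P, ⟨S, P, ?_, ?_, hd, hdP, rfl⟩, ?_, ?_, ?_⟩
  · intro C hC
    obtain ⟨v, q, hq, rfl⟩ := hS C hC
    exact ⟨v, q.mapLe h.le, (Walk.isCycle_mapLe h.le).2 hq, rfl⟩
  · refine hP.imp id ?_
    rintro ⟨u, v, p, hp, rfl⟩
    exact ⟨u, v, p.mapLe h.le, (Walk.isPath_mapLe h.le).2 hp, rfl⟩
  · exact h.isProperlyColoured fun a b => (hadj' a b).1
  · ext a
    rw [hU, Subgraph.verts_sup, Subgraph.verts_sSup]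
    simp
  · intro x p hp hle
    have he : ∀ e ∈ p.edges, e ∈ F.edgeSet := by
      intro e
      induction e with | _ a b =>
      intro he
      exact (hadj' a b).1 (hle.2 (Walk.adj_toSubgraph_iff_mem_edges.2 he))
    simpa using h.cyc x (p.transfer F he) (hp.transfer he)

/-- A configuration splits into few paths. -/
theorem IsConfig.exists_paths (h : IsConfig G c ℓ F U) :
    ∃ (k : ℕ) (P : Fin k → G.Subgraph), (k - 1) * ℓ ≤ U.ncard ∧
      (∀ i, IsPathSubgraph (P i) ∧ IsProperlyColoured c (P i)) ∧
      (∀ i j, i ≠ j → Disjoint (P i).verts (P j).verts) ∧ (⋃ i, (P i).verts) = U := by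
  classical
  obtain ⟨S, P, hS, hP, hd, hdP, hU, hadj⟩ := h.exists_components
  have hfin : S.Finite := Set.toFinite S
  have hopen : ∀ C ∈ S, ∃ Q : G.Subgraph, IsPathSubgraph Q ∧ Q.verts = C.verts ∧
      (∀ a b, Q.Adj a b → F.Adj a b) ∧ ℓ ≤ C.verts.ncard := by
    intro C hC
    obtain ⟨v, q, hq, rfl⟩ := hS C hC
    -- Dropping the first step of the closed walk deletes one edge of the cycle and keeps all its
    -- vertices.
    refine ⟨(q.tail.mapLe h.le).toSubgraph,
      ⟨_, _, _, (Walk.isPath_mapLe h.le).2 hq.isPath_tail, rfl⟩, ?_, ?_, ?_⟩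
    · ext a
      rw [Walk.mem_verts_toSubgraph, Walk.mem_verts_toSubgraph, Walk.support_mapLe_eq_support,
        Walk.support_mapLe_eq_support, Walk.support_tail_of_not_nil _ hq.not_nil]
      constructor
      · intro ha; exact List.mem_of_mem_tail ha
      · intro ha
        rw [← Walk.cons_tail_support q] at ha
        rcases List.mem_cons.1 ha with rfl | ha
        · exact Walk.end_mem_tail_support hq.not_nil
        · exact ha
    · intro a b hab
      rw [Walk.adj_toSubgraph_iff_mem_edges, Walk.edges_mapLe_eq_edges] at hab
      exact q.tail.adj_of_mem_edges hab
    · have h1 := h.cyc v q hq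
      have h2 : (q.mapLe h.le).toSubgraph.verts = (q.support.tail.toFinset : Set V) := by
        ext a
        rw [Walk.mem_verts_toSubgraph, Walk.support_mapLe_eq_support, Finset.mem_coe,
          List.mem_toFinset]
        constructor
        · intro ha
          rw [← Walk.cons_tail_support q] at ha
          rcases List.mem_cons.1 ha with rfl | ha
          · exact Walk.end_mem_tail_support hq.not_nil
          · exact ha
        · intro ha; exact List.mem_of_mem_tail ha
      rw [h2, Set.ncard_coe_finset, List.toFinset_card_of_nodup hq.support_nodup]
      simpa using h1
  choose! Q hQ1 hQ2 hQ3 hQ4 using hopen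
  let e := hfin.toFinset.equivFin.symm
  have heS : ∀ i, ((e i : hfin.toFinset) : G.Subgraph) ∈ S := fun i =>
    hfin.mem_toFinset.1 (e i).2
  have hcard : hfin.toFinset.card * ℓ ≤ U.ncard := by
    have h1 : (⋃ C ∈ hfin.toFinset, C.verts) ⊆ U := by
      intro a ha
      simp only [Set.mem_iUnion] at ha
      obtain ⟨C, hC, ha⟩ := ha
      exact (hU a).2 (Or.inl ⟨C, hfin.mem_toFinset.1 hC, ha⟩)
    have h2 : ((hfin.toFinset.biUnion fun C => C.verts.toFinset) : Set V) ⊆ U := by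
      intro a ha
      apply h1
      simpa using ha
    have h3 := Set.ncard_le_ncard h2 (Set.toFinite _)
    rw [Set.ncard_coe_finset, Finset.card_biUnion] at h3
    · refine le_trans ?_ h3
      rw [← smul_eq_mul]
      refine Finset.card_nsmul_le_sum _ _ _ ?_
      intro C hC
      rw [← Set.ncard_eq_toFinset_card']
      exact hQ4 C (hfin.mem_toFinset.1 hC)
    · intro C hC D hD hne
      rw [Function.onFun, Set.disjoint_toFinset]
      exact hd C (hfin.mem_toFinset.1 hC) D (hfin.mem_toFinset.1 hD) hne
  have hQprop : ∀ C ∈ S, IsProperlyColoured c (Q C) := fun C hC =>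
    h.isProperlyColoured (hQ3 C hC)
  have hQdisj : ∀ i j, i ≠ j → Disjoint (Q (e i)).verts (Q (e j)).verts := by
    intro i j hij
    rw [hQ2 _ (heS i), hQ2 _ (heS j)]
    exact hd _ (heS i) _ (heS j) fun he => hij (e.injective (Subtype.ext he))
  have hcov : ∀ a, (∃ i, a ∈ (Q (e i)).verts) ↔ ∃ C ∈ S, a ∈ C.verts := by
    intro a
    constructor
    · rintro ⟨i, hi⟩
      exact ⟨_, heS i, by rwa [← hQ2 _ (heS i)]⟩
    · rintro ⟨C, hC, ha⟩
      refine ⟨e.symm ⟨C, hfin.mem_toFinset.2 hC⟩, ?_⟩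
      rw [Equiv.apply_symm_apply, hQ2 C hC]
      exact ha
  -- The cycles alone give `k * ℓ ≤ |U|`. A path component, placed at index `0`, need not be long
  -- and accounts for the `k - 1`.
  rcases hP with rfl | ⟨u, v, p, hp, rfl⟩
  · refine ⟨_, fun i => Q (e i), le_trans (Nat.mul_le_mul_right _ (Nat.sub_le _ _)) hcard,
      fun i => ⟨hQ1 _ (heS i), hQprop _ (heS i)⟩, hQdisj, ?_⟩
    ext a
    rw [hU, Set.mem_iUnion, hcov]
    simp
  · refine ⟨_, Fin.cons (p.mapLe h.le).toSubgraph fun i => Q (e i), by simpa using hcard,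
      ?_, ?_, ?_⟩
    · intro i
      refine Fin.cases ?_ (fun i => ?_) i
      · refine ⟨⟨u, v, _, (Walk.isPath_mapLe h.le).2 hp, rfl⟩, h.isProperlyColoured ?_⟩
        intro a b hab
        exact (hadj a b).2 (Or.inr hab)
      · exact ⟨hQ1 _ (heS i), hQprop _ (heS i)⟩
    · intro i j
      refine Fin.cases ?_ (fun i => ?_) i <;> refine Fin.cases ?_ (fun j => ?_) j
      · intro h; exact absurd rfl h
      · intro _
        simp only [Fin.cons_zero, Fin.cons_succ]
        rw [hQ2 _ (heS j)]
        exact (hdP _ (heS j)).symm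
      · intro _
        simp only [Fin.cons_zero, Fin.cons_succ]
        rw [hQ2 _ (heS i)]
        exact hdP _ (heS i)
      · intro hij
        simp only [Fin.cons_succ]
        exact hQdisj i j fun he => hij (by rw [he])
    · ext a
      rw [hU, Set.mem_iUnion, ← hcov, Fin.exists_fin_succ, or_comm]
      simp

end Structure

/-! ### Local modifications and rotations -/

section EditEdges

variable {V : Type*} {F : SimpleGraph V}

/-- `F` with the edge `ab` added. -/
def addEdge (F : SimpleGraph V) (a b : V) : SimpleGraph V := F ⊔ edge a b

/-- `F` with the edge `ab` deleted. -/
def delEdge (F : SimpleGraph V) (a b : V) : SimpleGraph V := F.deleteEdges {s(a, b)}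

theorem addEdge_adj {a b : V} (h : a ≠ b) {u v : V} :
    (addEdge F a b).Adj u v ↔ F.Adj u v ∨ (u = a ∧ v = b) ∨ (u = b ∧ v = a) := by
  rw [addEdge, sup_adj, edge_adj]
  constructor
  · rintro (h | ⟨h, -⟩)
    · exact Or.inl h
    · exact Or.inr h
  · rintro (h1 | h1)
    · exact Or.inl h1
    · refine Or.inr ⟨h1, ?_⟩
      rcases h1 with ⟨rfl, rfl⟩ | ⟨rfl, rfl⟩
      · exact h
      · exact h.symm

theorem delEdge_adj {a b u v : V} :
    (delEdge F a b).Adj u v ↔ F.Adj u v ∧ ¬ ((u = a ∧ v = b) ∨ (u = b ∧ v = a)) := by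
  rw [delEdge, deleteEdges_adj, Set.mem_singleton_iff, Sym2.eq_iff]

theorem delEdge_le {a b : V} : delEdge F a b ≤ F := fun _ _ h => (delEdge_adj.1 h).1

theorem edgeSet_ncard_addEdge [Finite V] {a b : V} (h : a ≠ b) (hn : ¬ F.Adj a b) :
    (addEdge F a b).edgeSet.ncard = F.edgeSet.ncard + 1 := by
  have : (addEdge F a b).edgeSet = insert s(a, b) F.edgeSet := by
    ext e
    induction e with | _ u v =>
    rw [mem_edgeSet, addEdge_adj h, Set.mem_insert_iff, Sym2.eq_iff, mem_edgeSet, or_comm]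
  rw [this, Set.ncard_insert_of_notMem (by simpa using hn) (Set.toFinite _)]

theorem edgeSet_ncard_delEdge [Finite V] {a b : V} (hn : F.Adj a b) :
    (delEdge F a b).edgeSet.ncard + 1 = F.edgeSet.ncard := by
  have : (delEdge F a b).edgeSet = F.edgeSet \ {s(a, b)} := by
    ext e
    induction e with | _ u v =>
    rw [mem_edgeSet, delEdge_adj, Set.mem_sdiff, Set.mem_singleton_iff, Sym2.eq_iff, mem_edgeSet]
  rw [this]
  exact Set.ncard_sdiff_singleton_add_one (by simpa using hn) (Set.toFinite _)

theorem ProperOn.addEdge {K : Type*} {c : Sym2 V → K} (h : ProperOn c F) {a b : V} (hne : a ≠ b)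
    (ca : ∀ u, F.Adj a u → c s(a, b) ≠ c s(a, u)) (cb : ∀ u, F.Adj b u → c s(a, b) ≠ c s(b, u)) :
    ProperOn c (addEdge F a b) := by
  have hadj := fun u v => addEdge_adj (F := F) hne (u := u) (v := v)
  have cb' : ∀ u, F.Adj b u → c s(b, a) ≠ c s(b, u) := by
    intro u hu; rw [Sym2.eq_swap]; exact cb u hu
  intro u v w huv huw hvw
  rcases (hadj u v).1 huv with h1 | ⟨rfl, rfl⟩ | ⟨rfl, rfl⟩ <;>
  rcases (hadj u w).1 huw with h2 | ⟨h2, h3⟩ | ⟨h2, h3⟩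
  · exact h u v w h1 h2 hvw
  · subst h2 h3; exact (ca v h1).symm
  · subst h2 h3; exact (cb' v h1).symm
  · exact ca w h2
  · exact absurd h3.symm hvw
  · exact absurd h2 hne
  · exact cb' w h2
  · exact absurd h2.symm hne
  · exact absurd h3.symm hvw

theorem DegLeTwo.addEdge (h : DegLeTwo F) {a b : V} (hne : a ≠ b)
    (la : ∀ u v, F.Adj a u → F.Adj a v → u = v) (lb : ∀ u v, F.Adj b u → F.Adj b v → u = v) :
    DegLeTwo (addEdge F a b) := by
  have hadj := fun u v => addEdge_adj (F := F) hne (u := u) (v := v)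
  intro u v₁ v₂ v₃ h1 h2 h3
  have := h u v₁ v₂ v₃
  rw [hadj] at h1 h2 h3
  have e1 := la v₁ v₂
  have e2 := la v₁ v₃
  have e3 := la v₂ v₃
  have f1 := lb v₁ v₂
  have f2 := lb v₁ v₃
  have f3 := lb v₂ v₃
  grind

end EditEdges

/-- `F` arises from `F₀` by edge changes inside the set `M`, whose vertices are pairwise far apart
along the common part, with at most one new edge at each vertex of `F₀`. -/
structure Modif {V K : Type*} (G : SimpleGraph V) (c : Sym2 V → K) (ℓ : ℕ)
    (F₀ F : SimpleGraph V) (M : Set V) : Prop where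
  le : F ≤ G
  proper : ProperOn c F
  deg : DegLeTwo F
  changed : ∀ u v, u ∉ M → (F.Adj u v ↔ F₀.Adj u v)
  added_unique : ∀ u k v w, F₀.Adj u k → F.Adj u v → ¬ F₀.Adj u v → F.Adj u w → ¬ F₀.Adj u w →
    v = w
  added_old : ∀ u v, F.Adj u v → ¬ F₀.Adj u v → (∃ k, F₀.Adj u k) ∨ ∃ k, F₀.Adj v k
  sep : ∀ t ∈ M, ∀ t' ∈ M, t ≠ t' → ∀ p : (F ⊓ F₀).Walk t t', ℓ ≤ p.length + 1

section Modif

variable {V K : Type*} {G : SimpleGraph V} {c : Sym2 V → K} {ℓ : ℕ} {F₀ F : SimpleGraph V}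
  {M : Set V}

/-- Take `t` to be the first vertex of `M` on `q`. Every edge before it starts at an unmodified
vertex and so belongs to both graphs. -/
theorem Modif.exists_common_walk (h : Modif G c ℓ F₀ F M) {s u : V} (q : F.Walk s u) (hu : u ∈ M) :
    ∃ t ∈ M, ∃ q' : (F ⊓ F₀).Walk s t, q'.length ≤ q.length ∧ t ∈ q.support := by
  induction q with
  | nil => exact ⟨_, hu, Walk.nil, by simp, by simp⟩
  | @cons a b w hab q ih =>
    by_cases ha : a ∈ M
    · exact ⟨a, ha, Walk.nil, by simp, by simp⟩
    · obtain ⟨t, ht, q', h1, h2⟩ := ih hu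
      have : (F ⊓ F₀).Adj a b := ⟨hab, (h.changed a b ha).1 hab⟩
      exact ⟨t, ht, Walk.cons this q', by simpa using h1, by simp [h2]⟩

/-- A modification creates no short cycles. -/
theorem Modif.cyclesGe (h : Modif G c ℓ F₀ F M) (hc : CyclesGe ℓ F₀) : CyclesGe ℓ F := by
  intro v p hp
  by_cases hall : ∀ e ∈ p.edges, e ∈ F₀.edgeSet
  · simpa using hc v (p.transfer F₀ hall) (hp.transfer hall)
  push Not at hall
  obtain ⟨e, he, heF⟩ := hall
  -- Follow the cycle from the new edge through its end `t`, which has an edge of `F₀`. By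
  -- `added_unique` the next edge is old, and from there the cycle runs along common edges up to the
  -- next vertex of `M`; `sep` makes this stretch long.
  have key : ∀ u t, s(u, t) ∈ p.edges → ¬ F₀.Adj u t → (∃ k, F₀.Adj t k) → ℓ ≤ p.length := by
    rintro u t hut hn ⟨k, hk⟩
    obtain ⟨hadj, q, hq, hlen⟩ := exists_cons_of_mem_edges hp hut
    rw [Walk.cons_isCycle_iff] at hq
    obtain ⟨hqp, hqe⟩ := hq
    cases q with
    | nil => exact absurd hadj (F.loopless.irrefl _)
    | @cons _ s _ hts q1 =>
      have hold : F₀.Adj t s := by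
        by_contra hns
        have := h.added_unique t k s u hk hts hns hadj.symm fun h => hn h.symm
        subst this
        apply hqe
        simp [Sym2.eq_swap]
      have huM : u ∈ M := by
        by_contra hu
        exact hn ((h.changed u t hu).1 hadj)
      have htM : t ∈ M := by
        by_contra hu
        exact hn ((h.changed t u hu).1 hadj.symm).symm
      obtain ⟨t', ht', q', h1, h2⟩ := h.exists_common_walk q1 huM
      rw [Walk.cons_isPath_iff] at hqp
      have hne : t ≠ t' := fun e => hqp.2 (e ▸ h2)
      have := h.sep t htM t' ht' hne (Walk.cons (show (F ⊓ F₀).Adj t s from ⟨hts, hold⟩) q')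
      simp at this hlen
      omega
  induction e with | _ u t =>
  rw [mem_edgeSet] at heF
  rcases h.added_old u t (p.adj_of_mem_edges he) heF with hk | hk
  · exact key t u (by rwa [Sym2.eq_swap]) (fun h => heF h.symm) hk
  · exact key u t he heF hk

/-- A walk of a modified graph from a vertex far from the modifications to a modified vertex is
long. -/
theorem Modif.not_near (h : Modif G c ℓ F₀ F M) {m : ℕ} {s u : V} (hu : u ∈ M)
    (hs : ∀ t ∈ M, ¬ Near F₀ m t s) : ¬ Near F m s u := by
  rintro ⟨q, hq⟩
  obtain ⟨t, ht, q', h1, -⟩ := h.exists_common_walk q hu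
  exact hs t ht (Near.symm ⟨q'.mapLe inf_le_right, by rw [Walk.length_mapLe]; omega⟩)

theorem le_length_of_not_near {F' : SimpleGraph V} (hle : F' ≤ F₀) {t u : V}
    (h : ¬ Near F₀ ℓ t u) (p : F'.Walk t u) : ℓ ≤ p.length + 1 := by
  by_contra hlt
  exact h ⟨p.mapLe hle, by rw [Walk.length_mapLe]; omega⟩

theorem Modif.refl (hle : F₀ ≤ G) (hp : ProperOn c F₀) (hd : DegLeTwo F₀)
    (hM : ∀ t ∈ M, ∀ t' ∈ M, t ≠ t' → ¬ Near F₀ ℓ t t') : Modif G c ℓ F₀ F₀ M where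
  le := hle
  proper := hp
  deg := hd
  changed _ _ _ := Iff.rfl
  added_unique _ _ _ _ _ h1 h2 := absurd h1 h2
  added_old _ _ h1 h2 := absurd h1 h2
  sep t ht t' ht' hne p := le_length_of_not_near inf_le_right (hM t ht t' ht' hne) p

theorem Modif.insert_vertex (h : Modif G c ℓ F₀ F M) {a : V} (ha : ∀ t ∈ M, ¬ Near F₀ ℓ t a) :
    Modif G c ℓ F₀ F (insert a M) where
  le := h.le
  proper := h.proper
  deg := h.deg
  changed u v hu := h.changed u v fun hm => hu (Set.mem_insert_of_mem _ hm)
  added_unique := h.added_unique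
  added_old := h.added_old
  sep := by
    rintro t (rfl | ht) t' (rfl | ht') hne p
    · exact absurd rfl hne
    · exact le_length_of_not_near inf_le_right (fun hn => ha t' ht' hn.symm) p
    · exact le_length_of_not_near inf_le_right (ha t ht) p
    · exact h.sep t ht t' ht' hne p

theorem not_mem_of_far {m : ℕ} {a : V} (ha : ∀ t ∈ M, ¬ Near F₀ m t a) : a ∉ M :=
  fun h => ha a h (Near.refl _ _ _)

/-- The two new members `y` and `z` of `M` are adjacent in `F₀`, but a common walk between them
avoids `yz` and closes up with it to a cycle of `F₀`, so its length is at least `ℓ - 1`. This is the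
reason for the summand `1` in `sep`. -/
theorem Modif.remove (h : Modif G c ℓ F₀ F M) (hc : CyclesGe ℓ F₀) {y z : V} (hyz : F₀.Adj y z)
    (hy : ∀ t ∈ M, ¬ Near F₀ ℓ t y) (hz : ∀ t ∈ M, ¬ Near F₀ ℓ t z) :
    Modif G c ℓ F₀ (delEdge F y z) (insert y (insert z M)) where
  le := delEdge_le.trans h.le
  proper u v w huv huw := h.proper u v w (delEdge_le huv) (delEdge_le huw)
  deg u a b d ha hb hd := h.deg u a b d (delEdge_le ha) (delEdge_le hb) (delEdge_le hd)
  changed u v hu := by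
    simp only [Set.mem_insert_iff, not_or] at hu
    rw [delEdge_adj, h.changed u v hu.2.2]
    tauto
  added_unique u k v w hk h1 h2 h3 h4 :=
    h.added_unique u k v w hk (delEdge_le h1) h2 (delEdge_le h3) h4
  added_old u v h1 := h.added_old u v (delEdge_le h1)
  sep := by
    have hle : delEdge F y z ⊓ F₀ ≤ F₀ := inf_le_right
    have hnadj : ¬ (delEdge F y z ⊓ F₀).Adj y z := by
      rintro ⟨h1, -⟩
      rw [delEdge_adj] at h1
      simp at h1
    rintro t (rfl | rfl | ht) t' (rfl | rfl | ht') hne p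
    · exact absurd rfl hne
    · exact hc.le_length_of_not_adj hle hyz hnadj p
    · exact le_length_of_not_near hle (fun hn => hy t' ht' hn.symm) p
    · exact hc.le_length_of_not_adj hle hyz.symm (fun h => hnadj h.symm) p
    · exact absurd rfl hne
    · exact le_length_of_not_near hle (fun hn => hz t' ht' hn.symm) p
    · exact le_length_of_not_near hle (hy t ht) p
    · exact le_length_of_not_near hle (hz t ht) p
    · have hle' : delEdge F y z ⊓ F₀ ≤ F ⊓ F₀ := inf_le_inf_right _ delEdge_le
      have := h.sep t ht t' ht' hne (p.mapLe hle')
      rwa [Walk.length_mapLe] at this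

/-- The added edge is not in `F₀`, so the common graph does not grow and `sep` persists. The
conditions `na` and `nb` bind only at vertices that have an edge of `F₀`: a vertex inserted from
outside may receive two new edges. -/
theorem Modif.add (h : Modif G c ℓ F₀ F M) {a b : V} (ha : a ∈ M) (hb : b ∈ M)
    (hG : G.Adj a b) (hn₀ : ¬ F₀.Adj a b) (la : IsLow F a) (lb : IsLow F b)
    (na : (∃ k, F₀.Adj a k) → ∀ u, F.Adj a u → F₀.Adj a u)
    (nb : (∃ k, F₀.Adj b k) → ∀ u, F.Adj b u → F₀.Adj b u)
    (hold : (∃ k, F₀.Adj a k) ∨ ∃ k, F₀.Adj b k)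
    (ca : ∀ u, F.Adj a u → c s(a, b) ≠ c s(a, u)) (cb : ∀ u, F.Adj b u → c s(a, b) ≠ c s(b, u)) :
    Modif G c ℓ F₀ (addEdge F a b) M := by
  have hne : a ≠ b := hG.ne
  have hadj := fun u v => addEdge_adj (F := F) hne (u := u) (v := v)
  constructor
  · intro u v huv
    rcases (hadj u v).1 huv with h1 | ⟨rfl, rfl⟩ | ⟨rfl, rfl⟩
    · exact h.le h1
    · exact hG
    · exact hG.symm
  · exact h.proper.addEdge hne ca cb
  · exact h.deg.addEdge hne la lb
  · intro u v hu
    rw [hadj, h.changed u v hu]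
    constructor
    · rintro (h1 | ⟨rfl, rfl⟩ | ⟨rfl, rfl⟩)
      · exact h1
      · exact absurd ha hu
      · exact absurd hb hu
    · exact Or.inl
  · intro u k v w hk h1 h2 h3 h4
    rw [hadj] at h1 h3
    rcases h1 with h1 | ⟨rfl, rfl⟩ | ⟨rfl, rfl⟩ <;> rcases h3 with h3 | ⟨h5, h6⟩ | ⟨h5, h6⟩
    · exact h.added_unique u k v w hk h1 h2 h3 h4
    · subst h5 h6; exact absurd (na ⟨k, hk⟩ v h1) h2
    · subst h5 h6; exact absurd (nb ⟨k, hk⟩ v h1) h2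
    · exact absurd (na ⟨k, hk⟩ w h3) h4
    · exact h6.symm
    · exact absurd h5 hne
    · exact absurd (nb ⟨k, hk⟩ w h3) h4
    · exact absurd h5.symm hne
    · exact h6.symm
  · intro u v h1 h2
    rcases (hadj u v).1 h1 with h1 | ⟨rfl, rfl⟩ | ⟨rfl, rfl⟩
    · exact h.added_old u v h1 h2
    · exact hold
    · exact hold.symm
  · intro t ht t' ht' hne' p
    have hle : addEdge F a b ⊓ F₀ ≤ F ⊓ F₀ := by
      rintro u v ⟨h1, h2⟩
      refine ⟨?_, h2⟩
      rcases (hadj u v).1 h1 with h1 | ⟨rfl, rfl⟩ | ⟨rfl, rfl⟩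
      · exact h1
      · exact absurd h2 hn₀
      · exact absurd h2.symm hn₀
    have := h.sep t ht t' ht' hne' (p.mapLe hle)
    rwa [Walk.length_mapLe] at this

/-- Rotation: the end `v` is joined to `y`, the edge `yz` is dropped, and `z` becomes an end. -/
theorem Modif.rotate [Finite V] (h : Modif G c ℓ F₀ F M) (hc : CyclesGe ℓ F₀) (hd : DegLeTwo F₀)
    {v y z : V} (hv : v ∈ M) (lv : IsLow F v) (nv : ∀ u, F.Adj v u → F₀.Adj v u)
    (hyz : F₀.Adj y z) (hy : ∀ t ∈ M, ¬ Near F₀ ℓ t y) (hz : ∀ t ∈ M, ¬ Near F₀ ℓ t z)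
    (hG : G.Adj v y) (cv : ∀ u, F.Adj v u → c s(v, y) ≠ c s(v, u))
    (cy : ∀ u, F₀.Adj y u → u ≠ z → c s(v, y) ≠ c s(y, u)) (hℓ : 1 ≤ ℓ) :
    ∃ F', Modif G c ℓ F₀ F' (insert y (insert z M)) ∧ F'.edgeSet.ncard = F.edgeSet.ncard ∧
      (∀ u, F'.Adj z u ↔ F₀.Adj z u ∧ u ≠ y) ∧
      (∀ t ∈ M, t ≠ v → ∀ u, F'.Adj t u ↔ F.Adj t u) ∧
      F' = addEdge (delEdge F y z) v y := by
  have hyM := not_mem_of_far hy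
  have hzM := not_mem_of_far hz
  have hvy : v ≠ y := hG.ne
  have hvz : v ≠ z := fun e => hzM (e ▸ hv)
  have hn₀ : ¬ F₀.Adj v y := fun h' => hy v hv ((Near.of_adj h').mono hℓ)
  have hy' : ∀ u, F.Adj y u ↔ F₀.Adj y u := fun u => h.changed y u hyM
  have hz' : ∀ u, F.Adj z u ↔ F₀.Adj z u := fun u => h.changed z u hzM
  have hdv : ∀ u, (delEdge F y z).Adj v u → F.Adj v u := fun u hu => delEdge_le hu
  have hdy : ∀ u, (delEdge F y z).Adj y u → F₀.Adj y u ∧ u ≠ z := by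
    intro u hu
    rw [delEdge_adj] at hu
    exact ⟨(hy' u).1 hu.1, fun e => hu.2 (Or.inl ⟨rfl, e⟩)⟩
  have h1 := h.remove hc hyz hy hz
  refine ⟨addEdge (delEdge F y z) v y, h1.add (by simp [hv]) (by simp) hG hn₀ ?_ ?_ ?_ ?_
    (Or.inr ⟨z, hyz⟩) ?_ ?_, ?_, ?_, ?_, rfl⟩
  · intro a b ha hb; exact lv a b (hdv a ha) (hdv b hb)
  · intro a b ha hb
    rcases hd y a b z (hdy a ha).1 (hdy b hb).1 hyz with e | e | e
    · exact e
    · exact absurd e (hdy a ha).2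
    · exact absurd e (hdy b hb).2
  · intro _ u hu; exact nv u (hdv u hu)
  · intro _ u hu; exact (hdy u hu).1
  · intro u hu; exact cv u (hdv u hu)
  · intro u hu; exact cy u (hdy u hu).1 (hdy u hu).2
  · rw [edgeSet_ncard_addEdge hvy fun h' => hn₀ (nv _ (hdv _ h'))]
    exact edgeSet_ncard_delEdge ((hy' z).2 hyz)
  · intro u
    rw [addEdge_adj hvy, delEdge_adj, hz']
    have := hyz.ne
    grind
  · intro t ht htv u
    rw [addEdge_adj hvy, delEdge_adj]
    have e1 : t ≠ y := fun e => hyM (e ▸ ht)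
    have e2 : t ≠ z := fun e => hzM (e ▸ ht)
    grind

end Modif

/-! ### Maximal configurations and robustly reachable ends -/

/-- A configuration with the largest possible number of vertices, which is a path together with
cycles. -/
structure IsMaxConfig {V K : Type*} (G : SimpleGraph V) (c : Sym2 V → K) (ℓ : ℕ)
    (F₀ : SimpleGraph V) (U : Set V) : Prop where
  conf : IsConfig G c ℓ F₀ U
  max : ∀ F' U', IsConfig G c ℓ F' U' → U'.ncard ≤ U.ncard
  edges : F₀.edgeSet.ncard + 1 = U.ncard
  one_le : 1 ≤ ℓ

/-- The edge `au` has none of the colours of the edges of `F₀` at the head of the arrow `a`, the edge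
of `F₀` along the arrow being discarded. An arrow `(x, x)` discards no edge. -/
def Free {V K : Type*} (G : SimpleGraph V) (c : Sym2 V → K) (F₀ : SimpleGraph V) (a : V × V)
    (u : V) : Prop :=
  G.Adj a.2 u ∧ ∀ k, F₀.Adj a.2 k → k ≠ a.1 → c s(a.2, u) ≠ c s(a.2, k)

/-- The end at the head of the arrow `a₀` can be rotated along the arrow `a`. -/
def Step {V K : Type*} (G : SimpleGraph V) (c : Sym2 V → K) (F₀ : SimpleGraph V)
    (a₀ a : V × V) : Prop :=
  F₀.Adj a.1 a.2 ∧ Free G c F₀ a₀ a.1 ∧ ∀ k, F₀.Adj a.1 k → k ≠ a.2 → c s(a₀.2, a.1) ≠ c s(a.1, k)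

/-- The arrows that are robustly reachable from the end `x` by at most `r` rotations, staying out
of `E`. -/
def Reach {V K : Type*} (G : SimpleGraph V) (c : Sym2 V → K) (F₀ : SimpleGraph V) (E : Set V)
    (κ : ℕ) (x : V) : ℕ → Set (V × V)
  | 0 => ∅
  -- A direct step starts at the fixed end `x` and needs no robustness. A later step needs `κ`
  -- predecessors, so that one survives when those meeting a small set are excluded.
  | r + 1 => {a | a.1 ∉ E ∧ a.2 ∉ E ∧
      (Step G c F₀ (x, x) a ∨ κ ≤ {a₀ | a₀ ∈ Reach G c F₀ E κ x r ∧ Step G c F₀ a₀ a}.ncard)}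

/-- `(F', M')` arises from `(F, M)` by moving the end `x` to the head of the arrow `a` while
avoiding `X`. -/
structure Attains {V K : Type*} (G : SimpleGraph V) (c : Sym2 V → K) (ℓ : ℕ) (F₀ : SimpleGraph V)
    (x : V) (a : V × V) (X : Set V) (r : ℕ) (F : SimpleGraph V) (M : Set V) (F' : SimpleGraph V)
    (M' : Set V) : Prop where
  modif : Modif G c ℓ F₀ F' M'
  subset : M ⊆ M'
  card : M'.ncard ≤ M.ncard + 2 * r
  avoid : ∀ t ∈ M', t ∉ M → t ∉ X
  old : ∀ t ∈ M', t ∉ M → ∃ k, F₀.Adj t k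
  mem : a.2 ∈ M'
  edges : F'.edgeSet.ncard = F.edgeSet.ncard
  head : ∀ u, F'.Adj a.2 u ↔ F₀.Adj a.2 u ∧ u ≠ a.1
  unchanged : ∀ t ∈ M, t ≠ x → ∀ u, F'.Adj t u ↔ F.Adj t u

section Realize

variable {V K : Type*} [Fintype V] {G : SimpleGraph V} {c : Sym2 V → K} {ℓ : ℕ}
  {F₀ : SimpleGraph V} {U E : Set V} {κ : ℕ} {x : V}

theorem Reach.adj (hκ : 0 < κ) {r : ℕ} {a : V × V} (ha : a ∈ Reach G c F₀ E κ x r) :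
    F₀.Adj a.1 a.2 := by
  cases r with
  | zero => exact absurd ha (Set.notMem_empty _)
  | succ r =>
    rcases ha.2.2 with h | h
    · exact h.1
    · have hne : {a₀ | a₀ ∈ Reach G c F₀ E κ x r ∧ Step G c F₀ a₀ a}.Nonempty :=
        Set.nonempty_of_ncard_ne_zero (by omega)
      obtain ⟨a₀, h⟩ := hne
      exact h.2.1

theorem Reach.notMem {r : ℕ} {a : V × V} (ha : a ∈ Reach G c F₀ E κ x r) : a.1 ∉ E ∧ a.2 ∉ E := by
  cases r with
  | zero => exact absurd ha (Set.notMem_empty _)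
  | succ r => exact ⟨ha.1, ha.2.1⟩

theorem Reach.subset_succ (r : ℕ) : Reach G c F₀ E κ x r ⊆ Reach G c F₀ E κ x (r + 1) := by
  induction r with
  | zero => exact Set.empty_subset _
  | succ r ih =>
    rintro a ⟨h1, h2, h3⟩
    refine ⟨h1, h2, h3.imp id fun h => h.trans ?_⟩
    exact Set.ncard_le_ncard (fun a₀ h => ⟨ih h.1, h.2⟩) (Set.toFinite _)

theorem ncard_near_le (hF : DegLeTwo F₀) (u : V) (m : ℕ) :
    {v | Near F₀ m u v}.ncard ≤ 2 * m + 1 := by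
  classical
  rw [Set.ncard_eq_toFinset_card']
  refine le_trans (Finset.card_le_card ?_) (card_near_le hF u m)
  intro v; simp

theorem ncard_near_set_le (hF : DegLeTwo F₀) (M : Set V) (m : ℕ) :
    {v | ∃ t ∈ M, Near F₀ m t v}.ncard ≤ M.ncard * (2 * m + 1) := by
  classical
  have : {v | ∃ t ∈ M, Near F₀ m t v} =
      ((M.toFinset.biUnion fun t => Finset.univ.filter fun v => Near F₀ m t v : Finset V) :
        Set V) := by
    ext v; simp
  rw [this, Set.ncard_coe_finset, Set.ncard_eq_toFinset_card']
  exact Finset.card_biUnion_le_card_mul _ _ _ fun t _ => card_near_le hF t m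

theorem ncard_arrows_fst_le (hF : DegLeTwo F₀) (X : Set V) :
    {a : V × V | F₀.Adj a.1 a.2 ∧ a.1 ∈ X}.ncard ≤ 2 * X.ncard := by
  classical
  have : {a : V × V | F₀.Adj a.1 a.2 ∧ a.1 ∈ X} ⊆
      ((X.toFinset.biUnion fun t => (F₀.neighborFinset t).image fun v => (t, v) :
        Finset (V × V)) : Set (V × V)) := by
    rintro ⟨y, z⟩ ⟨h1, h2⟩
    simp only [Finset.coe_biUnion, Set.mem_iUnion, Finset.coe_image]
    exact ⟨y, by simpa using h2, z, by simpa using h1, rfl⟩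
  refine (Set.ncard_le_ncard this (Set.toFinite _)).trans ?_
  rw [Set.ncard_coe_finset, Set.ncard_eq_toFinset_card', mul_comm]
  refine Finset.card_biUnion_le_card_mul _ _ _ fun t _ => ?_
  refine Finset.card_image_le.trans ?_
  rw [F₀.card_neighborFinset_eq_degree]
  exact degree_le_two hF t

theorem ncard_arrows_le (hF : DegLeTwo F₀) (X : Set V) :
    {a : V × V | F₀.Adj a.1 a.2 ∧ (a.1 ∈ X ∨ a.2 ∈ X)}.ncard ≤ 4 * X.ncard := by
  have h1 := ncard_arrows_fst_le hF X
  have h2 : {a : V × V | F₀.Adj a.1 a.2 ∧ a.2 ∈ X}.ncard ≤ 2 * X.ncard := by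
    refine le_trans (le_of_eq ?_) h1
    rw [← Set.ncard_image_of_injective _ Prod.swap_injective]
    congr 1
    ext ⟨y, z⟩
    simp only [Set.mem_ofPred_eq, Set.mem_image, Prod.exists, Prod.swap_prod_mk, Prod.mk.injEq]
    constructor
    · rintro ⟨p, q, ⟨h1, h2⟩, rfl, rfl⟩; exact ⟨h1.symm, h2⟩
    · rintro ⟨h1, h2⟩; exact ⟨z, y, ⟨h1.symm, h2⟩, rfl, rfl⟩
  have h3 : {a : V × V | F₀.Adj a.1 a.2 ∧ (a.1 ∈ X ∨ a.2 ∈ X)} =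
      {a : V × V | F₀.Adj a.1 a.2 ∧ a.1 ∈ X} ∪ {a : V × V | F₀.Adj a.1 a.2 ∧ a.2 ∈ X} := by
    ext a; simp only [Set.mem_ofPred_eq, Set.mem_union]; tauto
  rw [h3]
  have := Set.ncard_union_le {a : V × V | F₀.Adj a.1 a.2 ∧ a.1 ∈ X}
    {a : V × V | F₀.Adj a.1 a.2 ∧ a.2 ∈ X}
  omega

/-- Robustly reachable arrows can be realised while avoiding a given small set. -/
theorem Reach.exists_attains (hm : IsMaxConfig G c ℓ F₀ U) (hx : IsLow F₀ x) :
    ∀ (r : ℕ) (a : V × V), a ∈ Reach G c F₀ E κ x r → ∀ (F : SimpleGraph V) (M X : Set V),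
      Modif G c ℓ F₀ F M → x ∈ M → (∀ u, F.Adj x u ↔ F₀.Adj x u) →
      (∀ t ∈ M, ∀ u, Near F₀ ℓ t u → u ∈ X) → a.1 ∉ X → a.2 ∉ X →
      4 * (X.ncard + r * (2 * (2 * ℓ + 1))) < κ →
      ∃ F' M', Attains G c ℓ F₀ x a X r F M F' M' := by
  have hc := hm.conf.cyc
  have hd := hm.conf.deg
  intro r
  induction r with
  | zero => intro a ha; exact absurd ha (Set.notMem_empty _)
  | succ r ih =>
    intro a ha F M X hF hxM hFx hX ha1 ha2 hκ
    have hfar1 : ∀ t ∈ M, ¬ Near F₀ ℓ t a.1 := fun t ht hn => ha1 (hX t ht _ hn)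
    have hfar2 : ∀ t ∈ M, ¬ Near F₀ ℓ t a.2 := fun t ht hn => ha2 (hX t ht _ hn)
    have hMX : M ⊆ X := fun t ht => hX t ht t (Near.refl _ _ _)
    rcases ha.2.2 with hs | hs
    · obtain ⟨hs1, hs2, hs3⟩ := hs
      obtain ⟨F', h1, h2, h3, h4, -⟩ := hF.rotate hc hd (v := x) hxM
        (fun p q hp hq => hx p q ((hFx p).1 hp) ((hFx q).1 hq)) (fun u hu => (hFx u).1 hu)
        hs1 hfar1 hfar2 hs2.1
        (fun u hu => hs2.2 u ((hFx u).1 hu) fun e => ((hFx u).1 hu).ne e.symm)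
        hs3 hm.one_le
      refine ⟨F', _, h1, ?_, ?_, ?_, ?_, ?_, h2, h3, h4⟩
      · exact (Set.subset_insert _ _).trans (Set.subset_insert _ _)
      · have e1 := Set.ncard_insert_le a.1 (insert a.2 M)
        have e2 := Set.ncard_insert_le a.2 M
        omega
      · rintro t (rfl | rfl | ht) hn
        · exact ha1
        · exact ha2
        · exact absurd ht hn
      · rintro t (rfl | rfl | ht) hn
        · exact ⟨_, hs1⟩
        · exact ⟨_, hs1.symm⟩
        · exact absurd ht hn
      · simp
    -- The predecessor must also stay far from both vertices of `a`. This enlarges `X` by at most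
    -- `2(2ℓ + 1)` vertices in each round, and a vertex lies on at most four arrows; hence the form
    -- of the hypothesis on `κ`.
    · set X₁ : Set V := X ∪ ({u | Near F₀ ℓ a.1 u} ∪ {u | Near F₀ ℓ a.2 u}) with hX₁
      have hX₁card : X₁.ncard ≤ X.ncard + 2 * (2 * ℓ + 1) := by
        have e1 := Set.ncard_union_le X ({u | Near F₀ ℓ a.1 u} ∪ {u | Near F₀ ℓ a.2 u})
        have e2 := Set.ncard_union_le {u | Near F₀ ℓ a.1 u} {u | Near F₀ ℓ a.2 u}
        have e3 := ncard_near_le hd a.1 ℓ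
        have e4 := ncard_near_le hd a.2 ℓ
        rw [hX₁]
        omega
      have hXX₁ : X ⊆ X₁ := Set.subset_union_left
      have hbad := ncard_arrows_le hd X₁
      have hκ' : 4 * (X.ncard + r * (2 * (2 * ℓ + 1)) + 2 * (2 * ℓ + 1)) < κ := by
        refine lt_of_le_of_lt (le_of_eq ?_) hκ; ring
      have hκ0 : 0 < κ := by omega
      obtain ⟨a₀, ⟨ha₀, hst⟩, hna₀⟩ : ∃ a₀ ∈ {a₀ | a₀ ∈ Reach G c F₀ E κ x r ∧ Step G c F₀ a₀ a},
          a₀ ∉ {a : V × V | F₀.Adj a.1 a.2 ∧ (a.1 ∈ X₁ ∨ a.2 ∈ X₁)} := by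
        by_contra! hcon
        have := Set.ncard_le_ncard (fun a h => hcon a h) (Set.toFinite
          {a : V × V | F₀.Adj a.1 a.2 ∧ (a.1 ∈ X₁ ∨ a.2 ∈ X₁)})
        have h0 : 4 * (X.ncard + 2 * (2 * ℓ + 1)) ≤
          4 * (X.ncard + r * (2 * (2 * ℓ + 1)) + 2 * (2 * ℓ + 1)) := by
            gcongr; exact Nat.le_add_right _ _
        omega
      have hadj₀ := Reach.adj hκ0 ha₀
      simp only [Set.mem_ofPred_eq, not_and, not_or] at hna₀
      obtain ⟨hn1, hn2⟩ := hna₀ hadj₀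
      obtain ⟨F₁, M₁, h⟩ := ih a₀ ha₀ F M X₁ hF hxM hFx
        (fun t ht u hu => hXX₁ (hX t ht u hu)) hn1 hn2 (by
          refine lt_of_le_of_lt ?_ hκ'
          gcongr 4 * ?_
          omega)
      have far1 : ∀ t ∈ M₁, ¬ Near F₀ ℓ t a.1 := by
        intro t ht hn
        by_cases htM : t ∈ M
        · exact hfar1 t htM hn
        · exact h.avoid t ht htM (Or.inr (Or.inl hn.symm))
      have far2 : ∀ t ∈ M₁, ¬ Near F₀ ℓ t a.2 := by
        intro t ht hn
        by_cases htM : t ∈ M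
        · exact hfar2 t htM hn
        · exact h.avoid t ht htM (Or.inr (Or.inr hn.symm))
      obtain ⟨hs1, hs2, hs3⟩ := hst
      obtain ⟨F', h1, h2, h3, h4, -⟩ := h.modif.rotate hc hd (v := a₀.2) h.mem
        (by
          intro p q hp hq
          have hp := (h.head p).1 hp
          have hq := (h.head q).1 hq
          rcases hd _ _ _ _ hp.1 hq.1 hadj₀.symm with e | e | e
          · exact e
          · exact absurd e hp.2
          · exact absurd e hq.2)
        (fun u hu => ((h.head u).1 hu).1) hs1 far1 far2 hs2.1
        (fun u hu => hs2.2 u ((h.head u).1 hu).1 ((h.head u).1 hu).2) hs3 hm.one_le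
      have ha₀M : a₀.2 ∉ M := fun h => hn2 (hXX₁ (hMX h))
      refine ⟨F', _, h1, ?_, ?_, ?_, ?_, ?_, h2.trans h.edges, h3, ?_⟩
      · exact h.subset.trans ((Set.subset_insert _ _).trans (Set.subset_insert _ _))
      · have e1 := Set.ncard_insert_le a.1 (insert a.2 M₁)
        have e2 := Set.ncard_insert_le a.2 M₁
        have e3 := h.card
        omega
      · rintro t (rfl | rfl | ht) hn
        · exact ha1
        · exact ha2
        · exact fun hX' => h.avoid t ht hn (hXX₁ hX')
      · rintro t (rfl | rfl | ht) hn
        · exact ⟨_, hs1⟩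
        · exact ⟨_, hs1.symm⟩
        · exact h.old t ht hn
      · simp
      · intro t ht htx u
        rw [h4 t (h.subset ht) (fun e => ha₀M (e ▸ ht)), h.unchanged t ht htx]

end Realize

/-! ### Configurations that maximality forbids -/

section Augment

variable {V K : Type*} [Fintype V] {G : SimpleGraph V} {c : Sym2 V → K} {ℓ : ℕ}
  {F₀ F : SimpleGraph V} {U M : Set V}

theorem IsMaxConfig.false_of_modif (hm : IsMaxConfig G c ℓ F₀ U) (hF : Modif G c ℓ F₀ F M)
    {U' : Set V} (hM : M ⊆ U') (hU : U ⊆ U') (hcard : U'.ncard ≤ F.edgeSet.ncard + 1)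
    (hlt : U.ncard < U'.ncard) : False := by
  refine absurd (hm.max F U' ⟨hF.le, hF.proper, hF.deg, hF.cyclesGe hm.conf.cyc, ?_, hcard⟩)
    (not_le.2 hlt)
  intro u v huv
  by_cases hu : u ∈ M
  · exact hM hu
  · exact hU (hm.conf.supp u v ((hF.changed u v hu).1 huv))

/-- A graph on the vertices of a maximal configuration cannot have all degrees equal to two. -/
theorem IsMaxConfig.false_of_edges (hm : IsMaxConfig G c ℓ F₀ U) (hF : Modif G c ℓ F₀ F M)
    (hM : M ⊆ U) (hUne : U ≠ Set.univ) (he : U.ncard ≤ F.edgeSet.ncard) : False := by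
  -- With this many edges no path component is left, so an outside vertex can be added as a
  -- one-vertex path.
  obtain ⟨w, hw⟩ := (Set.ne_univ_iff_exists_notMem U).1 hUne
  have hi := Set.ncard_insert_of_notMem hw (Set.toFinite U)
  exact hm.false_of_modif hF (hM.trans (Set.subset_insert w U)) (Set.subset_insert w U)
    (by omega) (by omega)

theorem IsMaxConfig.not_adj (hm : IsMaxConfig G c ℓ F₀ U) {w : V} (hw : w ∉ U) (u : V) :
    ¬ F₀.Adj w u := fun h => hw (hm.conf.supp _ _ h)

theorem IsMaxConfig.not_near (hm : IsMaxConfig G c ℓ F₀ U) {w : V} (hw : w ∉ U) {m : ℕ} {u : V}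
    (hu : u ≠ w) : ¬ Near F₀ m u w := by
  intro h
  cases m with
  | zero => exact hu (near_zero.1 h)
  | succ m =>
    rcases near_succ.1 h with h | ⟨v, -, hv⟩
    · exact hu h
    · exact hm.not_adj hw v hv.symm

/-- An end of a modified configuration has no suitable neighbour outside. -/
theorem IsMaxConfig.false_of_extend (hm : IsMaxConfig G c ℓ F₀ U) (hF : Modif G c ℓ F₀ F M)
    (hM : M ⊆ U) (he : U.ncard ≤ F.edgeSet.ncard + 1) {z w : V} (hz : z ∈ M) (hw : w ∉ U)
    (lz : IsLow F z) (nz : ∀ u, F.Adj z u → F₀.Adj z u) (hk : ∃ k, F₀.Adj z k) (hG : G.Adj z w)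
    (cz : ∀ u, F.Adj z u → c s(z, w) ≠ c s(z, u)) : False := by
  have hwM : w ∉ M := fun h => hw (hM h)
  have hF1 := hF.insert_vertex (a := w) fun t ht => hm.not_near hw fun e => hwM (e ▸ ht)
  have hFw : ∀ u, ¬ F.Adj w u := fun u hu => hm.not_adj hw u ((hF.changed w u hwM).1 hu)
  have h2 := hF1.add (a := z) (b := w) (by simp [hz]) (by simp) hG
    (fun h => hm.not_adj hw _ h.symm) lz (fun p _ hp _ => absurd hp (hFw p)) (fun _ => nz)
    (fun _ u hu => absurd hu (hFw u)) (Or.inl hk) cz (fun u hu => absurd hu (hFw u))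
  have h3 := edgeSet_ncard_addEdge (F := F) hG.ne (fun h => hFw _ h.symm)
  have hi := Set.ncard_insert_of_notMem hw (Set.toFinite U)
  refine hm.false_of_modif h2 (Set.insert_subset_insert hM) (Set.subset_insert w U)
    (by omega) (by omega)

end Augment

/-- A maximal configuration whose path has the far apart ends `x` and `x'`. -/
structure IsBase {V K : Type*} (G : SimpleGraph V) (c : Sym2 V → K) (ℓ : ℕ)
    (F₀ : SimpleGraph V) (U : Set V) (x x' : V) : Prop where
  isMax : IsMaxConfig G c ℓ F₀ U
  ne_univ : U ≠ Set.univ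
  low : IsLow F₀ x
  low' : IsLow F₀ x'
  exists_adj : ∃ k, F₀.Adj x k
  exists_adj' : ∃ k, F₀.Adj x' k
  ne : x ≠ x'
  far : ∀ p : F₀.Walk x x', ℓ ≤ p.length + 1
  two : ∀ u ∈ U, u ≠ x → u ≠ x' → ∃ a b, a ≠ b ∧ F₀.Adj u a ∧ F₀.Adj u b

section Base

variable {V K : Type*} [Fintype V] {G : SimpleGraph V} {c : Sym2 V → K} {ℓ : ℕ}
  {F₀ : SimpleGraph V} {U E : Set V} {κ : ℕ} {x x' : V}

theorem IsBase.symm (h : IsBase G c ℓ F₀ U x x') : IsBase G c ℓ F₀ U x' x :=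
  ⟨h.isMax, h.ne_univ, h.low', h.low, h.exists_adj', h.exists_adj, h.ne.symm,
    fun p => by simpa using h.far p.reverse, fun u hu h1 h2 => h.two u hu h2 h1⟩

theorem IsBase.mem (h : IsBase G c ℓ F₀ U x x') : x ∈ U := by
  obtain ⟨k, hk⟩ := h.exists_adj
  exact h.isMax.conf.supp _ _ hk

theorem IsBase.modif (h : IsBase G c ℓ F₀ U x x') : Modif G c ℓ F₀ F₀ {x, x'} := by
  refine ⟨h.isMax.conf.le, h.isMax.conf.proper, h.isMax.conf.deg, fun _ _ _ => Iff.rfl,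
    fun _ _ _ _ _ h1 h2 => absurd h1 h2, fun _ _ h1 h2 => absurd h1 h2, ?_⟩
  rintro t (rfl | rfl) t' (rfl | rfl) hne p
  · exact absurd rfl hne
  · simpa using h.far (p.mapLe inf_le_right)
  · simpa using h.symm.far (p.mapLe inf_le_right)
  · exact absurd rfl hne

/-- Reachable arrows avoid `E` and hence the neighbourhoods of both ends, so only the extra set `Y`
has to be kept away from the arrow. All further modified vertices have edges of `F₀`, which keeps
them in `U`. -/
theorem IsBase.exists_attains (h : IsBase G c ℓ F₀ U x x')
    (hE : ∀ u, Near F₀ ℓ x u ∨ Near F₀ ℓ x' u → u ∈ E) {r : ℕ} {a : V × V}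
    (ha : a ∈ Reach G c F₀ E κ x r) (Y : Set V) (hY1 : a.1 ∉ Y) (hY2 : a.2 ∉ Y)
    (hκ : 4 * (2 * (2 * ℓ + 1) + Y.ncard + r * (2 * (2 * ℓ + 1))) < κ) :
    ∃ F' M', Attains G c ℓ F₀ x a ({u | Near F₀ ℓ x u ∨ Near F₀ ℓ x' u} ∪ Y) r F₀ {x, x'} F' M' ∧
      M' ⊆ U := by
  have hd := h.isMax.conf.deg
  obtain ⟨hn1, hn2⟩ := Reach.notMem ha
  have hcard : ({u | Near F₀ ℓ x u ∨ Near F₀ ℓ x' u} ∪ Y).ncard ≤ 2 * (2 * ℓ + 1) + Y.ncard := by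
    have e1 := Set.ncard_union_le {u | Near F₀ ℓ x u ∨ Near F₀ ℓ x' u} Y
    have e2 := Set.ncard_union_le {u | Near F₀ ℓ x u} {u | Near F₀ ℓ x' u}
    have e3 := ncard_near_le hd x ℓ
    have e4 := ncard_near_le hd x' ℓ
    have e5 : {u | Near F₀ ℓ x u ∨ Near F₀ ℓ x' u} =
      {u | Near F₀ ℓ x u} ∪ {u | Near F₀ ℓ x' u} := rfl
    rw [e5] at e1 ⊢
    omega
  obtain ⟨F', M', hA⟩ := Reach.exists_attains h.isMax h.low r a ha F₀ {x, x'}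
    ({u | Near F₀ ℓ x u ∨ Near F₀ ℓ x' u} ∪ Y) h.modif (by simp) (fun _ => Iff.rfl)
    (by
      rintro t (rfl | rfl) u hu
      · exact Or.inl (Or.inl hu)
      · exact Or.inl (Or.inr hu))
    (by
      rintro (h1 | h1)
      · exact hn1 (hE _ h1)
      · exact hY1 h1)
    (by
      rintro (h1 | h1)
      · exact hn2 (hE _ h1)
      · exact hY2 h1)
    (by
      refine lt_of_le_of_lt ?_ hκ
      gcongr)
  refine ⟨F', M', hA, ?_⟩
  intro t ht
  by_cases h1 : t ∈ ({x, x'} : Set V)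
  · rcases h1 with rfl | rfl
    · exact h.mem
    · exact h.symm.mem
  · obtain ⟨k, hk⟩ := hA.old t ht h1
    exact h.isMax.conf.supp _ _ hk

theorem Attains.isLow_head {F F' : SimpleGraph V} {M M' X : Set V} {a : V × V} {r : ℕ}
    (hA : Attains G c ℓ F₀ x a X r F M F' M') (hd : DegLeTwo F₀) (hadj : F₀.Adj a.1 a.2) :
    IsLow F' a.2 := by
  intro p q hp hq
  have hp := (hA.head p).1 hp
  have hq := (hA.head q).1 hq
  rcases hd _ _ _ _ hp.1 hq.1 hadj.symm with e | e | e
  · exact e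
  · exact absurd e hp.2
  · exact absurd e hq.2

/-- A reachable end has no suitable neighbour outside of the configuration. -/
theorem IsBase.not_free_of_notMem (h : IsBase G c ℓ F₀ U x x')
    (hE : ∀ u, Near F₀ ℓ x u ∨ Near F₀ ℓ x' u → u ∈ E) {r : ℕ} {a : V × V}
    (ha : a ∈ Reach G c F₀ E κ x r)
    (hκ : 4 * (2 * (2 * ℓ + 1) + r * (2 * (2 * ℓ + 1))) < κ) {w : V} (hw : w ∉ U) :
    ¬ Free G c F₀ a w := by
  intro hf
  have hadj := Reach.adj (by omega) ha
  obtain ⟨F', M', hA, hM⟩ := h.exists_attains hE ha ∅ (by simp) (by simp) (by simpa using hκ)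
  have hed := h.isMax.edges
  have he := hA.edges
  exact h.isMax.false_of_extend hA.modif hM (by omega) hA.mem hw
    (hA.isLow_head h.isMax.conf.deg hadj) (fun u hu => ((hA.head u).1 hu).1) ⟨_, hadj.symm⟩ hf.1
    (fun u hu => hf.2 u ((hA.head u).1 hu).1 ((hA.head u).1 hu).2)

theorem IsBase.not_free_end (h : IsBase G c ℓ F₀ U x x') {w : V} (hw : w ∉ U) :
    ¬ Free G c F₀ (x, x) w := by
  intro hf
  have hed := h.isMax.edges
  refine h.isMax.false_of_extend h.modif ?_ (by omega) (z := x) (by simp) hw h.low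
    (fun u hu => hu) h.exists_adj hf.1 (fun u hu => hf.2 u hu hu.ne')
  rintro t (rfl | rfl)
  · exact h.mem
  · exact h.symm.mem

/-- Ends reachable from the two sides are not joined by an edge of a suitable colour. -/
theorem IsBase.not_free_pair (h : IsBase G c ℓ F₀ U x x')
    (hE : ∀ u, Near F₀ ℓ x u ∨ Near F₀ ℓ x' u → u ∈ E) {r : ℕ} {a a' : V × V}
    (ha : a ∈ Reach G c F₀ E κ x r) (ha' : a' ∈ Reach G c F₀ E κ x' r)
    (hκ : 4 * ((4 * r + 4) * (2 * ℓ + 1)) < κ) (hfar : ¬ Near F₀ (ℓ + 2) a.2 a'.2)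
    (hf : Free G c F₀ a a'.2) (hf' : Free G c F₀ a' a.2) : False := by
  have hd := h.isMax.conf.deg
  have hκ0 : 0 < κ := by omega
  have hadj := Reach.adj hκ0 ha
  have hadj' := Reach.adj hκ0 ha'
  obtain ⟨hn1, hn2⟩ := Reach.notMem ha'
  have far11 : ¬ Near F₀ ℓ a.1 a'.1 := fun hn => hfar
    ((((Near.of_adj hadj.symm).trans hn).trans (Near.of_adj hadj')).mono (by omega))
  have far12 : ¬ Near F₀ ℓ a.1 a'.2 := fun hn => hfar
    (((Near.of_adj hadj.symm).trans hn).mono (by omega))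
  have far21 : ¬ Near F₀ ℓ a.2 a'.1 := fun hn => hfar
    ((hn.trans (Near.of_adj hadj')).mono (by omega))
  have far22 : ¬ Near F₀ ℓ a.2 a'.2 := fun hn => hfar (hn.mono (by omega))
  have hYc : ({u | Near F₀ ℓ a'.1 u} ∪ {u | Near F₀ ℓ a'.2 u}).ncard ≤ 2 * (2 * ℓ + 1) := by
    have e2 := Set.ncard_union_le {u | Near F₀ ℓ a'.1 u} {u | Near F₀ ℓ a'.2 u}
    have e3 := ncard_near_le hd a'.1 ℓ
    have e4 := ncard_near_le hd a'.2 ℓ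
    omega
  obtain ⟨F₁, M₁, hA, hM₁⟩ := h.exists_attains hE ha
    ({u | Near F₀ ℓ a'.1 u} ∪ {u | Near F₀ ℓ a'.2 u})
    (by
      rintro (hn | hn)
      · exact far11 hn.symm
      · exact far12 hn.symm)
    (by
      rintro (hn | hn)
      · exact far21 hn.symm
      · exact far22 hn.symm)
    (by
      refine lt_of_le_of_lt ?_ hκ
      have : 2 * (2 * ℓ + 1) + ({u | Near F₀ ℓ a'.1 u} ∪ {u | Near F₀ ℓ a'.2 u}).ncard +
        r * (2 * (2 * ℓ + 1)) ≤ 2 * (2 * ℓ + 1) + 2 * (2 * ℓ + 1) + r * (2 * (2 * ℓ + 1)) := by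
          gcongr
      nlinarith)
  have hx'M : x' ∈ M₁ := hA.subset (by simp)
  have key : ∀ y, y ∉ E → (∀ u, Near F₀ ℓ y u → u ∈ {u | Near F₀ ℓ a'.1 u} ∪ {u | Near F₀ ℓ a'.2 u}) →
      y ∉ {v | ∃ t ∈ M₁, Near F₀ ℓ t v} := by
    rintro y hyE hyn ⟨t, ht, hty⟩
    by_cases htx : t ∈ ({x, x'} : Set V)
    · rcases htx with rfl | rfl
      · exact hyE (hE _ (Or.inl hty))
      · exact hyE (hE _ (Or.inr hty))
    · exact hA.avoid t ht htx (Or.inr (hyn t hty.symm))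
  have hM₁c : M₁.ncard ≤ 2 + 2 * r := by
    have := hA.card
    rw [Set.ncard_pair h.ne] at this
    exact this
  -- The rotations of the second end are performed in `F₁`, with the whole neighbourhood of `M₁`
  -- forbidden, so they do not disturb those of the first end.
  obtain ⟨F₂, M₂, hB⟩ := Reach.exists_attains h.isMax h.low' r a' ha' F₁ M₁
    {v | ∃ t ∈ M₁, Near F₀ ℓ t v} hA.modif hx'M
    (fun u => hA.unchanged x' (by simp) h.ne.symm u) (fun t ht u hu => ⟨t, ht, hu⟩)
    (key a'.1 hn1 fun u hu => Or.inl hu) (key a'.2 hn2 fun u hu => Or.inr hu)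
    (by
      refine lt_of_le_of_lt ?_ hκ
      have e1 := ncard_near_set_le hd M₁ ℓ
      have e2 : M₁.ncard * (2 * ℓ + 1) ≤ (2 + 2 * r) * (2 * ℓ + 1) := by gcongr
      nlinarith)
  have hM₂ : M₂ ⊆ U := by
    intro t ht
    by_cases htM : t ∈ M₁
    · exact hM₁ htM
    · obtain ⟨k, hk⟩ := hB.old t ht htM
      exact h.isMax.conf.supp _ _ hk
  have hax' : a.2 ≠ x' := by
    intro e
    exact (Reach.notMem ha).2 (hE _ (Or.inr (e ▸ Near.refl _ _ _)))
  have hhead : ∀ u, F₂.Adj a.2 u ↔ F₀.Adj a.2 u ∧ u ≠ a.1 := fun u =>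
    (hB.unchanged a.2 hA.mem hax' u).trans (hA.head u)
  have hn₀ : ¬ F₀.Adj a.2 a'.2 := fun hn => hfar ((Near.of_adj hn).mono (by omega))
  have low2 : IsLow F₂ a.2 := by
    intro p q hp hq
    exact hA.isLow_head hd hadj p q ((hA.head p).2 ((hhead p).1 hp)) ((hA.head q).2 ((hhead q).1 hq))
  have hC := hB.modif.add (a := a.2) (b := a'.2) (hB.subset hA.mem) hB.mem hf.1 hn₀ low2
    (hB.isLow_head hd hadj') (fun _ u hu => ((hhead u).1 hu).1)
    (fun _ u hu => ((hB.head u).1 hu).1) (Or.inl ⟨_, hadj.symm⟩)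
    (fun u hu => hf.2 u ((hhead u).1 hu).1 ((hhead u).1 hu).2)
    (fun u hu => by
      rw [Sym2.eq_swap]
      exact hf'.2 u ((hB.head u).1 hu).1 ((hB.head u).1 hu).2)
  have e1 := edgeSet_ncard_addEdge (F := F₂) hf.1.ne (fun hn => hn₀ ((hhead _).1 hn).1)
  have e2 := hA.edges
  have e3 := hB.edges
  have e4 := h.isMax.edges
  exact h.isMax.false_of_edges hC hM₂ h.ne_univ (by omega)

/-- A vertex `w` outside can replace the head of a reachable arrow and become an end. -/
theorem IsBase.exists_swap (h : IsBase G c ℓ F₀ U x x')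
    (hE : ∀ u, Near F₀ ℓ x u ∨ Near F₀ ℓ x' u → u ∈ E) {r : ℕ} {a : V × V}
    (ha : a ∈ Reach G c F₀ E κ x r) {a₁ w : V} (hadj₁ : F₀.Adj a.2 a₁) (hne : a₁ ≠ a.1)
    (hw : w ∉ U) (hG : G.Adj a₁ w)
    (hcol : ∀ u, F₀.Adj a₁ u → u ≠ a.2 → c s(a₁, w) ≠ c s(a₁, u)) (Y : Set V)
    (hY : ∀ s ∈ Y, ¬ Near F₀ ℓ x s ∧ ¬ Near F₀ ℓ x' s ∧ ¬ Near F₀ ℓ a.1 s ∧ ¬ Near F₀ ℓ a.2 s ∧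
      s ≠ w)
    (hκ : 4 * ((2 * r + 3 + Y.ncard) * (2 * ℓ + 1)) < κ) :
    ∃ F₂, IsMaxConfig G c ℓ F₂ (insert w (U \ {a.2})) ∧ (∀ u, F₂.Adj w u ↔ u = a₁) ∧
      ∀ s ∈ Y, (∀ u, F₂.Adj s u ↔ F₀.Adj s u) ∧ ¬ Near F₂ ℓ w s := by
  have hd := h.isMax.conf.deg
  have hadj := Reach.adj (by omega) ha
  obtain ⟨hn1, hn2⟩ := Reach.notMem ha
  have hℓ := h.isMax.one_le
  obtain ⟨F₁, M₁, hA, hM₁⟩ := h.exists_attains hE ha ({a₁} ∪ {v | ∃ s ∈ Y, Near F₀ ℓ s v})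
    (by
      rintro (hn | ⟨s, hs, hn⟩)
      · exact hne hn.symm
      · exact (hY s hs).2.2.1 hn.symm)
    (by
      rintro (hn | ⟨s, hs, hn⟩)
      · exact hadj₁.ne hn
      · exact (hY s hs).2.2.2.1 hn.symm)
    (by
      refine lt_of_le_of_lt ?_ hκ
      have e1 := Set.ncard_union_le {a₁} {v | ∃ s ∈ Y, Near F₀ ℓ s v}
      have e2 := ncard_near_set_le hd Y ℓ
      rw [Set.ncard_singleton] at e1
      nlinarith)
  have hfarM : ∀ t ∈ M₁, ∀ s ∈ Y, ¬ Near F₀ ℓ t s := by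
    intro t ht s hs hn
    by_cases htx : t ∈ ({x, x'} : Set V)
    · rcases htx with rfl | rfl
      · exact (hY s hs).1 hn
      · exact (hY s hs).2.1 hn
    · exact hA.avoid t ht htx (Or.inr (Or.inr ⟨s, hs, hn.symm⟩))
  have ha₁M : a₁ ∉ M₁ := by
    intro ht
    by_cases htx : a₁ ∈ ({x, x'} : Set V)
    · have hnear : Near F₀ ℓ a₁ a.2 := (Near.of_adj hadj₁.symm).mono hℓ
      rcases htx with e | e
      · exact hn2 (hE _ (Or.inl (e ▸ hnear)))
      · exact hn2 (hE _ (Or.inr (e ▸ hnear)))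
    · exact hA.avoid a₁ ht htx (Or.inr (Or.inl rfl))
  have hwM : w ∉ M₁ := fun ht => hw (hM₁ ht)
  set b := a.2 with hb
  have hF₁a : ∀ u, F₁.Adj a₁ u ↔ F₀.Adj a₁ u := fun u => hA.modif.changed _ _ ha₁M
  have hF₁w : ∀ u, ¬ F₁.Adj w u := fun u hu =>
    h.isMax.not_adj hw u ((hA.modif.changed _ _ hwM).1 hu)
  have hF₁b : ∀ u, F₁.Adj b u ↔ u = a₁ := by
    intro u
    rw [hA.head]
    constructor
    · rintro ⟨h1, h2⟩
      rcases hd _ _ _ _ h1 hadj₁ hadj.symm with e | e | e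
      · exact e
      · exact absurd e h2
      · exact absurd e hne
    · rintro rfl; exact ⟨hadj₁, hne⟩
  have hba₁ : b ≠ a₁ := hadj₁.ne
  have hbU : b ∈ U := h.isMax.conf.supp _ _ hadj₁
  have ha₁U : a₁ ∈ U := h.isMax.conf.supp _ _ hadj₁.symm
  have ha₁w : a₁ ≠ w := hG.ne
  have hbw : b ≠ w := fun e => hw (e ▸ hbU)
  -- In `F₁` the vertex `b` is an end whose only edge is `b a₁`. Moving this edge to `w a₁` expels
  -- `b` from the configuration and makes `w` an end in its place.
  set F₂ := addEdge (delEdge F₁ b a₁) a₁ w with hF₂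
  have hF₂adj : ∀ u v, F₂.Adj u v ↔ (F₁.Adj u v ∧ ¬ ((u = b ∧ v = a₁) ∨ (u = a₁ ∧ v = b))) ∨
      (u = a₁ ∧ v = w) ∨ (u = w ∧ v = a₁) := by
    intro u v
    rw [hF₂, addEdge_adj ha₁w, delEdge_adj]
  have hF₂w : ∀ u, F₂.Adj w u ↔ u = a₁ := by
    intro u
    rw [hF₂adj]
    have := hF₁w u
    have := ha₁w.symm
    grind
  have hF₂b : ∀ u, ¬ F₂.Adj b u := by
    intro u
    rw [hF₂adj, hF₁b]
    grind
  have hdel : ∀ u, (delEdge F₁ b a₁).Adj a₁ u → F₀.Adj a₁ u ∧ u ≠ b := by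
    intro u hu
    rw [delEdge_adj, hF₁a] at hu
    exact ⟨hu.1, fun e => hu.2 (Or.inr ⟨rfl, e⟩)⟩
  have hdelw : ∀ u, ¬ (delEdge F₁ b a₁).Adj w u := fun u hu => hF₁w u (delEdge_le hu)
  have hcard : (insert w (U \ {b})).ncard = U.ncard := by
    rw [Set.ncard_insert_of_notMem (fun hn => hw hn.1) (Set.toFinite _)]
    exact Set.ncard_sdiff_singleton_add_one hbU (Set.toFinite _)
  have hedge : F₂.edgeSet.ncard + 1 = U.ncard := by
    have e1 := edgeSet_ncard_addEdge (F := delEdge F₁ b a₁) ha₁w (fun hn => hdelw _ hn.symm)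
    have e2 := edgeSet_ncard_delEdge ((hF₁b a₁).2 rfl)
    have e3 := hA.edges
    have e4 := h.isMax.edges
    rw [← hF₂] at e1
    omega
  refine ⟨F₂, ⟨⟨?_, ?_, ?_, ?_, ?_, ?_⟩, ?_, ?_, hℓ⟩, hF₂w, ?_⟩
  · intro u v huv
    rcases (hF₂adj u v).1 huv with h1 | ⟨rfl, rfl⟩ | ⟨rfl, rfl⟩
    · exact hA.modif.le h1.1
    · exact hG
    · exact hG.symm
  · refine ProperOn.addEdge (fun u v w huv huw => hA.modif.proper u v w (delEdge_le huv)
      (delEdge_le huw)) ha₁w ?_ ?_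
    · intro u hu; exact hcol u (hdel u hu).1 (hdel u hu).2
    · intro u hu; exact absurd hu (hdelw u)
  · refine DegLeTwo.addEdge (fun u v₁ v₂ v₃ h1 h2 h3 => hA.modif.deg u v₁ v₂ v₃ (delEdge_le h1)
      (delEdge_le h2) (delEdge_le h3)) ha₁w ?_ ?_
    · intro p q hp hq
      rcases hd _ _ _ _ (hdel p hp).1 (hdel q hq).1 hadj₁.symm with e | e | e
      · exact e
      · exact absurd e (hdel p hp).2
      · exact absurd e (hdel q hq).2
    · intro p q hp; exact absurd hp (hdelw p)
  · refine (hA.modif.cyclesGe h.isMax.conf.cyc).of_pendant w ?_ ?_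
    · intro p q hp hq; exact ((hF₂w p).1 hp).trans ((hF₂w q).1 hq).symm
    · intro p q hp hq hpq
      rcases (hF₂adj p q).1 hpq with h1 | ⟨-, h1⟩ | ⟨h1, -⟩
      · exact h1.1
      · exact absurd h1 hq
      · exact absurd h1 hp
  · intro u v huv
    by_cases huw : u = w
    · exact Or.inl huw
    right
    have hub : u ≠ b := by rintro rfl; exact hF₂b _ huv
    refine ⟨?_, hub⟩
    rcases (hF₂adj u v).1 huv with h1 | ⟨rfl, -⟩ | ⟨h1, -⟩
    · by_cases huM : u ∈ M₁
      · exact hM₁ huM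
      · exact h.isMax.conf.supp _ _ ((hA.modif.changed u v huM).1 h1.1)
    · exact ha₁U
    · exact absurd h1 huw
  · omega
  · intro F' U' hF'
    rw [hcard]
    exact h.isMax.max F' U' hF'
  · omega
  · intro s hs
    have hsM : s ∉ M₁ := fun hM => hfarM s hM s hs (Near.refl _ _ _)
    have hsb : s ≠ b := fun e => (hY s hs).2.2.2.1 (e ▸ Near.refl _ _ _)
    have hsa₁ : s ≠ a₁ := fun e => (hY s hs).2.2.2.1 (e ▸ (Near.of_adj hadj₁).mono hℓ)
    have hsw := (hY s hs).2.2.2.2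
    refine ⟨?_, ?_⟩
    · intro u
      rw [hF₂adj, hA.modif.changed s u hsM]
      grind
    · rintro ⟨p, hp⟩
      classical
      -- Since `w` has taken over the only edge of `b`, sending `w` to `b` is a homomorphism. A
      -- short walk of `F₂` from `w` to `s` thus yields a short walk of `F₁` from `s` to the
      -- modified vertex `b`.
      let f : F₂ →g F₁ :=
        { toFun := fun v => if v = w then b else v
          map_rel' := by
            intro u v huv
            have huv' := huv
            rw [hF₂adj] at huv'
            have h1 : F₁.Adj a₁ b := ((hF₁b a₁).2 rfl).symm
            rcases huv' with ⟨h2, -⟩ | ⟨rfl, rfl⟩ | ⟨rfl, rfl⟩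
            · have e1 : u ≠ w := fun e => hF₁w v (e ▸ h2)
              have e2 : v ≠ w := fun e => hF₁w u (e ▸ h2.symm)
              simpa [e1, e2] using h2
            · simpa [ha₁w] using h1
            · simpa [ha₁w] using h1.symm }
      have hfw : f w = b := by simp [f]
      have hfs : f s = s := by simp [f, hsw]
      have hnear : Near F₁ ℓ s b :=
        ⟨((p.map f).copy hfw hfs).reverse, by simpa using hp⟩
      exact hA.modif.not_near hA.mem (fun t ht => hfarM t ht s hs) hnear

/-- Replacing the head of a reachable arrow by a path of two vertices outside. -/
theorem IsBase.false_of_truncate (h : IsBase G c ℓ F₀ U x x')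
    (hE : ∀ u, Near F₀ ℓ x u ∨ Near F₀ ℓ x' u → u ∈ E) {r : ℕ} {a : V × V}
    (ha : a ∈ Reach G c F₀ E κ x r) {a₁ w w' : V} (hadj₁ : F₀.Adj a.2 a₁) (hne : a₁ ≠ a.1)
    (hw : w ∉ U) (hG : G.Adj a₁ w)
    (hcol : ∀ u, F₀.Adj a₁ u → u ≠ a.2 → c s(a₁, w) ≠ c s(a₁, u)) (hw' : w' ∉ U)
    (hG' : G.Adj w w') (hcol' : c s(w, w') ≠ c s(w, a₁))
    (hκ : 4 * ((2 * r + 3) * (2 * ℓ + 1)) < κ) : False := by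
  obtain ⟨F₂, hm, hF₂, -⟩ := h.exists_swap hE ha hadj₁ hne hw hG hcol ∅ (by simp) (by simpa using hκ)
  have hed := hm.edges
  refine hm.false_of_extend (M := {w}) (z := w) (w := w') (Modif.refl hm.conf.le hm.conf.proper
    hm.conf.deg (by rintro t rfl t' rfl h; exact absurd rfl h)) (by simp) (by omega)
    rfl ?_ ?_ (fun u hu => hu) ⟨a₁, (hF₂ a₁).2 rfl⟩ hG' ?_
  · rintro (e | e)
    · exact hG'.ne e.symm
    · exact hw' e.1
  · intro p q hp hq; exact ((hF₂ p).1 hp).trans ((hF₂ q).1 hq).symm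
  · intro u hu
    rw [(hF₂ u).1 hu]
    exact hcol'

/-- Using a vertex outside as an end, rotating along `pq` and leaving the configuration at `q`. -/
theorem IsBase.false_of_swap_rotate (h : IsBase G c ℓ F₀ U x x')
    (hE : ∀ u, Near F₀ ℓ x u ∨ Near F₀ ℓ x' u → u ∈ E) {r : ℕ} {a : V × V}
    (ha : a ∈ Reach G c F₀ E κ x r) {a₁ w w' p q : V} (hadj₁ : F₀.Adj a.2 a₁) (hne : a₁ ≠ a.1)
    (hw : w ∉ U) (hG : G.Adj a₁ w)
    (hcol : ∀ u, F₀.Adj a₁ u → u ≠ a.2 → c s(a₁, w) ≠ c s(a₁, u)) (hw' : w' ∉ U)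
    (hww' : w' ≠ w) (hpq : F₀.Adj p q) (hwp : G.Adj w p) (hqw' : G.Adj q w')
    (hcol₁ : c s(w, p) ≠ c s(w, a₁))
    (hcolp : ∀ u, F₀.Adj p u → u ≠ q → c s(w, p) ≠ c s(p, u))
    (hcolq : ∀ u, F₀.Adj q u → u ≠ p → c s(q, w') ≠ c s(q, u))
    (hfar : ∀ t ∈ ({x, x', a.1, a.2} : Set V), ¬ Near F₀ ℓ t p ∧ ¬ Near F₀ ℓ t q)
    (hκ : 4 * ((2 * r + 5) * (2 * ℓ + 1)) < κ) : False := by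
  have hpU : p ∈ U := h.isMax.conf.supp _ _ hpq
  have hqU : q ∈ U := h.isMax.conf.supp _ _ hpq.symm
  obtain ⟨F₂, hm, hF₂, hY⟩ := h.exists_swap hE ha hadj₁ hne hw hG hcol {p, q}
    (by
      rintro s (rfl | rfl)
      · exact ⟨(hfar _ (by simp)).1, (hfar _ (by simp)).1, (hfar _ (by simp)).1,
          (hfar _ (by simp)).1, fun e => hw (e ▸ hpU)⟩
      · exact ⟨(hfar _ (by simp)).2, (hfar _ (by simp)).2, (hfar _ (by simp)).2,
          (hfar _ (by simp)).2, fun e => hw (e ▸ hqU)⟩)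
    (by
      rw [Set.ncard_pair hpq.ne]
      exact hκ)
  obtain ⟨hp1, hp2⟩ := hY p (by simp)
  obtain ⟨hq1, hq2⟩ := hY q (by simp)
  have h0 : Modif G c ℓ F₂ F₂ {w} := Modif.refl hm.conf.le hm.conf.proper
    hm.conf.deg (by rintro t rfl t' rfl h; exact absurd rfl h)
  obtain ⟨F₃, h1, h2, h3, -⟩ := h0.rotate hm.conf.cyc hm.conf.deg (v := w) (y := p) (z := q) rfl
    (fun p q hp hq => ((hF₂ p).1 hp).trans ((hF₂ q).1 hq).symm) (fun u hu => hu)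
    ((hp1 q).2 hpq) (by rintro t rfl; exact hp2) (by rintro t rfl; exact hq2) hwp
    (fun u hu => by rw [(hF₂ u).1 hu]; exact hcol₁)
    (fun u hu => hcolp u ((hp1 u).1 hu)) hm.one_le
  have hed := hm.edges
  have hfar' := hfar a.2 (by simp)
  refine hm.false_of_extend h1 (z := q) (w := w') ?_ (by omega) (by simp) ?_ ?_
    (fun u hu => ((h3 u).1 hu).1) ⟨p, (hq1 p).2 hpq.symm⟩ hqw' ?_
  · rintro t (rfl | rfl | rfl)
    · exact Or.inr ⟨hpU, fun e => hfar'.1 (e ▸ Near.refl _ _ _)⟩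
    · exact Or.inr ⟨hqU, fun e => hfar'.2 (e ▸ Near.refl _ _ _)⟩
    · exact Or.inl rfl
  · rintro (e | e)
    · exact hww' e
    · exact hw' e.1
  · intro s t hs ht
    have hs := (h3 s).1 hs
    have ht := (h3 t).1 ht
    rcases hm.conf.deg _ _ _ _ hs.1 ht.1 ((hq1 p).2 hpq.symm) with e | e | e
    · exact e
    · exact absurd e hs.2
    · exact absurd e ht.2
  · intro u hu
    have hu := (h3 u).1 hu
    exact hcolq u ((hq1 u).1 hu.1) hu.2

end Base

section FourEnds

variable {V K : Type*} [Fintype V] {G : SimpleGraph V} {c : Sym2 V → K} {ℓ : ℕ}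
  {F₀ : SimpleGraph V} {U : Set V}

/-- Inserting a vertex between two far apart vertices and joining the two new ends. -/
theorem IsMaxConfig.false_of_insert_join (hm : IsMaxConfig G c ℓ F₀ U) {w a₁ b₁ a₂ b₂ : V}
    (hw : w ∉ U) (h₁ : F₀.Adj a₁ b₁) (h₂ : F₀.Adj a₂ b₂) (hfar : ¬ Near F₀ (ℓ + 2) a₁ a₂)
    (hwa₁ : G.Adj w a₁) (hwa₂ : G.Adj w a₂) (hb : G.Adj b₁ b₂) (hc : c s(w, a₁) ≠ c s(w, a₂))
    (ca₁ : ∀ u, F₀.Adj a₁ u → u ≠ b₁ → c s(w, a₁) ≠ c s(a₁, u))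
    (ca₂ : ∀ u, F₀.Adj a₂ u → u ≠ b₂ → c s(w, a₂) ≠ c s(a₂, u))
    (cb₁ : ∀ u, F₀.Adj b₁ u → u ≠ a₁ → c s(b₁, b₂) ≠ c s(b₁, u))
    (cb₂ : ∀ u, F₀.Adj b₂ u → u ≠ a₂ → c s(b₁, b₂) ≠ c s(b₂, u)) : False := by
  have hd := hm.conf.deg
  have hw0 := hm.not_adj hw
  have U1 : a₁ ∈ U := hm.conf.supp _ _ h₁
  have U2 : b₁ ∈ U := hm.conf.supp _ _ h₁.symm
  have U3 : a₂ ∈ U := hm.conf.supp _ _ h₂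
  have U4 : b₂ ∈ U := hm.conf.supp _ _ h₂.symm
  have fw : ∀ u ∈ U, ¬ Near F₀ ℓ w u := fun u hu hn =>
    hm.not_near hw (fun e => hw (e ▸ hu)) hn.symm
  have f11 : ¬ Near F₀ ℓ a₁ a₂ := fun hn => hfar (hn.mono (by omega))
  have f12 : ¬ Near F₀ ℓ a₁ b₂ := fun hn => hfar
    ((hn.trans (Near.of_adj h₂.symm)).mono (by omega))
  have f21 : ¬ Near F₀ ℓ b₁ a₂ := fun hn => hfar (((Near.of_adj h₁).trans hn).mono (by omega))
  have f22 : ¬ Near F₀ ℓ b₁ b₂ := fun hn => hfar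
    ((((Near.of_adj h₁).trans hn).trans (Near.of_adj h₂.symm)).mono (by omega))
  have n11 : a₁ ≠ a₂ := fun e => f11 (e ▸ Near.refl _ _ _)
  have n12 : a₁ ≠ b₂ := fun e => f12 (e ▸ Near.refl _ _ _)
  have n21 : b₁ ≠ a₂ := fun e => f21 (e ▸ Near.refl _ _ _)
  have n22 : b₁ ≠ b₂ := fun e => f22 (e ▸ Near.refl _ _ _)
  have m1 := h₁.ne
  have m2 := h₂.ne
  have w1 := hwa₁.ne
  have w2 := hwa₂.ne
  have w3 : w ≠ b₁ := fun e => hw (e ▸ U2)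
  have w4 : w ≠ b₂ := fun e => hw (e ▸ U4)
  have low : ∀ {p q : V} (_ : F₀.Adj p q) (r s), F₀.Adj p r ∧ r ≠ q → F₀.Adj p s ∧ s ≠ q →
      r = s := by
    intro p q h r s hr hs
    rcases hm.conf.deg _ _ _ _ hr.1 hs.1 h with e | e | e
    · exact e
    · exact absurd e hr.2
    · exact absurd e hs.2
  -- The edges `a₁b₁` and `a₂b₂` are exchanged for `wa₁`, `wa₂` and `b₁b₂`: one more edge for one
  -- more vertex.
  have h0 : Modif G c ℓ F₀ F₀ {w} := Modif.refl hm.conf.le hm.conf.proper hm.conf.deg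
    (by rintro t rfl t' rfl h; exact absurd rfl h)
  have s1 := h0.remove hm.conf.cyc h₁ (by rintro t rfl; exact fw _ U1)
    (by rintro t rfl; exact fw _ U2)
  have s2 := s1.remove hm.conf.cyc h₂
    (by
      rintro t (rfl | rfl | rfl)
      · exact f11
      · exact f21
      · exact fw _ U3)
    (by
      rintro t (rfl | rfl | rfl)
      · exact f12
      · exact f22
      · exact fw _ U4)
  set D := delEdge (delEdge F₀ a₁ b₁) a₂ b₂ with hD
  have hDadj : ∀ u v, D.Adj u v ↔ (F₀.Adj u v ∧ ¬ ((u = a₁ ∧ v = b₁) ∨ (u = b₁ ∧ v = a₁))) ∧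
      ¬ ((u = a₂ ∧ v = b₂) ∨ (u = b₂ ∧ v = a₂)) := by
    intro u v; rw [hD, delEdge_adj, delEdge_adj]
  have Dw : ∀ u, ¬ D.Adj w u := fun u hu => hw0 u ((hDadj _ _).1 hu).1.1
  have Da₁ : ∀ u, D.Adj a₁ u → F₀.Adj a₁ u ∧ u ≠ b₁ := fun u hu =>
    ⟨((hDadj _ _).1 hu).1.1, fun e => ((hDadj _ _).1 hu).1.2 (Or.inl ⟨rfl, e⟩)⟩
  have Db₁ : ∀ u, D.Adj b₁ u → F₀.Adj b₁ u ∧ u ≠ a₁ := fun u hu =>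
    ⟨((hDadj _ _).1 hu).1.1, fun e => ((hDadj _ _).1 hu).1.2 (Or.inr ⟨rfl, e⟩)⟩
  have Da₂ : ∀ u, D.Adj a₂ u → F₀.Adj a₂ u ∧ u ≠ b₂ := fun u hu =>
    ⟨((hDadj _ _).1 hu).1.1, fun e => ((hDadj _ _).1 hu).2 (Or.inl ⟨rfl, e⟩)⟩
  have Db₂ : ∀ u, D.Adj b₂ u → F₀.Adj b₂ u ∧ u ≠ a₂ := fun u hu =>
    ⟨((hDadj _ _).1 hu).1.1, fun e => ((hDadj _ _).1 hu).2 (Or.inr ⟨rfl, e⟩)⟩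
  have s3 := s2.add (a := w) (b := a₁) (by simp) (by simp) hwa₁ (hw0 _)
    (fun p _ hp _ => absurd hp (Dw p)) (fun p q hp hq => low h₁ p q (Da₁ p hp) (Da₁ q hq))
    (fun ⟨k, hk⟩ => absurd hk (hw0 k)) (fun _ u hu => (Da₁ u hu).1) (Or.inr ⟨_, h₁⟩)
    (fun u hu => absurd hu (Dw u)) (fun u hu => ca₁ u (Da₁ u hu).1 (Da₁ u hu).2)
  set A := addEdge D w a₁ with hA
  have hAadj : ∀ u v, A.Adj u v ↔ D.Adj u v ∨ (u = w ∧ v = a₁) ∨ (u = a₁ ∧ v = w) := by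
    intro u v; rw [hA, addEdge_adj w1]
  have Aw : ∀ u, A.Adj w u → u = a₁ := by
    intro u hu
    rcases (hAadj _ _).1 hu with h | ⟨-, h⟩ | ⟨h, -⟩
    · exact absurd h (Dw u)
    · exact h
    · exact absurd h w1
  have Aother : ∀ p, p ≠ w → p ≠ a₁ → ∀ u, A.Adj p u → D.Adj p u := by
    intro p hp1 hp2 u hu
    rcases (hAadj _ _).1 hu with h | ⟨h, -⟩ | ⟨h, -⟩
    · exact h
    · exact absurd h hp1
    · exact absurd h hp2
  have Aa₂ := Aother a₂ w2.symm n11.symm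
  have s4 := s3.add (a := w) (b := a₂) (by simp) (by simp) hwa₂ (hw0 _)
    (fun p q hp hq => (Aw p hp).trans (Aw q hq).symm)
    (fun p q hp hq => low h₂ p q (Da₂ p (Aa₂ p hp)) (Da₂ q (Aa₂ q hq)))
    (fun ⟨k, hk⟩ => absurd hk (hw0 k)) (fun _ u hu => (Da₂ u (Aa₂ u hu)).1) (Or.inr ⟨_, h₂⟩)
    (fun u hu => by rw [Aw u hu]; exact hc.symm)
    (fun u hu => ca₂ u (Da₂ u (Aa₂ u hu)).1 (Da₂ u (Aa₂ u hu)).2)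
  set B := addEdge A w a₂ with hB
  have hBadj : ∀ u v, B.Adj u v ↔ A.Adj u v ∨ (u = w ∧ v = a₂) ∨ (u = a₂ ∧ v = w) := by
    intro u v; rw [hB, addEdge_adj w2]
  have Bother : ∀ p, p ≠ w → p ≠ a₁ → p ≠ a₂ → ∀ u, B.Adj p u → D.Adj p u := by
    intro p hp1 hp2 hp3 u hu
    rcases (hBadj _ _).1 hu with h | ⟨h, -⟩ | ⟨h, -⟩
    · exact Aother p hp1 hp2 u h
    · exact absurd h hp1
    · exact absurd h hp3
  have Bb₁ := fun u hu => Db₁ u (Bother b₁ w3.symm m1.symm n21 u hu)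
  have Bb₂ := fun u hu => Db₂ u (Bother b₂ w4.symm n12.symm m2.symm u hu)
  have hn₀ : ¬ F₀.Adj b₁ b₂ := fun hn => f22 ((Near.of_adj hn).mono hm.one_le)
  have s5 := s4.add (a := b₁) (b := b₂) (by simp) (by simp) hb hn₀
    (fun p q hp hq => low h₁.symm p q (Bb₁ p hp) (Bb₁ q hq))
    (fun p q hp hq => low h₂.symm p q (Bb₂ p hp) (Bb₂ q hq))
    (fun _ u hu => (Bb₁ u hu).1) (fun _ u hu => (Bb₂ u hu).1) (Or.inl ⟨_, h₁.symm⟩)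
    (fun u hu => cb₁ u (Bb₁ u hu).1 (Bb₁ u hu).2) (fun u hu => cb₂ u (Bb₂ u hu).1 (Bb₂ u hu).2)
  have e1 := edgeSet_ncard_delEdge h₁
  have e2 : D.edgeSet.ncard + 1 = (delEdge F₀ a₁ b₁).edgeSet.ncard := by
    refine edgeSet_ncard_delEdge ?_
    rw [delEdge_adj]
    refine ⟨h₂, ?_⟩
    rintro (⟨e, -⟩ | ⟨e, -⟩)
    · exact n11 e.symm
    · exact n21 e.symm
  have e3 : A.edgeSet.ncard = D.edgeSet.ncard + 1 := edgeSet_ncard_addEdge w1 (Dw _)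
  have e4 : B.edgeSet.ncard = A.edgeSet.ncard + 1 :=
    edgeSet_ncard_addEdge w2 fun h => n11 (Aw _ h).symm
  have e5 := edgeSet_ncard_addEdge (F := B) n22 fun h => hn₀ (Bb₁ _ h).1
  have hi := Set.ncard_insert_of_notMem hw (Set.toFinite U)
  have hed := hm.edges
  refine hm.false_of_modif s5 (U' := insert w U) ?_ (Set.subset_insert w U) (by omega) (by omega)
  rintro t (rfl | rfl | rfl | rfl | rfl)
  · exact Or.inr U3
  · exact Or.inr U4
  · exact Or.inr U1
  · exact Or.inr U2
  · exact Or.inl rfl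

end FourEnds

/-! ### Existence of a maximal configuration with far apart ends -/

section Existence

variable {V K : Type*} [Fintype V] {G : SimpleGraph V} {c : Sym2 V → K} {ℓ : ℕ}
  {F₀ : SimpleGraph V} {U : Set V}

theorem exists_max_isConfig (G : SimpleGraph V) (c : Sym2 V → K) (ℓ : ℕ) :
    ∃ F U, IsConfig G c ℓ F U ∧ ∀ F' U', IsConfig G c ℓ F' U' → U'.ncard ≤ U.ncard := by
  have hne : {p : SimpleGraph V × Set V | IsConfig G c ℓ p.1 p.2}.Nonempty := by
    refine ⟨(⊥, ∅), bot_le, ?_, ?_, ?_, ?_, by simp⟩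
    · intro u v w h; exact absurd h (by simp)
    · intro u a b d h; exact absurd h (by simp)
    · intro v p hp
      have := hp.not_nil
      exact absurd (Walk.adj_snd this) (by simp)
    · intro u v h; exact absurd h (by simp)
  have : Finite (SimpleGraph V) := Finite.of_injective (fun F : SimpleGraph V => F.Adj)
    (fun a b h => SimpleGraph.ext h)
  obtain ⟨p, hp, hmax⟩ := Set.exists_max_image {p : SimpleGraph V × Set V | IsConfig G c ℓ p.1 p.2}
    (fun p => p.2.ncard) (Set.toFinite _) hne
  exact ⟨p.1, p.2, hp, fun F' U' h => hmax (F', U') h⟩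

/-- If there were `|U|` edges or more, an outside vertex could be added as a one-vertex path. So a
maximal configuration that misses a vertex does contain a path. -/
theorem IsConfig.isMaxConfig (h : IsConfig G c ℓ F₀ U)
    (hmax : ∀ F' U', IsConfig G c ℓ F' U' → U'.ncard ≤ U.ncard) (hU : U ≠ Set.univ) (hℓ : 1 ≤ ℓ) :
    IsMaxConfig G c ℓ F₀ U := by
  refine ⟨h, hmax, ?_, hℓ⟩
  by_contra hne
  obtain ⟨w, hw⟩ := (Set.ne_univ_iff_exists_notMem U).1 hU
  have hi := Set.ncard_insert_of_notMem hw (Set.toFinite U)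
  have hc := h.card
  have := hmax F₀ (insert w U) ⟨h.le, h.proper, h.deg, h.cyc,
    fun u v huv => Or.inr (h.supp u v huv), by omega⟩
  omega

theorem exists_two_of_not_isLow {v : V} (h : ¬ IsLow F₀ v) :
    ∃ a b, a ≠ b ∧ F₀.Adj v a ∧ F₀.Adj v b := by
  unfold IsLow at h
  push Not at h
  obtain ⟨a, b, ha, hb, hab⟩ := h
  exact ⟨a, b, hab, ha, hb⟩

/-- The ends of a maximal configuration. -/
theorem IsMaxConfig.exists_ends (h : IsMaxConfig G c ℓ F₀ U) :
    ∃ x x', x ∈ U ∧ x' ∈ U ∧ IsLow F₀ x ∧ IsLow F₀ x' ∧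
      (∀ u ∈ U, u ≠ x → u ≠ x' → ∃ a b, a ≠ b ∧ F₀.Adj u a ∧ F₀.Adj u b) ∧
      (x = x' → ∀ u, ¬ F₀.Adj x u) ∧ (x ≠ x' → (∃ k, F₀.Adj x k) ∧ ∃ k, F₀.Adj x' k) := by
  classical
  have hd := h.conf.deg
  have hs := h.conf.supp
  have hc := h.conf.card
  by_cases hiso : ∃ x ∈ U, ∀ u, ¬ F₀.Adj x u
  · obtain ⟨x, hx, hx0⟩ := hiso
    refine ⟨x, x, hx, hx, fun a b ha => absurd ha (hx0 a), fun a b ha => absurd ha (hx0 a), ?_,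
      fun _ => hx0, fun hn => absurd rfl hn⟩
    intro u hu hne _
    by_contra hcon
    refine hne (eq_of_isolated hd hs hc hx hu hx0 ?_)
    by_contra hl
    exact hcon (exists_two_of_not_isLow hl)
  push Not at hiso
  have h1 := sum_degree_eq hs
  have h2 := h.edges
  have hdeg : ∀ v ∈ U.toFinset, 1 ≤ F₀.degree v := by
    intro v hv
    obtain ⟨k, hk⟩ := hiso v (by simpa using hv)
    rw [Nat.one_le_iff_ne_zero, ← Nat.pos_iff_ne_zero, F₀.degree_pos_iff_exists_adj]
    exact ⟨k, hk⟩
  -- All degrees are one or two and they sum to `2|U| - 2`, so exactly two vertices have degree one.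
  have h3 : ∑ v ∈ U.toFinset, (if IsLow F₀ v then 1 else 0) = 2 := by
    have : ∑ v ∈ U.toFinset, ((if IsLow F₀ v then 1 else 0) + F₀.degree v) = 2 * U.ncard := by
      rw [Finset.sum_congr rfl (g := fun _ => 2), Finset.sum_const, Set.ncard_eq_toFinset_card',
        smul_eq_mul, mul_comm]
      intro v hv
      have e1 := hdeg v hv
      have e2 := degree_le_two hd v
      have e3 := isLow_iff_degree_le_one (F := F₀) (v := v)
      split_ifs with hl
      · have := e3.1 hl; omega
      · have : ¬ F₀.degree v ≤ 1 := fun hn => hl (e3.2 hn)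
        omega
    rw [Finset.sum_add_distrib, h1] at this
    omega
  rw [← Finset.card_filter, Finset.card_eq_two] at h3
  obtain ⟨x, x', hne, hxx⟩ := h3
  have hmem : ∀ v, (v ∈ U ∧ IsLow F₀ v) ↔ v = x ∨ v = x' := by
    intro v
    have : v ∈ U.toFinset.filter (fun v => IsLow F₀ v) ↔ v ∈ ({x, x'} : Finset V) := by rw [hxx]
    simpa using this
  have hx := (hmem x).2 (Or.inl rfl)
  have hx' := (hmem x').2 (Or.inr rfl)
  refine ⟨x, x', hx.1, hx'.1, hx.2, hx'.2, ?_, fun e => absurd e hne,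
    fun _ => ⟨hiso _ hx.1, hiso _ hx'.1⟩⟩
  intro u hu h4 h5
  refine exists_two_of_not_isLow fun hl => ?_
  rcases (hmem u).1 ⟨hu, hl⟩ with e | e
  · exact h4 e
  · exact h5 e

/-- Here `x` may be isolated, and then the edge `xw` has no end with an edge of `F₀`, as `Modif`
would require. Instead, `w` becomes a pendant vertex and therefore lies on no cycle. -/
theorem IsMaxConfig.not_free_of_isLow (h : IsMaxConfig G c ℓ F₀ U) {x w : V} (hx : x ∈ U)
    (lx : IsLow F₀ x) (hw : w ∉ U) : ¬ Free G c F₀ (x, x) w := by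
  rintro ⟨hG, hc⟩
  dsimp only at hG hc
  have hFw := h.not_adj hw
  have hw1 : ∀ u, (addEdge F₀ x w).Adj w u → u = x := by
    intro u hu
    rw [addEdge_adj hG.ne] at hu
    rcases hu with hu | ⟨e, -⟩ | ⟨-, e⟩
    · exact absurd hu (hFw u)
    · exact absurd e.symm hG.ne
    · exact e
  have hi := Set.ncard_insert_of_notMem hw (Set.toFinite U)
  have he := edgeSet_ncard_addEdge hG.ne (fun h => hFw _ h.symm)
  have hed := h.edges
  have := h.max (addEdge F₀ x w) (insert w U) ⟨?_, ?_, ?_, ?_, ?_, by omega⟩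
  · omega
  · intro u v huv
    rcases (addEdge_adj hG.ne).1 huv with h1 | ⟨rfl, rfl⟩ | ⟨rfl, rfl⟩
    · exact h.conf.le h1
    · exact hG
    · exact hG.symm
  · exact h.conf.proper.addEdge hG.ne (fun u hu => hc u hu hu.ne') (fun u hu => absurd hu (hFw u))
  · exact h.conf.deg.addEdge hG.ne lx (fun u _ hu => absurd hu (hFw u))
  · refine h.conf.cyc.of_pendant w (fun a b ha hb => (hw1 a ha).trans (hw1 b hb).symm) ?_
    intro a b ha hb hab
    rcases (addEdge_adj hG.ne).1 hab with h1 | ⟨-, e⟩ | ⟨e, -⟩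
    · exact h1
    · exact absurd e hb
    · exact absurd e ha
  · intro u v huv
    rcases (addEdge_adj hG.ne).1 huv with h1 | ⟨rfl, -⟩ | ⟨rfl, -⟩
    · exact Or.inr (h.conf.supp _ _ h1)
    · exact Or.inr hx
    · exact Or.inl rfl

/-- The vertices available to an arrow miss at most one colour. -/
theorem colourDegree_le_ncard_free {z y : V} (hF : ∀ p q, F₀.Adj z p → p ≠ y → F₀.Adj z q →
    q ≠ y → p = q) : colourDegree G c z ≤ {u | Free G c F₀ (y, z) u}.ncard + 1 := by
  have hsub : (fun u => c s(z, u)) '' G.neighborSet z ⊆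
      (fun u => c s(z, u)) '' {u | Free G c F₀ (y, z) u} ∪
        (fun u => c s(z, u)) '' {k | F₀.Adj z k ∧ k ≠ y} := by
    rintro _ ⟨u, hu, rfl⟩
    by_cases h : Free G c F₀ (y, z) u
    · exact Or.inl ⟨u, h, rfl⟩
    · right
      unfold Free at h
      push Not at h
      obtain ⟨k, h1, h2, h3⟩ := h hu
      exact ⟨k, ⟨h1, h2⟩, h3.symm⟩
  have h1 := Set.ncard_le_ncard hsub (Set.toFinite _)
  have h2 := Set.ncard_union_le ((fun u => c s(z, u)) '' {u | Free G c F₀ (y, z) u})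
    ((fun u => c s(z, u)) '' {k | F₀.Adj z k ∧ k ≠ y})
  have h3 := Set.ncard_image_le (f := fun u => c s(z, u)) (Set.toFinite {u | Free G c F₀ (y, z) u})
  have h4 := Set.ncard_image_le (f := fun u => c s(z, u)) (Set.toFinite {k | F₀.Adj z k ∧ k ≠ y})
  have h5 : {k | F₀.Adj z k ∧ k ≠ y}.ncard ≤ 1 :=
    (Set.ncard_le_one_iff (Set.toFinite _)).2 fun ha hb => hF _ _ ha.1 ha.2 hb.1 hb.2
  unfold colourDegree
  omega

/-- A maximal configuration has two ends far apart, after a rotation. -/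
theorem IsMaxConfig.exists_isBase (h : IsMaxConfig G c ℓ F₀ U) (hU : U ≠ Set.univ)
    (hdeg : ∀ v, 4 * ℓ + 12 ≤ colourDegree G c v) : ∃ F x x', IsBase G c ℓ F U x x' := by
  have hd := h.conf.deg
  have hℓ := h.one_le
  obtain ⟨x, x', hx, hx', lx, lx', htwo, hiso, hnbr⟩ := h.exists_ends
  -- The two neighbourhoods of radius `ℓ + 1` contain at most `4ℓ + 6` vertices, fewer than the
  -- suitable neighbours of `x`. The extra unit of radius keeps `z` at distance more than `ℓ` from
  -- `x` and `x'`.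
  obtain ⟨y, hy, hyX⟩ : ∃ y ∈ {u | Free G c F₀ (x, x) u},
      y ∉ {u | Near F₀ (ℓ + 1) x u} ∪ {u | Near F₀ (ℓ + 1) x' u} := by
    by_contra! hcon
    have e1 := Set.ncard_le_ncard hcon (Set.toFinite _)
    have e2 := Set.ncard_union_le {u | Near F₀ (ℓ + 1) x u} {u | Near F₀ (ℓ + 1) x' u}
    have e3 := ncard_near_le hd x (ℓ + 1)
    have e4 := ncard_near_le hd x' (ℓ + 1)
    have e5 := colourDegree_le_ncard_free (G := G) (c := c) (F₀ := F₀) (z := x) (y := x)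
      (fun p q hp _ hq _ => lx p q hp hq)
    have e6 := hdeg x
    omega
  simp only [Set.mem_union, Set.mem_ofPred_eq, not_or] at hyX
  have hyU : y ∈ U := by
    by_contra hyU
    exact h.not_free_of_isLow hx lx hyU hy
  have hyx : y ≠ x := fun e => hyX.1 (e ▸ Near.refl _ _ _)
  have hyx' : y ≠ x' := fun e => hyX.2 (e ▸ Near.refl _ _ _)
  obtain ⟨z, hyz, hcz⟩ : ∃ z, F₀.Adj y z ∧ ∀ u, F₀.Adj y u → u ≠ z → c s(x, y) ≠ c s(y, u) := by
    obtain ⟨a, b, hab, ha, hb⟩ := htwo y hyU hyx hyx'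
    have hne := h.conf.proper y a b ha hb hab
    by_cases hc : c s(x, y) = c s(y, a)
    · refine ⟨a, ha, fun u hu hua => ?_⟩
      rcases hd y u a b hu ha hb with e | e | e
      · exact absurd e hua
      · rw [e, hc]; exact hne
      · exact absurd e hab
    · refine ⟨b, hb, fun u hu hub => ?_⟩
      rcases hd y u a b hu ha hb with e | e | e
      · rw [e]; exact hc
      · exact absurd e hub
      · exact absurd e hab
  have hyn : ¬ Near F₀ ℓ x y := fun hn => hyX.1 (hn.mono (by omega))
  have hzn : ¬ Near F₀ ℓ x z := fun hn => hyX.1 (hn.trans (Near.of_adj hyz.symm))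
  have hyn' : ¬ Near F₀ ℓ x' y := fun hn => hyX.2 (hn.mono (by omega))
  have hzn' : ¬ Near F₀ ℓ x' z := fun hn => hyX.2 (hn.trans (Near.of_adj hyz.symm))
  have hzU : z ∈ U := h.conf.supp _ _ hyz.symm
  have hzx : z ≠ x := fun e => hzn (e ▸ Near.refl _ _ _)
  have hzx' : z ≠ x' := fun e => hzn' (e ▸ Near.refl _ _ _)
  have h0 : Modif G c ℓ F₀ F₀ {x} := Modif.refl h.conf.le h.conf.proper hd
    (by rintro t rfl t' rfl h; exact absurd rfl h)
  obtain ⟨F₁, h1, h2, h3, -, h5⟩ := h0.rotate h.conf.cyc hd (v := x) rfl lx (fun u hu => hu) hyz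
    (by rintro t rfl; exact hyn) (by rintro t rfl; exact hzn) hy.1
    (fun u hu => hy.2 u hu hu.ne') hcz hℓ
  have hadj : ∀ u v, F₁.Adj u v ↔ (F₀.Adj u v ∧ ¬ ((u = y ∧ v = z) ∨ (u = z ∧ v = y))) ∨
      (u = x ∧ v = y) ∨ (u = y ∧ v = x) := by
    intro u v
    rw [h5, addEdge_adj hyx.symm, delEdge_adj]
  have hxy : F₁.Adj x y := (hadj _ _).2 (Or.inr (Or.inl ⟨rfl, rfl⟩))
  have hMU : insert y (insert z {x}) ⊆ U := by
    rintro t (rfl | rfl | rfl)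
    · exact hyU
    · exact hzU
    · exact hx
  have hx'adj : ∀ u, F₁.Adj x' u → F₀.Adj x' u ∨ (x' = x ∧ u = y) := by
    intro u hu
    rcases (hadj _ _).1 hu with e | e | ⟨e, -⟩
    · exact Or.inl e.1
    · exact Or.inr e
    · exact absurd e.symm hyx'
  refine ⟨F₁, z, x', ⟨⟨⟨h1.le, h1.proper, h1.deg, h1.cyclesGe h.conf.cyc, ?_, ?_⟩, h.max, ?_, hℓ⟩,
    hU, ?_, ?_, ?_, ?_, hzx', ?_, ?_⟩⟩
  · intro u v huv
    by_cases hu : u ∈ insert y (insert z ({x} : Set V))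
    · exact hMU hu
    · exact h.conf.supp u v ((h1.changed u v hu).1 huv)
  · have := h.edges; omega
  · have := h.edges; omega
  · intro a b ha hb
    have ha := (h3 a).1 ha
    have hb := (h3 b).1 hb
    rcases hd z a b y ha.1 hb.1 hyz.symm with e | e | e
    · exact e
    · exact absurd e ha.2
    · exact absurd e hb.2
  · intro a b ha hb
    rcases hx'adj a ha with h6 | ⟨e, rfl⟩ <;> rcases hx'adj b hb with h7 | ⟨e', rfl⟩
    · exact lx' a b h6 h7
    · exact absurd (e' ▸ h6) (hiso e'.symm a)
    · exact absurd (e ▸ h7) (hiso e.symm b)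
    · rfl
  · obtain ⟨a, b, hab, ha, hb⟩ := htwo z hzU hzx hzx'
    by_cases hay : a = y
    · exact ⟨b, (h3 b).2 ⟨hb, fun e => hab (hay.trans e.symm)⟩⟩
    · exact ⟨a, (h3 a).2 ⟨ha, hay⟩⟩
  · by_cases hxx : x = x'
    · exact ⟨y, hxx ▸ hxy⟩
    · obtain ⟨k, hk⟩ := (hnbr hxx).2
      refine ⟨k, (hadj _ _).2 (Or.inl ⟨hk, ?_⟩)⟩
      rintro (⟨e, -⟩ | ⟨e, -⟩)
      · exact hyx' e.symm
      · exact hzx' e.symm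
  · classical
    intro p
    suffices ∀ q : F₁.Walk z x', q.IsPath → ℓ ≤ q.length + 1 from
      (this p.bypass p.bypass_isPath).trans (Nat.succ_le_succ p.length_bypass_le_length)
    intro q hq
    cases q with
    | nil => exact absurd rfl hzx'
    | @cons _ s _ hzs q =>
      rw [Walk.cons_isPath_iff] at hq
      have hold : F₀.Adj z s := ((h3 s).1 hzs).1
      -- A path that meets a modified vertex is long by `sep`, its first edge being old. Any other
      -- path lies entirely in `F₀`, where `z` is far from `x'`.
      by_cases hM : ∃ t ∈ insert y (insert z ({x} : Set V)), t ∈ q.support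
      · obtain ⟨t, ht, htq⟩ := hM
        obtain ⟨t', ht', q', h6, h7⟩ := h1.exists_common_walk (q.takeUntil t htq) ht
        have hne : z ≠ t' := fun e => hq.2 (e ▸ q.support_takeUntil_subset_support htq h7)
        have := h1.sep z (by simp) t' ht' hne
          (Walk.cons (show (F₁ ⊓ F₀).Adj z s from ⟨hzs, hold⟩) q')
        have h8 := q.length_takeUntil_le_length htq
        simp at this ⊢
        omega
      · push Not at hM
        have he : ∀ e ∈ q.edges, e ∈ F₀.edgeSet := by
          intro e
          induction e with | _ a b =>
          intro he
          exact (h1.changed a b fun ha => hM a ha (q.fst_mem_support_of_mem_edges he)).1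
            (q.adj_of_mem_edges he)
        by_contra hlt
        refine hzn' (Near.symm ⟨Walk.cons hold (q.transfer F₀ he), ?_⟩)
        simp at hlt ⊢
        omega
  · intro u hu huz hux'
    by_cases huy : u = y
    · subst huy
      obtain ⟨a, b, hab, ha, hb⟩ := htwo u hu hyx hyx'
      obtain ⟨k, hk, hkz⟩ : ∃ k, F₀.Adj u k ∧ k ≠ z := by
        by_cases haz : a = z
        · exact ⟨b, hb, fun e => hab (haz.trans e.symm)⟩
        · exact ⟨a, ha, haz⟩
      refine ⟨x, k, ?_, hxy.symm, (hadj _ _).2 (Or.inl ⟨hk, ?_⟩)⟩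
      · rintro rfl
        exact hyn ((Near.of_adj hk.symm).mono hℓ)
      · rintro (⟨-, e⟩ | ⟨e, -⟩)
        · exact hkz e
        · exact huz e
    have hkeep : ∀ k, F₀.Adj u k → F₁.Adj u k := by
      intro k hk
      refine (hadj _ _).2 (Or.inl ⟨hk, ?_⟩)
      rintro (⟨e, -⟩ | ⟨e, -⟩)
      · exact huy e
      · exact huz e
    by_cases hux : u = x
    · subst hux
      obtain ⟨k, hk⟩ := (hnbr hux').1
      exact ⟨k, y, fun e => hyn ((Near.of_adj (e ▸ hk)).mono hℓ), hkeep k hk, hxy⟩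
    · obtain ⟨a, b, hab, ha, hb⟩ := htwo u hu hux hux'
      exact ⟨a, b, hab, hkeep a ha, hkeep b hb⟩

end Existence

/-! ### Double counting -/

section DoubleCounting

variable {α β : Type*} [Finite α] [Finite β]

theorem ncard_eq_sum_fibers_fst [Fintype α] (S : Set (α × β)) :
    S.ncard = ∑ a, {b | (a, b) ∈ S}.ncard := by
  classical
  have := Fintype.ofFinite β
  simp only [Set.ncard_eq_toFinset_card', Set.toFinset_ofPred]
  rw [← Finset.card_sigma]
  refine Finset.card_bij (fun p _ => ⟨p.1, p.2⟩) ?_ ?_ ?_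
  · intro p hp; simpa using hp
  · intro p _ q _ h
    simp only [Sigma.mk.injEq, heq_eq_eq] at h
    exact Prod.ext h.1 h.2
  · rintro ⟨a, b⟩ h
    exact ⟨(a, b), by simpa using h, rfl⟩

theorem mul_le_ncard_of_fst {S : Set (α × β)} {A : Set α} {m : ℝ}
    (h : ∀ a ∈ A, m ≤ {b | (a, b) ∈ S}.ncard) : A.ncard * m ≤ S.ncard := by
  classical
  have := Fintype.ofFinite α
  rw [ncard_eq_sum_fibers_fst, Nat.cast_sum, Set.ncard_eq_toFinset_card', ← nsmul_eq_mul]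
  refine (Finset.card_nsmul_le_sum A.toFinset _ m fun a ha => h a (by simpa using ha)).trans ?_
  exact Finset.sum_le_sum_of_subset_of_nonneg (Finset.subset_univ _) fun _ _ _ => Nat.cast_nonneg _

theorem ncard_le_mul_of_fst {S : Set (α × β)} {A : Set α} {m : ℝ} (hS : ∀ p ∈ S, p.1 ∈ A)
    (h : ∀ a ∈ A, ({b | (a, b) ∈ S}.ncard : ℝ) ≤ m) : (S.ncard : ℝ) ≤ A.ncard * m := by
  classical
  have := Fintype.ofFinite α
  rw [ncard_eq_sum_fibers_fst, Nat.cast_sum, Set.ncard_eq_toFinset_card', ← nsmul_eq_mul]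
  refine le_trans (le_of_eq ?_)
    (Finset.sum_le_card_nsmul A.toFinset _ m fun a ha => h a (by simpa using ha))
  refine (Finset.sum_subset (Finset.subset_univ _) fun a _ ha => ?_).symm
  have : {b | (a, b) ∈ S} = ∅ := by
    ext b
    simp only [Set.mem_ofPred_eq, Set.mem_empty_iff_false, iff_false]
    exact fun hb => ha (by simpa using hS _ hb)
  rw [this]; simp

theorem ncard_preimage_swap (S : Set (α × β)) : (Prod.swap ⁻¹' S).ncard = S.ncard := by
  rw [← Set.image_swap_eq_preimage_swap, Set.ncard_image_of_injective _ Prod.swap_injective]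

theorem mul_le_ncard_of_snd {S : Set (α × β)} {B : Set β} {m : ℝ}
    (h : ∀ b ∈ B, m ≤ {a | (a, b) ∈ S}.ncard) : B.ncard * m ≤ S.ncard := by
  rw [← ncard_preimage_swap]
  exact mul_le_ncard_of_fst h

theorem ncard_le_mul_of_snd {S : Set (α × β)} {B : Set β} {m : ℝ} (hS : ∀ p ∈ S, p.2 ∈ B)
    (h : ∀ b ∈ B, ({a | (a, b) ∈ S}.ncard : ℝ) ≤ m) : (S.ncard : ℝ) ≤ B.ncard * m := by
  rw [← ncard_preimage_swap]
  exact ncard_le_mul_of_fst (fun p hp => hS _ hp) h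

end DoubleCounting

/-! ### Popular vertices, heads and the counting of arrows -/

/-- The vertices of `W` available to at least `2κ` robustly reachable arrows. -/
def Popular {V K : Type*} (G : SimpleGraph V) (c : Sym2 V → K) (F₀ : SimpleGraph V) (E : Set V)
    (κ : ℕ) (x : V) (W : Set V) (r : ℕ) : Set V :=
  {y | y ∈ W ∧ 2 * κ ≤ {a | a ∈ Reach G c F₀ E κ x r ∧ Free G c F₀ a y}.ncard}

/-- The heads of the robustly reachable arrows. -/
def Heads {V K : Type*} (G : SimpleGraph V) (c : Sym2 V → K) (F₀ : SimpleGraph V) (E : Set V)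
    (κ : ℕ) (x : V) (r : ℕ) : Set V :=
  {z | ∃ y, (y, z) ∈ Reach G c F₀ E κ x r}

/-- The pairs formed by a robustly reachable arrow and an unpopular vertex available to it. -/
def Stray {V K : Type*} (G : SimpleGraph V) (c : Sym2 V → K) (F₀ : SimpleGraph V) (E : Set V)
    (κ : ℕ) (x : V) (W : Set V) (r : ℕ) : Set ((V × V) × V) :=
  {p | p.1 ∈ Reach G c F₀ E κ x r ∧ Free G c F₀ p.1 p.2 ∧ p.2 ∉ Popular G c F₀ E κ x W r}

/-- A base together with the parameters of the exploration of the reachable arrows: `E` is a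
neighbourhood of the ends and `E₁` a slightly larger one. -/
structure IsFrame {V K : Type*} (G : SimpleGraph V) (c : Sym2 V → K) (ℓ : ℕ) (F₀ : SimpleGraph V)
    (U : Set V) (x x' : V) (E E₁ : Set V) (κ r d : ℕ) : Prop where
  base : IsBase G c ℓ F₀ U x x'
  near : ∀ u, Near F₀ ℓ x u ∨ Near F₀ ℓ x' u → u ∈ E
  subset : E ⊆ E₁
  adj_mem : ∀ y z, F₀.Adj y z → z ∈ E → y ∈ E₁
  large : 4 * ((4 * r + 8) * (2 * ℓ + 1)) < κ
  deg : ∀ v, d + 1 ≤ colourDegree G c v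

section Frame

variable {V K : Type*} [Fintype V] {G : SimpleGraph V} {c : Sym2 V → K} {ℓ : ℕ}
  {F₀ : SimpleGraph V} {U E E₁ : Set V} {κ r d : ℕ} {x x' : V}

local notation "ℛ" => Reach G c F₀ E κ x r
local notation "ℛ₂" => Reach G c F₀ E κ x' r
local notation "𝒟" => Popular G c F₀ E κ x (U \ E₁) r
local notation "𝒟₂" => Popular G c F₀ E κ x' (U \ E₁) r
local notation "𝒵" => Heads G c F₀ E κ x r
local notation "𝒵₂" => Heads G c F₀ E κ x' r

theorem IsFrame.symm (h : IsFrame G c ℓ F₀ U x x' E E₁ κ r d) :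
    IsFrame G c ℓ F₀ U x' x E E₁ κ r d :=
  ⟨h.base.symm, fun u hu => h.near u hu.symm, h.subset, h.adj_mem, h.large, h.deg⟩

theorem IsFrame.pos (h : IsFrame G c ℓ F₀ U x x' E E₁ κ r d) : 0 < κ :=
  (Nat.zero_le _).trans_lt h.large

theorem IsFrame.two_mul_lt (h : IsFrame G c ℓ F₀ U x x' E E₁ κ r d) : 2 * ℓ + 5 < κ := by
  have h1 := h.large
  have h2 : 8 * (2 * ℓ + 1) ≤ (4 * r + 8) * (2 * ℓ + 1) := Nat.mul_le_mul_right _ (by omega)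
  omega

theorem IsFrame.large_of_le (h : IsFrame G c ℓ F₀ U x x' E E₁ κ r d) {m : ℕ} (hm : m ≤ 4 * r + 8) :
    4 * (m * (2 * ℓ + 1)) < κ :=
  lt_of_le_of_lt (Nat.mul_le_mul_left _ (Nat.mul_le_mul_right _ hm)) h.large

theorem IsFrame.not_free (h : IsFrame G c ℓ F₀ U x x' E E₁ κ r d) {a : V × V} (ha : a ∈ ℛ) {w : V}
    (hw : w ∉ U) : ¬ Free G c F₀ a w := by
  refine h.base.not_free_of_notMem h.near ha (lt_of_eq_of_lt ?_
    (h.large_of_le (m := 2 * r + 2) (by omega))) hw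
  ring

theorem IsFrame.exists_nbrs (h : IsFrame G c ℓ F₀ U x x' E E₁ κ r d) {y : V} (hy : y ∈ U \ E₁) :
    ∃ p q, p ≠ q ∧ F₀.Adj y p ∧ F₀.Adj y q ∧ ∀ k, F₀.Adj y k → k = p ∨ k = q := by
  have hyE : y ∉ E := fun hE => hy.2 (h.subset hE)
  obtain ⟨p, q, hpq, hp, hq⟩ := h.base.two y hy.1
    (fun e => hyE (h.near _ (Or.inl (e ▸ Near.refl _ _ _))))
    (fun e => hyE (h.near _ (Or.inr (e ▸ Near.refl _ _ _))))
  refine ⟨p, q, hpq, hp, hq, fun k hk => ?_⟩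
  rcases h.base.isMax.conf.deg y k p q hk hp hq with e | e | e
  · exact Or.inl e
  · exact Or.inr e
  · exact absurd e hpq

/-- The two edges at `y` have different colours, so the new edge agrees with at most one of them;
that one is dropped. -/
theorem step_or_step (hd : DegLeTwo F₀) (hp : ProperOn c F₀) {a : V × V} {y p q : V}
    (hf : Free G c F₀ a y) (h₁ : F₀.Adj y p) (h₂ : F₀.Adj y q) (hne : p ≠ q) :
    Step G c F₀ a (y, p) ∨ Step G c F₀ a (y, q) := by
  have hc := hp y p q h₁ h₂ hne
  by_cases hcq : c s(a.2, y) = c s(y, q)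
  · refine Or.inr ⟨h₂, hf, fun k hk hkq => ?_⟩
    rcases hd y k p q hk h₁ h₂ with e | e | e
    · rw [e, hcq]; exact hc.symm
    · exact absurd e hkq
    · exact absurd e hne
  · refine Or.inl ⟨h₁, hf, fun k hk hkp => ?_⟩
    rcases hd y k p q hk h₁ h₂ with e | e | e
    · exact absurd e hkp
    · rw [e]; exact hcq
    · exact absurd e hne

/-- Each of the `2κ` arrows available to `y` can be continued along one of the two arrows leaving
`y`, so one of these is continued from at least `κ`. The margin between `E` and `E₁` keeps its head
out of `E`. -/
theorem IsFrame.exists_arrow (h : IsFrame G c ℓ F₀ U x x' E E₁ κ r d) {y : V} (hy : y ∈ 𝒟) :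
    ∃ z, (y, z) ∈ Reach G c F₀ E κ x (r + 1) := by
  obtain ⟨p, q, hpq, hp, hq, -⟩ := h.exists_nbrs hy.1
  have hyE : y ∉ E := fun hE => hy.1.2 (h.subset hE)
  have hsub : {a | a ∈ ℛ ∧ Free G c F₀ a y} ⊆
      {a | a ∈ ℛ ∧ Step G c F₀ a (y, p)} ∪ {a | a ∈ ℛ ∧ Step G c F₀ a (y, q)} := by
    rintro a ⟨h1, h2⟩
    exact (step_or_step h.base.isMax.conf.deg h.base.isMax.conf.proper h2 hp hq hpq).imp
      (fun h3 => ⟨h1, h3⟩) (fun h3 => ⟨h1, h3⟩)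
  have h1 := Set.ncard_le_ncard hsub (Set.toFinite _)
  have h2 := Set.ncard_union_le {a | a ∈ ℛ ∧ Step G c F₀ a (y, p)}
    {a | a ∈ ℛ ∧ Step G c F₀ a (y, q)}
  have h3 := hy.2
  by_cases h4 : κ ≤ {a | a ∈ ℛ ∧ Step G c F₀ a (y, p)}.ncard
  · exact ⟨p, hyE, fun hE => hy.1.2 (h.adj_mem _ _ hp hE), Or.inr h4⟩
  · exact ⟨q, hyE, fun hE => hy.1.2 (h.adj_mem _ _ hq hE), Or.inr (by omega)⟩

theorem IsFrame.exists_arrow_of_free_end (h : IsFrame G c ℓ F₀ U x x' E E₁ κ r d) {y : V}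
    (hy : y ∈ U \ E₁) (hf : Free G c F₀ (x, x) y) : ∃ z, (y, z) ∈ Reach G c F₀ E κ x 1 := by
  obtain ⟨p, q, hpq, hp, hq, -⟩ := h.exists_nbrs hy
  have hyE : y ∉ E := fun hE => hy.2 (h.subset hE)
  rcases step_or_step h.base.isMax.conf.deg h.base.isMax.conf.proper hf hp hq hpq with h1 | h1
  · exact ⟨p, hyE, fun hE => hy.2 (h.adj_mem _ _ hp hE), Or.inl h1⟩
  · exact ⟨q, hyE, fun hE => hy.2 (h.adj_mem _ _ hq hE), Or.inl h1⟩

theorem IsFrame.le_ncard_free (h : IsFrame G c ℓ F₀ U x x' E E₁ κ r d) {a : V × V} (ha : a ∈ ℛ) :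
    d ≤ {u | Free G c F₀ a u}.ncard := by
  have hadj := Reach.adj h.pos ha
  have h1 := h.deg a.2
  have h2 := colourDegree_le_ncard_free (G := G) (c := c) (F₀ := F₀) (z := a.2) (y := a.1) (by
    intro p q hp hpa hq hqa
    rcases h.base.isMax.conf.deg _ p q _ hp hq hadj.symm with e | e | e
    · exact e
    · exact absurd e hpa
    · exact absurd e hqa)
  change colourDegree G c a.2 ≤ {u | Free G c F₀ a u}.ncard + 1 at h2
  omega

/-- By maximality the suitable neighbours of `x` lie in `U`, and each of them not in `E₁` is the
tail of an arrow reached in one step. -/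
theorem IsFrame.le_ncard_reach_one (h : IsFrame G c ℓ F₀ U x x' E E₁ κ r d) :
    d ≤ (Reach G c F₀ E κ x 1).ncard + E₁.ncard := by
  have h1 := h.deg x
  have h2 := colourDegree_le_ncard_free (G := G) (c := c) (F₀ := F₀) (z := x) (y := x)
    (fun p q hp _ hq _ => h.base.low p q hp hq)
  have hsub : {u | Free G c F₀ (x, x) u} ⊆ Prod.fst '' (Reach G c F₀ E κ x 1) ∪ E₁ := by
    intro u hu
    by_cases hE : u ∈ E₁
    · exact Or.inr hE
    · left
      have hU : u ∈ U := by
        by_contra hU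
        exact h.base.not_free_end hU hu
      obtain ⟨z, hz⟩ := h.exists_arrow_of_free_end ⟨hU, hE⟩ hu
      exact ⟨(u, z), hz, rfl⟩
  have h3 := Set.ncard_le_ncard hsub (Set.toFinite _)
  have h4 := Set.ncard_union_le (Prod.fst '' (Reach G c F₀ E κ x 1)) E₁
  have h5 := Set.ncard_image_le (f := Prod.fst) (Set.toFinite (Reach G c F₀ E κ x 1))
  omega

theorem Reach.mono {r s : ℕ} (h : r ≤ s) : Reach G c F₀ E κ x r ⊆ Reach G c F₀ E κ x s := by
  induction h with
  | refl => exact subset_rfl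
  | step _ ih => exact ih.trans (Reach.subset_succ _)

theorem IsFrame.ncard_reach_le (h : IsFrame G c ℓ F₀ U x x' E E₁ κ r d) (s : ℕ) :
    (Reach G c F₀ E κ x s).ncard ≤ 2 * Nat.card V := by
  have h1 := ncard_arrows_fst_le h.base.isMax.conf.deg Set.univ
  rw [Set.ncard_univ] at h1
  refine le_trans (Set.ncard_le_ncard ?_ (Set.toFinite _)) h1
  exact fun a ha => ⟨Reach.adj h.pos ha, trivial⟩

/-- By maximality a vertex available to a reachable arrow lies in `U`. So a stray one is in `E₁`, or
is an unpopular vertex of `U \ E₁` and then serves fewer than `2κ` arrows. -/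
theorem IsFrame.ncard_stray_le (h : IsFrame G c ℓ F₀ U x x' E E₁ κ r d) :
    ((Stray G c F₀ E κ x (U \ E₁) r).ncard : ℝ) ≤
      Set.ncard ℛ * E₁.ncard + Nat.card V * (2 * κ) := by
  have hsub : Stray G c F₀ E κ x (U \ E₁) r ⊆ ℛ ×ˢ E₁ ∪
      {p | p.1 ∈ ℛ ∧ Free G c F₀ p.1 p.2 ∧ p.2 ∈ U \ E₁ ∧ p.2 ∉ 𝒟} := by
    rintro ⟨a, u⟩ ⟨h1, h2, h3⟩
    by_cases hE : u ∈ E₁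
    · exact Or.inl ⟨h1, hE⟩
    · refine Or.inr ⟨h1, h2, ⟨?_, hE⟩, h3⟩
      by_contra hU
      exact h.not_free h1 hU h2
  have h1 := Set.ncard_le_ncard hsub (Set.toFinite _)
  have h2 := Set.ncard_union_le (ℛ ×ˢ E₁)
    {p | p.1 ∈ ℛ ∧ Free G c F₀ p.1 p.2 ∧ p.2 ∈ U \ E₁ ∧ p.2 ∉ 𝒟}
  have h3 : (({p | p.1 ∈ ℛ ∧ Free G c F₀ p.1 p.2 ∧ p.2 ∈ U \ E₁ ∧ p.2 ∉ 𝒟} :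
      Set ((V × V) × V)).ncard : ℝ) ≤ (Set.univ : Set V).ncard * (2 * κ) := by
    refine ncard_le_mul_of_snd (fun _ _ => trivial) fun u _ => ?_
    by_cases hu : u ∈ U \ E₁ ∧ u ∉ 𝒟
    · have : {a | a ∈ ℛ ∧ Free G c F₀ a u}.ncard ≤ 2 * κ := by
        by_contra hlt
        exact hu.2 ⟨hu.1, by omega⟩
      have h4 : {a | a ∈ ℛ ∧ Free G c F₀ a u ∧ u ∈ U \ E₁ ∧ u ∉ 𝒟}.ncard ≤ 2 * κ :=
        (Set.ncard_le_ncard (t := {a | a ∈ ℛ ∧ Free G c F₀ a u})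
          (fun a ha => ⟨ha.1, ha.2.1⟩) (Set.toFinite _)).trans this
      exact_mod_cast h4
    · have : {a | a ∈ ℛ ∧ Free G c F₀ a u ∧ u ∈ U \ E₁ ∧ u ∉ 𝒟} = ∅ := by
        ext a
        simp only [Set.mem_ofPred_eq, Set.mem_empty_iff_false, iff_false]
        exact fun ha => hu ha.2.2
      change (({a | a ∈ ℛ ∧ Free G c F₀ a u ∧ u ∈ U \ E₁ ∧ u ∉ 𝒟}.ncard : ℝ)) ≤ _
      rw [this, Set.ncard_empty, Nat.cast_zero]
      exact mul_nonneg zero_le_two κ.cast_nonneg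
  rw [Set.ncard_univ] at h3
  rw [Set.ncard_prod] at h2
  have h4 := h1.trans h2
  have h5 : ((Stray G c F₀ E κ x (U \ E₁) r).ncard : ℝ) ≤ Set.ncard ℛ * E₁.ncard +
    ({p | p.1 ∈ ℛ ∧ Free G c F₀ p.1 p.2 ∧ p.2 ∈ U \ E₁ ∧ p.2 ∉ 𝒟} :
      Set ((V × V) × V)).ncard := by exact_mod_cast h4
  linarith

/-- Most of the vertices available to the reachable arrows are popular. -/
theorem IsFrame.mul_le_ncard_popular (h : IsFrame G c ℓ F₀ U x x' E E₁ κ r d) :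
    (Set.ncard ℛ : ℝ) * d ≤
      Set.ncard ℛ * Set.ncard 𝒟 + (Stray G c F₀ E κ x (U \ E₁) r).ncard := by
  have h1 : (Set.ncard ℛ : ℝ) * d ≤ ({p | p.1 ∈ ℛ ∧ Free G c F₀ p.1 p.2} :
      Set ((V × V) × V)).ncard := by
    refine mul_le_ncard_of_fst fun a ha => ?_
    have h2 := h.le_ncard_free ha
    have h3 : {b | (a, b) ∈ {p : (V × V) × V | p.1 ∈ ℛ ∧ Free G c F₀ p.1 p.2}} =
      {u | Free G c F₀ a u} := by
      ext u; exact ⟨fun hu => hu.2, fun hu => ⟨ha, hu⟩⟩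
    rw [h3]
    exact_mod_cast h2
  have hsub : {p : (V × V) × V | p.1 ∈ ℛ ∧ Free G c F₀ p.1 p.2} ⊆
      ℛ ×ˢ 𝒟 ∪ Stray G c F₀ E κ x (U \ E₁) r := by
    rintro ⟨a, u⟩ ⟨h2, h3⟩
    by_cases hu : u ∈ 𝒟
    · exact Or.inl ⟨h2, hu⟩
    · exact Or.inr ⟨h2, h3, hu⟩
  have h2 := (Set.ncard_le_ncard hsub (Set.toFinite _)).trans (Set.ncard_union_le _ _)
  rw [Set.ncard_prod] at h2
  have h3 : (({p : (V × V) × V | p.1 ∈ ℛ ∧ Free G c F₀ p.1 p.2}.ncard : ℕ) : ℝ) ≤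
    Set.ncard ℛ * Set.ncard 𝒟 + (Stray G c F₀ E κ x (U \ E₁) r).ncard := by exact_mod_cast h2
  linarith

theorem IsFrame.ncard_popular_le (h : IsFrame G c ℓ F₀ U x x' E E₁ κ r d) :
    Set.ncard 𝒟 ≤ (Reach G c F₀ E κ x (r + 1)).ncard := by
  have hsub : 𝒟 ⊆ Prod.fst '' Reach G c F₀ E κ x (r + 1) := by
    intro y hy
    obtain ⟨z, hz⟩ := h.exists_arrow hy
    exact ⟨(y, z), hz, rfl⟩
  exact (Set.ncard_le_ncard hsub (Set.toFinite _)).trans (Set.ncard_image_le (Set.toFinite _))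

/-- A popular vertex of the other side is the head of at most one reachable arrow. -/
theorem IsFrame.eq_of_mem_popular (h : IsFrame G c ℓ F₀ U x x' E E₁ κ r d) {z y₁ y₂ : V}
    (hz : z ∈ 𝒟₂) (h₁ : (y₁, z) ∈ ℛ) (h₂ : (y₂, z) ∈ ℛ) : y₁ = y₂ := by
  by_contra hne
  have hd := h.base.isMax.conf.deg
  have a₁ := (Reach.adj h.pos h₁).symm
  have a₂ := (Reach.adj h.pos h₂).symm
  dsimp only at a₁ a₂
  have hcol := h.base.isMax.conf.proper z y₁ y₂ a₁ a₂ hne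
  -- At most `2ℓ + 5` vertices are near `z`, and each is the head of at most two arrows; this is
  -- less than the `2κ` arrows that popularity supplies.
  obtain ⟨a', ⟨ha', hf⟩, hfar⟩ : ∃ a' ∈ {a | a ∈ ℛ₂ ∧ Free G c F₀ a z},
      a' ∉ {a : V × V | F₀.Adj a.1 a.2 ∧ (a.1 ∈ (∅ : Set V) ∨ a.2 ∈ {v | Near F₀ (ℓ + 2) z v})} := by
    by_contra! hcon
    have e1 := Set.ncard_le_ncard hcon (Set.toFinite _)
    have e2 := ncard_arrows_fst_le hd {v | Near F₀ (ℓ + 2) z v}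
    have e3 := ncard_near_le hd z (ℓ + 2)
    have e4 := h.two_mul_lt
    have e5 := hz.2
    have e6 : {a : V × V | F₀.Adj a.1 a.2 ∧
        (a.1 ∈ (∅ : Set V) ∨ a.2 ∈ {v | Near F₀ (ℓ + 2) z v})}.ncard ≤
        {a : V × V | F₀.Adj a.1 a.2 ∧ a.1 ∈ {v | Near F₀ (ℓ + 2) z v}}.ncard := by
      rw [← Set.ncard_image_of_injective _ Prod.swap_injective]
      refine Set.ncard_le_ncard ?_ (Set.toFinite _)
      rintro _ ⟨⟨p, q⟩, ⟨h1, h2⟩, rfl⟩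
      exact ⟨h1.symm, h2.resolve_left (by simp)⟩
    omega
  have hfar' : ¬ Near F₀ (ℓ + 2) z a'.2 := fun hn =>
    hfar ⟨Reach.adj h.pos ha', Or.inr hn⟩
  have hG := hf.1.symm
  have fin : ∀ {y : V}, (y, z) ∈ ℛ → Free G c F₀ (y, z) a'.2 → False := fun hy hfy =>
    h.base.not_free_pair h.near hy ha' (h.large_of_le (by omega)) hfar' hfy hf
  -- Both edges at `z` can be dropped in some rotation. The joining edge agrees in colour with at
  -- most one of them, and the arrow that drops that one makes `z` free for it.
  by_cases hc : c s(z, a'.2) = c s(z, y₂)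
  · refine fin h₂ ⟨hG, fun k hk hky => ?_⟩
    dsimp only at hk hky ⊢
    rcases hd z k y₁ y₂ hk a₁ a₂ with e | e | e
    · rw [e, hc]; exact hcol.symm
    · exact absurd e hky
    · exact absurd e hne
  · refine fin h₁ ⟨hG, fun k hk hky => ?_⟩
    dsimp only at hk hky ⊢
    rcases hd z k y₁ y₂ hk a₁ a₂ with e | e | e
    · exact absurd e hky
    · rw [e]; exact hc
    · exact absurd e hne

theorem IsFrame.heads_subset (h : IsFrame G c ℓ F₀ U x x' E E₁ κ r d) : 𝒵 ⊆ U := by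
  rintro z ⟨y, hy⟩
  exact h.base.isMax.conf.supp _ _ (Reach.adj h.pos hy).symm

theorem IsFrame.popular_subset : 𝒟 ⊆ U := fun _ h => h.1.1

theorem ncard_tails_le (hd : DegLeTwo F₀) (z : V) {S : Set (V × V)}
    (hS : ∀ a ∈ S, F₀.Adj a.1 a.2) : {y | (y, z) ∈ S}.ncard ≤ 2 := by
  classical
  by_contra! hlt
  obtain ⟨a, b, e, ha, hb, he, hab, hae, hbe⟩ := (Set.two_lt_ncard_iff (Set.toFinite _)).1 hlt
  rcases hd z a b e (hS _ ha).symm (hS _ hb).symm (hS _ he).symm with h | h | h <;> contradiction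

/-- Count arrows by their heads. A head in `𝒟₂` receives one arrow by `IsFrame.eq_of_mem_popular`,
any other head at most two, and there are at most `|U| - |𝒟₂|` of the latter. -/
theorem IsFrame.ncard_reach_add_le (h : IsFrame G c ℓ F₀ U x x' E E₁ κ r d) :
    (Set.ncard ℛ : ℝ) + 2 * Set.ncard 𝒟₂ ≤ 2 * U.ncard + (𝒟₂ ∩ 𝒵).ncard := by
  have hd := h.base.isMax.conf.deg
  have h1 : (({a | a ∈ ℛ ∧ a.2 ∈ 𝒟₂} : Set (V × V)).ncard : ℝ) ≤ (𝒟₂ ∩ 𝒵).ncard * 1 := by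
    refine ncard_le_mul_of_snd (fun a ha => ⟨ha.2, a.1, ha.1⟩) fun z hz => ?_
    have : {y | (y, z) ∈ {a | a ∈ ℛ ∧ a.2 ∈ 𝒟₂}}.ncard ≤ 1 :=
      (Set.ncard_le_one_iff (Set.toFinite _)).2 fun ha hb => h.eq_of_mem_popular hz.1 ha.1 hb.1
    exact_mod_cast this
  have h2 : (({a | a ∈ ℛ ∧ a.2 ∉ 𝒟₂} : Set (V × V)).ncard : ℝ) ≤ (𝒵 \ 𝒟₂).ncard * 2 := by
    refine ncard_le_mul_of_snd (fun a ha => ⟨⟨a.1, ha.1⟩, ha.2⟩) fun z hz => ?_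
    have := ncard_tails_le hd z (S := {a | a ∈ ℛ ∧ a.2 ∉ 𝒟₂}) fun a ha => Reach.adj h.pos ha.1
    exact_mod_cast this
  have h3 : Set.ncard ℛ ≤ ({a | a ∈ ℛ ∧ a.2 ∈ 𝒟₂} : Set (V × V)).ncard +
      ({a | a ∈ ℛ ∧ a.2 ∉ 𝒟₂} : Set (V × V)).ncard := by
    refine le_trans (Set.ncard_le_ncard ?_ (Set.toFinite _)) (Set.ncard_union_le _ _)
    intro a ha
    by_cases hm : a.2 ∈ 𝒟₂
    · exact Or.inl ⟨ha, hm⟩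
    · exact Or.inr ⟨ha, hm⟩
  have h4 : (𝒵 \ 𝒟₂).ncard + Set.ncard 𝒟₂ ≤ U.ncard := by
    rw [← Set.ncard_union_eq Set.disjoint_sdiff_left (Set.toFinite _) (Set.toFinite _)]
    exact Set.ncard_le_ncard (Set.union_subset (Set.sdiff_subset.trans h.heads_subset)
      IsFrame.popular_subset) (Set.toFinite _)
  have h3' : (Set.ncard ℛ : ℝ) ≤ ({a | a ∈ ℛ ∧ a.2 ∈ 𝒟₂} : Set (V × V)).ncard +
      ({a | a ∈ ℛ ∧ a.2 ∉ 𝒟₂} : Set (V × V)).ncard := by exact_mod_cast h3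
  have h4' : ((𝒵 \ 𝒟₂).ncard : ℝ) + Set.ncard 𝒟₂ ≤ U.ncard := by exact_mod_cast h4
  linarith

/-- For most of the heads of reachable arrows that are popular for the other side, the arrow is
free to most of the heads on the other side. -/
theorem IsFrame.mul_le_ncard_pairs (h : IsFrame G c ℓ F₀ U x x' E E₁ κ r d) :
    ((𝒟₂ ∩ 𝒵).ncard : ℝ) * d ≤
      ({p | p.1 ∈ 𝒟₂ ∩ 𝒵 ∧ p.2 ∈ 𝒟 ∩ 𝒵₂ ∧ ∃ y, (y, p.1) ∈ ℛ ∧ Free G c F₀ (y, p.1) p.2} :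
        Set (V × V)).ncard + (𝒟₂ ∩ 𝒵).ncard * (𝒟 \ 𝒵₂).ncard +
        (Stray G c F₀ E κ x (U \ E₁) r).ncard := by
  have h1 : ((𝒟₂ ∩ 𝒵).ncard : ℝ) * d ≤ ({p | p.1 ∈ 𝒟₂ ∩ 𝒵 ∧
      ∃ y, (y, p.1) ∈ ℛ ∧ Free G c F₀ (y, p.1) p.2} : Set (V × V)).ncard := by
    refine mul_le_ncard_of_fst fun z hz => ?_
    obtain ⟨y, hy⟩ := hz.2
    have h2 : d ≤ {u | (z, u) ∈ ({p | p.1 ∈ 𝒟₂ ∩ 𝒵 ∧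
        ∃ y, (y, p.1) ∈ ℛ ∧ Free G c F₀ (y, p.1) p.2} : Set (V × V))}.ncard := by
      refine (h.le_ncard_free hy).trans (Set.ncard_le_ncard ?_ (Set.toFinite _))
      exact fun u hu => ⟨hz, y, hy, hu⟩
    exact_mod_cast h2
  have hsub : {p : V × V | p.1 ∈ 𝒟₂ ∩ 𝒵 ∧ ∃ y, (y, p.1) ∈ ℛ ∧ Free G c F₀ (y, p.1) p.2} ⊆
      ({p | p.1 ∈ 𝒟₂ ∩ 𝒵 ∧ p.2 ∈ 𝒟 ∩ 𝒵₂ ∧ ∃ y, (y, p.1) ∈ ℛ ∧ Free G c F₀ (y, p.1) p.2} ∪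
        (𝒟₂ ∩ 𝒵) ×ˢ (𝒟 \ 𝒵₂)) ∪
        (fun q : (V × V) × V => (q.1.2, q.2)) '' Stray G c F₀ E κ x (U \ E₁) r := by
    rintro ⟨z, u⟩ ⟨hz, y, hy, hf⟩
    by_cases hu : u ∈ 𝒟
    · left
      by_cases hu' : u ∈ 𝒵₂
      · exact Or.inl ⟨hz, ⟨hu, hu'⟩, y, hy, hf⟩
      · exact Or.inr ⟨hz, hu, hu'⟩
    · exact Or.inr ⟨((y, z), u), ⟨hy, hf, hu⟩, rfl⟩
  have h2 := Set.ncard_le_ncard hsub (Set.toFinite _)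
  have h3 := Set.ncard_union_le
    ({p | p.1 ∈ 𝒟₂ ∩ 𝒵 ∧ p.2 ∈ 𝒟 ∩ 𝒵₂ ∧ ∃ y, (y, p.1) ∈ ℛ ∧ Free G c F₀ (y, p.1) p.2} ∪
        (𝒟₂ ∩ 𝒵) ×ˢ (𝒟 \ 𝒵₂))
    ((fun q : (V × V) × V => (q.1.2, q.2)) '' Stray G c F₀ E κ x (U \ E₁) r)
  have h4 := Set.ncard_union_le
    {p | p.1 ∈ 𝒟₂ ∩ 𝒵 ∧ p.2 ∈ 𝒟 ∩ 𝒵₂ ∧ ∃ y, (y, p.1) ∈ ℛ ∧ Free G c F₀ (y, p.1) p.2}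
    ((𝒟₂ ∩ 𝒵) ×ˢ (𝒟 \ 𝒵₂))
  have h5 := Set.ncard_image_le (f := fun q : (V × V) × V => (q.1.2, q.2))
    (Set.toFinite (Stray G c F₀ E κ x (U \ E₁) r))
  rw [Set.ncard_prod] at h4
  have h6 := h2.trans (h3.trans (Nat.add_le_add h4 h5))
  refine h1.trans ?_
  exact_mod_cast h6

/-- Let `P` and `Q` be the pairs free as seen from the first and from the second side. By
`IsBase.not_free_pair` a pair free from both sides must be near, so `|P| + |Q|` exceeds the size of
the whole product by at most the number of near pairs. -/
theorem IsFrame.mul_add_mul_le (h : IsFrame G c ℓ F₀ U x x' E E₁ κ r d) :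
    ((𝒟₂ ∩ 𝒵).ncard : ℝ) * d + (𝒟 ∩ 𝒵₂).ncard * d ≤
      (𝒟₂ ∩ 𝒵).ncard * (𝒟 ∩ 𝒵₂).ncard + Nat.card V * (2 * ℓ + 5) +
      (𝒟₂ ∩ 𝒵).ncard * (𝒟 \ 𝒵₂).ncard + (𝒟 ∩ 𝒵₂).ncard * (𝒟₂ \ 𝒵).ncard +
      (Stray G c F₀ E κ x (U \ E₁) r).ncard + (Stray G c F₀ E κ x' (U \ E₁) r).ncard := by
  have h1 := h.mul_le_ncard_pairs
  have h2 := h.symm.mul_le_ncard_pairs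
  set P : Set (V × V) :=
    {p | p.1 ∈ 𝒟₂ ∩ 𝒵 ∧ p.2 ∈ 𝒟 ∩ 𝒵₂ ∧ ∃ y, (y, p.1) ∈ ℛ ∧ Free G c F₀ (y, p.1) p.2} with hP
  set Q : Set (V × V) :=
    {p | p.1 ∈ 𝒟 ∩ 𝒵₂ ∧ p.2 ∈ 𝒟₂ ∩ 𝒵 ∧ ∃ y, (y, p.1) ∈ ℛ₂ ∧ Free G c F₀ (y, p.1) p.2} with hQ
  have h3 : P ∩ Prod.swap ⁻¹' Q ⊆ {p | Near F₀ (ℓ + 2) p.1 p.2} := by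
    rintro ⟨z, z'⟩ ⟨⟨-, -, y, hy, hf⟩, -, -, y', hy', hf'⟩
    by_contra hn
    exact h.base.not_free_pair h.near hy hy' (h.large_of_le (by omega)) hn hf hf'
  have h4 : (({p | Near F₀ (ℓ + 2) p.1 p.2} : Set (V × V)).ncard : ℝ) ≤
      (Set.univ : Set V).ncard * (2 * ℓ + 5) := by
    refine ncard_le_mul_of_fst (fun _ _ => trivial) fun z _ => ?_
    have := ncard_near_le h.base.isMax.conf.deg z (ℓ + 2)
    have h5 : {b | (z, b) ∈ {p : V × V | Near F₀ (ℓ + 2) p.1 p.2}}.ncard ≤ 2 * ℓ + 5 := by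
      refine this.trans (by omega)
    exact_mod_cast h5
  rw [Set.ncard_univ] at h4
  have h5 : P ∪ Prod.swap ⁻¹' Q ⊆ (𝒟₂ ∩ 𝒵) ×ˢ (𝒟 ∩ 𝒵₂) := by
    rintro ⟨z, z'⟩ (⟨hz, hz', -⟩ | ⟨hz', hz, -⟩)
    · exact ⟨hz, hz'⟩
    · exact ⟨hz, hz'⟩
  have h6 := Set.ncard_union_add_ncard_inter P (Prod.swap ⁻¹' Q)
  rw [ncard_preimage_swap] at h6
  have h7 := Set.ncard_le_ncard h5 (Set.toFinite _)
  rw [Set.ncard_prod] at h7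
  have h8 := Set.ncard_le_ncard h3 (Set.toFinite _)
  have h6' : ((P ∪ Prod.swap ⁻¹' Q).ncard : ℝ) + (P ∩ Prod.swap ⁻¹' Q).ncard =
    P.ncard + Q.ncard := by exact_mod_cast h6
  have h7' : ((P ∪ Prod.swap ⁻¹' Q).ncard : ℝ) ≤ (𝒟₂ ∩ 𝒵).ncard * (𝒟 ∩ 𝒵₂).ncard := by
    exact_mod_cast h7
  have h8' : ((P ∩ Prod.swap ⁻¹' Q).ncard : ℝ) ≤
    ({p | Near F₀ (ℓ + 2) p.1 p.2} : Set (V × V)).ncard := by exact_mod_cast h8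
  linarith

end Frame

/-! ### Stable frames -/

/-- A frame in which the reachable arrows are almost closed under further rotations and the number
of heads is almost as small as possible, all errors being at most `m`. -/
structure IsStable {V K : Type*} (G : SimpleGraph V) (c : Sym2 V → K) (ℓ : ℕ) (F₀ : SimpleGraph V)
    (U : Set V) (x x' : V) (E E₁ : Set V) (κ r d : ℕ) (m : ℝ) : Prop where
  frame : IsFrame G c ℓ F₀ U x x' E E₁ κ r d
  heads_le : ((Heads G c F₀ E κ x r).ncard : ℝ) ≤ d / 2 + m
  le_popular : (d : ℝ) - m ≤ (Popular G c F₀ E κ x (U \ E₁) r).ncard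
  popular_le : ((Popular G c F₀ E κ x (U \ E₁) r).ncard : ℝ) ≤ d + m
  card_le : (U.ncard : ℝ) ≤ 3 / 2 * d + m
  le_card : 3 / 2 * (d : ℝ) - m ≤ U.ncard
  grow : ((Reach G c F₀ E κ x (r + 1)).ncard : ℝ) ≤ (Reach G c F₀ E κ x r).ncard + m
  stray : ((Stray G c F₀ E κ x (U \ E₁) r).ncard : ℝ) ≤ m * Nat.card V
  threshold_le : (κ : ℝ) ≤ m

/-- In units of `n`, the popular sets have sizes `d₀ + d₁ = d + s` and `e₀ + e₁ = d + t`, where `d₀`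
and `e₀` are the parts that are heads of the other side. The counts of arrows give `d₀ ≥ 2s + t -
3μ` and `e₀ ≥ s + 2t - 3μ`, and the count of pairs becomes `(d₀ - s)(e₀ - t) ≤ st + 2μ`. So `(s + t
- 3μ)² ≤ (s + t)²/4 + 2μ` unless `s + t` is already small, which bounds `s + t`; then `d₀e₀ ≤ s e₀ +
t d₀ + 2μ` is small too. -/
theorem overlap_le_or_le {d d₀ d₁ e₀ e₁ μ α ρ : ℝ} (hd₀ : 0 ≤ d₀) (hd₁ : 0 ≤ d₁) (he₀ : 0 ≤ e₀)
    (he₁ : 0 ≤ e₁) (hd : d₀ + d₁ ≤ 1) (he : e₀ + e₁ ≤ 1) (h₁ : d - μ ≤ d₀ + d₁)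
    (h₂ : d - μ ≤ e₀ + e₁) (h₃ : d₀ + d₁ + 2 * (e₀ + e₁) ≤ 3 * d + 3 * μ + e₀)
    (h₄ : e₀ + e₁ + 2 * (d₀ + d₁) ≤ 3 * d + 3 * μ + d₀)
    (h₅ : e₀ * d + d₀ * d ≤ e₀ * d₀ + e₀ * d₁ + d₀ * e₁ + 2 * μ) (hμ : 0 ≤ μ) (hα : 0 < α)
    (hα₁ : α ≤ 1) (hμα : 20 * μ ≤ α ^ 2) (hρ : 0 ≤ ρ) (hαρ : 6 * α ≤ ρ ^ 2) :
    (d₀ ≤ ρ ∨ e₀ ≤ ρ) ∧ d₀ + d₁ ≤ d + 2 * α ∧ e₀ + e₁ ≤ d + 2 * α := by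
  obtain ⟨s, hs⟩ : ∃ s, s = d₀ + d₁ - d := ⟨_, rfl⟩
  obtain ⟨t, ht⟩ : ∃ t, t = e₀ + e₁ - d := ⟨_, rfl⟩
  have hd₁' : d₁ = s + d - d₀ := by linarith
  have he₁' : e₁ = t + d - e₀ := by linarith
  subst hd₁' he₁'
  have a1 : 2 * s + t - 3 * μ ≤ d₀ := by linarith
  have a2 : s + 2 * t - 3 * μ ≤ e₀ := by linarith
  have a3 : (d₀ - s) * (e₀ - t) ≤ s * t + 2 * μ := by linarith
  have hμα' : 20 * μ ≤ α := hμα.trans (by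
    rw [pow_two]; exact mul_le_of_le_one_left hα.le hα₁)
  have key : s + t ≤ α + 3 * μ := by
    by_contra! hlt
    have b1 : (s + t - 3 * μ) * (s + t - 3 * μ) ≤ (d₀ - s) * (e₀ - t) := by
      apply mul_le_mul <;> linarith
    have b2 : s + t ≤ 2 := by linarith
    have b3 : 4 * (s * t) ≤ (s + t) ^ 2 := by linarith [sq_nonneg (s - t)]
    have b4 : μ * (s + t) ≤ μ * 2 := mul_le_mul_of_nonneg_left b2 hμ
    have b5 : α ^ 2 < (s + t) ^ 2 := pow_lt_pow_left₀ (by linarith) hα.le two_ne_zero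
    have b6 : 0 ≤ μ ^ 2 := sq_nonneg μ
    linarith
  have hs' : s ≤ 2 * α := by linarith
  have ht' : t ≤ 2 * α := by linarith
  refine ⟨?_, by linarith, by linarith⟩
  by_contra! hcon
  have c1 : ρ * ρ < d₀ * e₀ := mul_lt_mul'' hcon.1 hcon.2 hρ hρ
  have c2 : s * e₀ ≤ 2 * α * 1 := mul_le_mul hs' (by linarith) he₀ (by linarith)
  have c3 : t * d₀ ≤ 2 * α * 1 := mul_le_mul ht' (by linarith) hd₀ (by linarith)
  linarith

/-- The `T` increments of a monotone sequence bounded by `M` sum to at most `M`. -/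
theorem exists_small_step {f : ℕ → ℕ} (hf : ∀ r, f r ≤ f (r + 1)) {T M : ℕ} (hT : 1 ≤ T)
    (hM : ∀ r, f r ≤ M) : ∃ r, 1 ≤ r ∧ r ≤ T ∧ T * (f (r + 1) - f r) ≤ M := by
  by_contra! hcon
  have h : ∀ k, k ≤ T → k * (M + 1) ≤ T * f (k + 1) := by
    intro k
    induction k with
    | zero => simp
    | succ k ih =>
      intro hk
      have h1 := ih (by omega)
      have h2 := hcon (k + 1) (by omega) hk
      have h3 := Nat.mul_le_mul_left T (hf (k + 1))
      rw [Nat.mul_sub] at h2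
      rw [Nat.succ_mul]
      omega
  have h1 := Nat.le_of_mul_le_mul_left (h T le_rfl) hT
  have h2 := hM (T + 1)
  omega

section Stable

variable {V K : Type*} [Fintype V] {G : SimpleGraph V} {c : Sym2 V → K} {ℓ : ℕ}
  {F₀ : SimpleGraph V} {U : Set V} {x x' : V}

/-- Divide `IsFrame.mul_le_ncard_popular` by the number of reachable arrows. Already the first round
provides at least `d - |E₁|`, which is at least a quarter of `|V|`; this turns the factor `2` of the
stray bound into `8`. -/
theorem IsFrame.le_ncard_popular {E E₁ : Set V} {κ r d : ℕ}
    (h : IsFrame G c ℓ F₀ U x x' E E₁ κ r d) (hr : 1 ≤ r) (hn : 0 < (Nat.card V : ℝ))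
    (hd : (Nat.card V : ℝ) ≤ 2 * d) (hE : (4 * E₁.ncard : ℝ) ≤ Nat.card V) :
    (Stray G c F₀ E κ x (U \ E₁) r).ncard ≤ 2 * (Nat.card V : ℝ) * (E₁.ncard + κ) ∧
    (d : ℝ) - 8 * (E₁.ncard + κ) ≤ (Popular G c F₀ E κ x (U \ E₁) r).ncard := by
  have h1 := h.ncard_stray_le
  have h2 := h.mul_le_ncard_popular
  have h3 : ((Reach G c F₀ E κ x r).ncard : ℝ) ≤ 2 * Nat.card V := by
    exact_mod_cast h.ncard_reach_le r
  have h4 : (d : ℝ) ≤ (Reach G c F₀ E κ x r).ncard + E₁.ncard := by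
    have := h.le_ncard_reach_one
    have h5 := Set.ncard_le_ncard (Reach.mono (G := G) (c := c) (F₀ := F₀) (E := E) (κ := κ)
      (x := x) hr) (Set.toFinite _)
    have h6 : d ≤ (Reach G c F₀ E κ x r).ncard + E₁.ncard := by omega
    exact_mod_cast h6
  have hS : ((Stray G c F₀ E κ x (U \ E₁) r).ncard : ℝ) ≤
      2 * (Nat.card V : ℝ) * (E₁.ncard + κ) := by
    have : ((Reach G c F₀ E κ x r).ncard : ℝ) * E₁.ncard ≤ 2 * Nat.card V * E₁.ncard := by gcongr
    linarith
  refine ⟨hS, ?_⟩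
  have hR : (Nat.card V : ℝ) / 4 ≤ (Reach G c F₀ E κ x r).ncard := by linarith
  have hR0 : 0 < ((Reach G c F₀ E κ x r).ncard : ℝ) := by linarith
  refine le_of_mul_le_mul_left ?_ hR0
  have h7 : (Nat.card V : ℝ) / 4 * (8 * (E₁.ncard + κ)) ≤
      (Reach G c F₀ E κ x r).ncard * (8 * (E₁.ncard + κ)) := by gcongr
  linarith

/-- Heads of one side and popular vertices of the other lie in `U` and hardly overlap, so there are
at most about `|U| - d` heads, that is `d/2`. The lower bound on `|U|` comes from the count of
arrows by heads, as there are about `d` arrows or more. -/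
theorem IsFrame.isStable {E E₁ : Set V} {κ r d : ℕ} (h : IsFrame G c ℓ F₀ U x x' E E₁ κ r d)
    {N μ α ρ : ℝ} (hN : N = Nat.card V) (hN0 : 0 < N)
    (hS : (Stray G c F₀ E κ x (U \ E₁) r).ncard ≤ 2 * (Nat.card V : ℝ) * (E₁.ncard + κ))
    (hκ : 8 * (E₁.ncard + κ : ℝ) ≤ μ * N)
    (hD : (d : ℝ) - μ * N ≤ (Popular G c F₀ E κ x (U \ E₁) r).ncard)
    (hD' : (d : ℝ) - μ * N ≤ (Popular G c F₀ E κ x' (U \ E₁) r).ncard)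
    (hDle : ((Popular G c F₀ E κ x (U \ E₁) r).ncard : ℝ) ≤ d + 2 * α * N)
    (hover : ((Popular G c F₀ E κ x' (U \ E₁) r ∩ Heads G c F₀ E κ x r).ncard : ℝ) ≤ ρ * N)
    (hU : (U.ncard : ℝ) ≤ 3 / 2 * d + μ * N)
    (hgrow : ((Reach G c F₀ E κ x (r + 1)).ncard : ℝ) ≤ (Reach G c F₀ E κ x r).ncard + μ * N)
    (hα : 2 * α ≤ ρ) (hμ : 2 * μ ≤ ρ) (hρ : 0 ≤ ρ) :
    IsStable G c ℓ F₀ U x x' E E₁ κ r d (2 * ρ * N) := by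
  have hE0 : (0 : ℝ) ≤ E₁.ncard := Nat.cast_nonneg _
  have hκ0 : (0 : ℝ) ≤ κ := Nat.cast_nonneg _
  have hρN : 0 ≤ ρ * N := by positivity
  have hμN : 2 * (μ * N) ≤ ρ * N := by nlinarith
  have hαN : 2 * (α * N) ≤ ρ * N := by nlinarith
  refine ⟨h, ?_, by linarith, by linarith, by linarith, ?_, by linarith, ?_, by linarith⟩
  · have h1 := Set.ncard_union_add_ncard_inter (Popular G c F₀ E κ x' (U \ E₁) r)
      (Heads G c F₀ E κ x r)
    have h2 := Set.ncard_le_ncard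
      (Set.union_subset (IsFrame.popular_subset (G := G) (c := c) (F₀ := F₀) (E := E) (κ := κ)
        (x := x') (U := U) (E₁ := E₁) (r := r)) h.heads_subset) (Set.toFinite U)
    have h3 : ((Popular G c F₀ E κ x' (U \ E₁) r).ncard : ℝ) + (Heads G c F₀ E κ x r).ncard ≤
      U.ncard + (Popular G c F₀ E κ x' (U \ E₁) r ∩ Heads G c F₀ E κ x r).ncard := by
        have : (Popular G c F₀ E κ x' (U \ E₁) r).ncard + (Heads G c F₀ E κ x r).ncard ≤
          U.ncard + (Popular G c F₀ E κ x' (U \ E₁) r ∩ Heads G c F₀ E κ x r).ncard := by omega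
        exact_mod_cast this
    linarith
  · have h1 := h.ncard_reach_add_le
    have h2 : ((Popular G c F₀ E κ x (U \ E₁) r).ncard : ℝ) ≤
        (Reach G c F₀ E κ x (r + 1)).ncard := by exact_mod_cast h.ncard_popular_le
    linarith
  · rw [← hN] at hS ⊢
    refine hS.trans ?_
    have : 2 * (E₁.ncard + κ : ℝ) ≤ 2 * ρ * N := by linarith
    nlinarith

/-- Some number of rounds gives a stable frame, for one of the two ends. -/
theorem IsBase.exists_isStable (h : IsBase G c ℓ F₀ U x x') {κ T d : ℕ} {μ α ρ : ℝ}
    (hdeg : ∀ v, d + 1 ≤ colourDegree G c v) (hn : 0 < (Nat.card V : ℝ))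
    (hd : (Nat.card V : ℝ) ≤ 2 * d) (hT : 1 ≤ T) (hμT : 4 ≤ μ * T)
    (hκ : 4 * ((4 * T + 8) * (2 * ℓ + 1)) < κ)
    (hκ' : 8 * ((4 * ℓ + 6 : ℝ) + κ) ≤ μ * Nat.card V)
    (hU : (U.ncard : ℝ) ≤ 3 / 2 * d + μ * Nat.card V) (hμ : 0 ≤ μ) (hμ₁ : μ ≤ 1) (hα : 0 < α)
    (hα₁ : α ≤ 1) (hμα : 20 * μ ≤ α ^ 2) (hρ : 0 ≤ ρ) (hρ₁ : ρ ≤ 1) (hαρ : 6 * α ≤ ρ ^ 2) :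
    ∃ y y' E E₁ r, IsStable G c ℓ F₀ U y y' E E₁ κ r d (2 * ρ * Nat.card V) := by
  have hdeg2 := h.isMax.conf.deg
  set E : Set V := {u | Near F₀ ℓ x u ∨ Near F₀ ℓ x' u} with hE
  set E₁ : Set V := {u | Near F₀ (ℓ + 1) x u ∨ Near F₀ (ℓ + 1) x' u} with hE₁
  have hframe : ∀ r, r ≤ T → IsFrame G c ℓ F₀ U x x' E E₁ κ r d := by
    intro r hr
    refine ⟨h, fun u hu => hu, ?_, ?_, lt_of_le_of_lt ?_ hκ, hdeg⟩
    · exact fun u hu => hu.imp (fun hn => hn.mono (by omega)) (fun hn => hn.mono (by omega))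
    · intro y z hyz hz
      exact hz.imp (fun hn => hn.trans (Near.of_adj hyz.symm))
        (fun hn => hn.trans (Near.of_adj hyz.symm))
    · gcongr
  have hE₁card : E₁.ncard ≤ 4 * ℓ + 6 := by
    have e1 : E₁ = {u | Near F₀ (ℓ + 1) x u} ∪ {u | Near F₀ (ℓ + 1) x' u} := rfl
    have e2 := Set.ncard_union_le {u | Near F₀ (ℓ + 1) x u} {u | Near F₀ (ℓ + 1) x' u}
    have e3 := ncard_near_le hdeg2 x (ℓ + 1)
    have e4 := ncard_near_le hdeg2 x' (ℓ + 1)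
    rw [e1]
    omega
  set N : ℝ := (Nat.card V : ℝ) with hN
  have hE₁card' : (E₁.ncard : ℝ) ≤ 4 * ℓ + 6 := by exact_mod_cast hE₁card
  have hκE : 8 * (E₁.ncard + κ : ℝ) ≤ μ * N := by linarith
  have hκ0 : (0 : ℝ) ≤ κ := Nat.cast_nonneg _
  have hE0 : (0 : ℝ) ≤ E₁.ncard := Nat.cast_nonneg _
  have hμN : μ * N ≤ N := by nlinarith
  have hE4 : (4 * E₁.ncard : ℝ) ≤ N := by linarith
  have hf0 := hframe 0 (Nat.zero_le _)
  -- The growth of both sides is summed, so that one number of rounds serves both.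
  obtain ⟨r, hr1, hrT, hr⟩ := exists_small_step
    (f := fun r => (Reach G c F₀ E κ x r).ncard + (Reach G c F₀ E κ x' r).ncard)
    (fun r => Nat.add_le_add (Set.ncard_le_ncard (Reach.subset_succ r) (Set.toFinite _))
      (Set.ncard_le_ncard (Reach.subset_succ r) (Set.toFinite _))) hT
    (fun r => Nat.add_le_add (hf0.ncard_reach_le r) (hf0.symm.ncard_reach_le r))
  have hF := hframe r hrT
  have m1 := Set.ncard_le_ncard (Reach.subset_succ (G := G) (c := c) (F₀ := F₀) (E := E) (κ := κ)
    (x := x) r) (Set.toFinite _)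
  have m2 := Set.ncard_le_ncard (Reach.subset_succ (G := G) (c := c) (F₀ := F₀) (E := E) (κ := κ)
    (x := x') r) (Set.toFinite _)
  have grow : ((Reach G c F₀ E κ x (r + 1)).ncard : ℝ) + (Reach G c F₀ E κ x' (r + 1)).ncard ≤
      (Reach G c F₀ E κ x r).ncard + (Reach G c F₀ E κ x' r).ncard + μ * N := by
    obtain ⟨w, hw⟩ : ∃ w, (Reach G c F₀ E κ x (r + 1)).ncard +
      (Reach G c F₀ E κ x' (r + 1)).ncard =
      (Reach G c F₀ E κ x r).ncard + (Reach G c F₀ E κ x' r).ncard + w :=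
        ⟨_, (Nat.add_sub_cancel' (by omega)).symm⟩
    rw [hw, Nat.add_sub_cancel_left] at hr
    have hw' : ((Reach G c F₀ E κ x (r + 1)).ncard : ℝ) + (Reach G c F₀ E κ x' (r + 1)).ncard =
      (Reach G c F₀ E κ x r).ncard + (Reach G c F₀ E κ x' r).ncard + w := by exact_mod_cast hw
    have hr' : (T : ℝ) * w ≤ 2 * N + 2 * N := by rw [hN]; exact_mod_cast hr
    have hT0 : (0 : ℝ) < T := by exact_mod_cast hT
    have : (w : ℝ) ≤ μ * N := by
      refine le_of_mul_le_mul_left (hr'.trans ?_) hT0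
      have := mul_le_mul_of_nonneg_right hμT hn.le
      linarith
    linarith
  have m1' : ((Reach G c F₀ E κ x r).ncard : ℝ) ≤ (Reach G c F₀ E κ x (r + 1)).ncard := by
    exact_mod_cast m1
  have m2' : ((Reach G c F₀ E κ x' r).ncard : ℝ) ≤ (Reach G c F₀ E κ x' (r + 1)).ncard := by
    exact_mod_cast m2
  obtain ⟨hS, hD⟩ := hF.le_ncard_popular hr1 hn hd hE4
  obtain ⟨hS', hD'⟩ := hF.symm.le_ncard_popular hr1 hn hd hE4
  have hpair := hF.mul_add_mul_le
  have hR1 := hF.ncard_reach_add_le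
  have hR2 := hF.symm.ncard_reach_add_le
  have hP1 : ((Popular G c F₀ E κ x (U \ E₁) r).ncard : ℝ) ≤
        (Reach G c F₀ E κ x (r + 1)).ncard := by exact_mod_cast hF.ncard_popular_le
  have hP2 : ((Popular G c F₀ E κ x' (U \ E₁) r).ncard : ℝ) ≤
        (Reach G c F₀ E κ x' (r + 1)).ncard := by exact_mod_cast hF.symm.ncard_popular_le
  have split : ∀ A B : Set V, (A.ncard : ℝ) = (A ∩ B).ncard + (A \ B).ncard := by
    intro A B
    exact_mod_cast (Set.ncard_inter_add_ncard_sdiff_eq_ncard A B (Set.toFinite _)).symm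
  have le_card : ∀ A : Set V, (A.ncard : ℝ) ≤ N := by
    intro A
    rw [hN, ← Set.ncard_univ]
    exact_mod_cast Set.ncard_le_ncard (Set.subset_univ A) (Set.toFinite _)
  set D := Popular G c F₀ E κ x (U \ E₁) r with hDdef
  set D' := Popular G c F₀ E κ x' (U \ E₁) r with hDdef'
  set Z := Heads G c F₀ E κ x r with hZdef
  set Z' := Heads G c F₀ E κ x' r with hZdef'
  have s1 := split D Z'
  have s2 := split D' Z
  have n1 := le_card D
  have n2 := le_card D'
  have hℓ : (2 * ℓ + 5 : ℝ) ≤ μ * N := by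
    have : (0 : ℝ) ≤ ℓ := Nat.cast_nonneg _
    linarith
  have hNne : N ≠ 0 := hn.ne'
  have q : ∀ a : ℝ, ∃ b, a = b * N := fun a => ⟨a / N, (div_mul_cancel₀ a hNne).symm⟩
  obtain ⟨d₀, hd₀⟩ := q (D ∩ Z').ncard
  obtain ⟨d₁, hd₁⟩ := q (D \ Z').ncard
  obtain ⟨e₀, he₀⟩ := q (D' ∩ Z).ncard
  obtain ⟨e₁, he₁⟩ := q (D' \ Z).ncard
  obtain ⟨δ, hδ⟩ := q d
  have nonneg : ∀ {b : ℝ} {A : Set V}, (A.ncard : ℝ) = b * N → 0 ≤ b := fun {b A} hb =>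
    nonneg_of_mul_nonneg_left (hb ▸ Nat.cast_nonneg _) hn
  have hNN : 0 < N * N := mul_pos hn hn
  obtain ⟨hmin, hDle, hDle'⟩ := overlap_le_or_le (d := δ) (d₀ := d₀) (d₁ := d₁) (e₀ := e₀)
    (e₁ := e₁) (μ := μ) (α := α) (ρ := ρ) (nonneg hd₀) (nonneg hd₁) (nonneg he₀) (nonneg he₁)
    (le_of_mul_le_mul_right (by linarith) hn) (le_of_mul_le_mul_right (by linarith) hn)
    (le_of_mul_le_mul_right (by linarith) hn) (le_of_mul_le_mul_right (by linarith) hn)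
    (le_of_mul_le_mul_right (by linarith) hn) (le_of_mul_le_mul_right (by linarith) hn)
    (by
      refine le_of_mul_le_mul_right ?_ hNN
      rw [hd₀, hd₁, he₀, he₁, hδ] at hpair
      have t1 : N * (2 * ℓ + 5) ≤ N * (μ * N) := mul_le_mul_of_nonneg_left hℓ hn.le
      have t2 : N * (8 * (E₁.ncard + κ : ℝ)) ≤ N * (μ * N) := mul_le_mul_of_nonneg_left hκE hn.le
      have t3 : 0 ≤ N * (E₁.ncard + κ : ℝ) := by positivity
      linarith)
    hμ hα hα₁ hμα hρ hαρ
  have hρ2 : ρ ^ 2 ≤ ρ := by rw [pow_two]; exact mul_le_of_le_one_left hρ hρ₁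
  have hα2 : α ^ 2 ≤ α := by rw [pow_two]; exact mul_le_of_le_one_left hα.le hα₁
  have hμρ : 2 * μ ≤ ρ := by linarith
  have hαρ' : 2 * α ≤ ρ := by linarith
  have up1 : (D.ncard : ℝ) ≤ d + 2 * α * N := by
    have := mul_le_mul_of_nonneg_right hDle hn.le
    linarith
  have up2 : (D'.ncard : ℝ) ≤ d + 2 * α * N := by
    have := mul_le_mul_of_nonneg_right hDle' hn.le
    linarith
  -- The side whose heads mostly avoid the popular vertices of the other side becomes the stable
  -- one.
  rcases hmin with hm | hm
  · exact ⟨x', x, E, E₁, r, hF.symm.isStable hN hn hS' hκE (by linarith) (by linarith) up2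
      (by rw [hd₀]; exact mul_le_mul_of_nonneg_right hm hn.le) hU (by linarith) hαρ' hμρ hρ⟩
  · exact ⟨x, x', E, E₁, r, hF.isStable hN hn hS hκE (by linarith) (by linarith) up1
      (by rw [he₀]; exact mul_le_mul_of_nonneg_right hm hn.le) hU (by linarith) hαρ' hμρ hρ⟩

end Stable

/-! ### Hubs and emitters -/

/-- The structure found around a stable frame. The vertices of `B` can be made ends of the
configuration, in both ways; a vertex `a ∈ A` has the neighbours `t a` and `s a`, and nearly all
edges between `B` and `a` have the colour of the edge from `a` to `t a`. -/
structure IsHubSystem {V K : Type*} (G : SimpleGraph V) (c : Sym2 V → K) (ℓ : ℕ)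
    (F₀ : SimpleGraph V) (U D B A : Set V) (t s : V → V) (d : ℕ) (m : ℝ) : Prop where
  isMax : IsMaxConfig G c ℓ F₀ U
  deg : ∀ v, d + 1 ≤ colourDegree G c v
  near_le : (2 * ℓ + 5 : ℝ) ≤ m
  D_subset : D ⊆ U
  B_subset : B ⊆ U
  A_subset : A ⊆ D
  adj_t : ∀ a ∈ A, F₀.Adj a (t a)
  adj_s : ∀ a ∈ A, F₀.Adj a (s a)
  t_ne_s : ∀ a ∈ A, t a ≠ s a
  s_notMem : ∀ a ∈ A, s a ∉ B
  U_le : (U.ncard : ℝ) ≤ 3 / 2 * d + m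
  le_U : 3 / 2 * (d : ℝ) - m ≤ U.ncard
  D_le : (D.ncard : ℝ) ≤ d + m
  le_A : (d : ℝ) - 6 * m ≤ A.ncard
  le_B : (d : ℝ) / 2 - 3 * m ≤ B.ncard
  t_notMem : ({a | a ∈ A ∧ t a ∉ B}.ncard : ℝ) ≤ 4 * m
  bad : (({p | p.1 ∈ B ∧ p.2 ∈ A ∧ ¬ (G.Adj p.1 p.2 ∧ c s(p.1, p.2) = c s(p.2, t p.2))} :
    Set (V × V)).ncard : ℝ) ≤ 3 * m * Nat.card V
  stray : (({p | p.1 ∈ B ∧ G.Adj p.1 p.2 ∧ p.2 ∉ D} : Set (V × V)).ncard : ℝ) ≤ m * Nat.card V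
  not_adj : ∀ b ∈ B, ∀ w, w ∉ U → ¬ G.Adj b w
  truncate : ∀ a ∈ A, t a ∈ B → ∀ w w', w ∉ U → w' ∉ U → G.Adj a w → c s(a, w) ≠ c s(a, s a) →
    G.Adj w w' → c s(w, w') ≠ c s(w, a) → False
  swap : ∀ a ∈ A, t a ∈ B → ∀ w w' p q, w ∉ U → w' ∉ U → w' ≠ w → G.Adj a w →
    c s(a, w) ≠ c s(a, s a) → p ∈ D → q ∈ D → F₀.Adj p q → G.Adj w p → G.Adj q w' →
    c s(w, p) ≠ c s(w, a) → (∀ u, F₀.Adj p u → u ≠ q → c s(w, p) ≠ c s(p, u)) →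
    (∀ u, F₀.Adj q u → u ≠ p → c s(q, w') ≠ c s(q, u)) → ¬ Near F₀ (ℓ + 2) a p →
    ¬ Near F₀ (ℓ + 2) a q → False

/-- The vertices all of whose edges of `F₀` are robustly reachable towards them. -/
def Hubs {V K : Type*} (G : SimpleGraph V) (c : Sym2 V → K) (F₀ : SimpleGraph V) (E : Set V)
    (κ : ℕ) (x : V) (r : ℕ) : Set V :=
  {z | z ∈ Heads G c F₀ E κ x r ∧ ∀ y, F₀.Adj y z → (y, z) ∈ Reach G c F₀ E κ x r}

section Hubs

variable {V K : Type*} [Fintype V] {G : SimpleGraph V} {c : Sym2 V → K} {ℓ : ℕ}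
  {F₀ : SimpleGraph V} {U E E₁ : Set V} {κ r d : ℕ} {x x' : V} {m : ℝ}

local notation "ℛ" => Reach G c F₀ E κ x r
local notation "𝒟" => Popular G c F₀ E κ x (U \ E₁) r
local notation "𝒵" => Heads G c F₀ E κ x r
local notation "ℬ" => Hubs G c F₀ E κ x r

/-- A head that is not a hub misses one of its at most two incoming arrows. -/
theorem IsFrame.ncard_reach_notMem_hubs_le (h : IsFrame G c ℓ F₀ U x x' E E₁ κ r d) :
    (({a | a ∈ ℛ ∧ a.2 ∉ ℬ} : Set (V × V)).ncard : ℝ) ≤ (𝒵 \ ℬ).ncard * 1 := by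
  refine ncard_le_mul_of_snd (fun a ha => ⟨⟨a.1, ha.1⟩, ha.2⟩) fun z hz => ?_
  obtain ⟨y₀, hy₀, hn⟩ : ∃ y, F₀.Adj y z ∧ (y, z) ∉ ℛ := by
    by_contra! hcon
    exact hz.2 ⟨hz.1, hcon⟩
  have : {y | (y, z) ∈ {a | a ∈ ℛ ∧ a.2 ∉ ℬ}}.ncard ≤ 1 := by
    refine (Set.ncard_le_one_iff (Set.toFinite _)).2 fun {p q} hp hq => ?_
    have hp := hp.1
    have hq := hq.1
    rcases h.base.isMax.conf.deg z p q y₀ (Reach.adj h.pos hp).symm (Reach.adj h.pos hq).symm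
      hy₀.symm with e | e | e
    · exact e
    · exact absurd (e ▸ hp) hn
    · exact absurd (e ▸ hq) hn
  exact_mod_cast this

theorem IsFrame.ncard_reach_le_heads_add (h : IsFrame G c ℓ F₀ U x x' E E₁ κ r d) :
    (Set.ncard ℛ : ℝ) ≤ Set.ncard 𝒵 + Set.ncard ℬ := by
  have h1 := h.ncard_reach_notMem_hubs_le
  have h2 : (({a | a ∈ ℛ ∧ a.2 ∈ ℬ} : Set (V × V)).ncard : ℝ) ≤ Set.ncard ℬ * 2 := by
    refine ncard_le_mul_of_snd (fun a ha => ha.2) fun z hz => ?_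
    have := ncard_tails_le h.base.isMax.conf.deg z (S := {a | a ∈ ℛ ∧ a.2 ∈ ℬ})
      fun a ha => Reach.adj h.pos ha.1
    exact_mod_cast this
  have h3 : Set.ncard ℛ ≤ ({a | a ∈ ℛ ∧ a.2 ∈ ℬ} : Set (V × V)).ncard +
      ({a | a ∈ ℛ ∧ a.2 ∉ ℬ} : Set (V × V)).ncard := by
    refine le_trans (Set.ncard_le_ncard ?_ (Set.toFinite _)) (Set.ncard_union_le _ _)
    intro a ha
    by_cases hm : a.2 ∈ ℬ
    · exact Or.inl ⟨ha, hm⟩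
    · exact Or.inr ⟨ha, hm⟩
  have h3' : (Set.ncard ℛ : ℝ) ≤ ({a | a ∈ ℛ ∧ a.2 ∈ ℬ} : Set (V × V)).ncard +
      ({a | a ∈ ℛ ∧ a.2 ∉ ℬ} : Set (V × V)).ncard := by exact_mod_cast h3
  have h4 : ((𝒵 \ ℬ).ncard : ℝ) + Set.ncard ℬ = Set.ncard 𝒵 := by
    exact_mod_cast Set.ncard_sdiff_add_ncard_of_subset
        (show ℬ ⊆ 𝒵 from fun _ hb => hb.1) (Set.toFinite _)
  linarith

theorem IsFrame.exists_other_nbr (h : IsFrame G c ℓ F₀ U x x' E E₁ κ r d) {b : V} (hb : b ∈ ℬ)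
    (a : V) : ∃ a₂, a₂ ≠ a ∧ F₀.Adj b a₂ ∧ (a₂, b) ∈ ℛ := by
  obtain ⟨y, hy⟩ := hb.1
  have hbE := (Reach.notMem hy).2
  obtain ⟨p, q, hpq, hp, hq⟩ := h.base.two b (h.heads_subset hb.1)
    (fun e => hbE (h.near _ (Or.inl (e ▸ Near.refl _ _ _))))
    (fun e => hbE (h.near _ (Or.inr (e ▸ Near.refl _ _ _))))
  by_cases hpa : p = a
  · exact ⟨q, fun e => hpq (hpa.trans e.symm), hq, hb.2 _ hq.symm⟩
  · exact ⟨p, hpa, hp, hb.2 _ hp.symm⟩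

/-- A vertex adjacent to a hub is available to one of the arrows into the hub. -/
theorem IsFrame.exists_free_of_hub (h : IsFrame G c ℓ F₀ U x x' E E₁ κ r d) {b u : V} (hb : b ∈ ℬ)
    (hu : G.Adj b u) : ∃ y, (y, b) ∈ ℛ ∧ Free G c F₀ (y, b) u := by
  obtain ⟨y, hy⟩ := hb.1
  have hyb := (Reach.adj h.pos hy).symm
  obtain ⟨z, hzy, hz, hzR⟩ := h.exists_other_nbr hb y
  have hd := h.base.isMax.conf.deg
  have hcol := h.base.isMax.conf.proper b z y hz hyb hzy
  by_cases hc : c s(b, u) = c s(b, z)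
  · refine ⟨z, hzR, hu, fun k hk hkz => ?_⟩
    dsimp only at hk hkz ⊢
    rcases hd b k z y hk hz hyb with e | e | e
    · exact absurd e hkz
    · rw [e, hc]; exact hcol
    · exact absurd e hzy
  · refine ⟨y, hy, hu, fun k hk hky => ?_⟩
    dsimp only at hk hky ⊢
    rcases hd b k z y hk hz hyb with e | e | e
    · rw [e]; exact hc
    · exact absurd e hky
    · exact absurd e hzy

theorem IsFrame.not_adj_of_hub (h : IsFrame G c ℓ F₀ U x x' E E₁ κ r d) {b w : V} (hb : b ∈ ℬ)
    (hw : w ∉ U) : ¬ G.Adj b w := by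
  intro hG
  obtain ⟨y, hy, hf⟩ := h.exists_free_of_hub hb hG
  exact h.not_free hy hw hf

theorem IsFrame.ncard_hub_stray_le (h : IsFrame G c ℓ F₀ U x x' E E₁ κ r d) :
    ({p | p.1 ∈ ℬ ∧ G.Adj p.1 p.2 ∧ p.2 ∉ 𝒟} : Set (V × V)).ncard ≤
      (Stray G c F₀ E κ x (U \ E₁) r).ncard := by
  refine le_trans (Set.ncard_le_ncard ?_ (Set.toFinite _)) (Set.ncard_image_le
    (f := fun q : (V × V) × V => (q.1.2, q.2)) (Set.toFinite (Stray G c F₀ E κ x (U \ E₁) r)))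
  rintro ⟨b, u⟩ ⟨hb, hu, hn⟩
  obtain ⟨y, hy, hf⟩ := h.exists_free_of_hub hb hu
  exact ⟨((y, b), u), ⟨hy, hf, hn⟩, rfl⟩

/-- The popular vertices with exactly one arrow, the opposite arrow not being reachable even in one
further round. -/
def Emitters {V K : Type*} (G : SimpleGraph V) (c : Sym2 V → K) (F₀ : SimpleGraph V) (E : Set V)
    (κ : ℕ) (x : V) (W : Set V) (r : ℕ) : Set V :=
  {y | y ∈ Popular G c F₀ E κ x W r ∧ (∃ z, (y, z) ∈ Reach G c F₀ E κ x r) ∧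
    ∃ z, F₀.Adj y z ∧ (y, z) ∉ Reach G c F₀ E κ x (r + 1)}

local notation "𝒜" => Emitters G c F₀ E κ x (U \ E₁) r

/-- A popular vertex that is not an emitter is in `D₁`, sending its first arrow in the extra round,
or in `D₂`, sending two arrows by then. The slow growth bounds `|D₁|` by `m`. The vertices of `D₂`
push the number of arrows to at least `|𝒟| + |D₂|`, whereas at most `2|𝒵| + m` arrows exist, so
`|D₂| ≤ 4m`. -/
theorem IsStable.le_ncard_emitters (h : IsStable G c ℓ F₀ U x x' E E₁ κ r d m) :
    (d : ℝ) - 6 * m ≤ Set.ncard 𝒜 := by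
  have hf := h.frame
  have hd := hf.base.isMax.conf.deg
  set S := Reach G c F₀ E κ x (r + 1) with hS
  have hsubS : ℛ ⊆ S := Reach.subset_succ r
  set D₁ : Set V := {y | y ∈ 𝒟 ∧ ∀ z, (y, z) ∉ ℛ} with hD₁
  set D₂ : Set V := {y | y ∈ 𝒟 ∧ ∀ z, F₀.Adj y z → (y, z) ∈ S} with hD₂
  have h1 : D₁.ncard + Set.ncard ℛ ≤ S.ncard := by
    have e1 : D₁.ncard ≤ (S \ ℛ).ncard := by
      refine le_trans (Set.ncard_le_ncard ?_ (Set.toFinite _))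
        (Set.ncard_image_le (f := Prod.fst) (Set.toFinite (S \ ℛ)))
      rintro y ⟨hy, hn⟩
      obtain ⟨z, hz⟩ := hf.exists_arrow hy
      exact ⟨(y, z), ⟨hz, hn z⟩, rfl⟩
    have e2 := Set.ncard_sdiff_add_ncard_of_subset hsubS (Set.toFinite _)
    omega
  have h2 : (Set.ncard (𝒟 \ D₂) : ℝ) * 1 ≤ ({a | a ∈ S ∧ a.1 ∉ D₂} : Set (V × V)).ncard := by
    refine mul_le_ncard_of_fst fun y hy => ?_
    obtain ⟨z, hz⟩ := hf.exists_arrow hy.1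
    have : 1 ≤ {z | (y, z) ∈ {a | a ∈ S ∧ a.1 ∉ D₂}}.ncard :=
      Nat.one_le_iff_ne_zero.2 (Set.ncard_ne_zero_of_mem (a := z) ⟨hz, hy.2⟩ (Set.toFinite _))
    exact_mod_cast this
  have h3 : (D₂.ncard : ℝ) * 2 ≤ ({a | a ∈ S ∧ a.1 ∈ D₂} : Set (V × V)).ncard := by
    refine mul_le_ncard_of_fst fun y hy => ?_
    obtain ⟨p, q, hpq, hp, hq, -⟩ := hf.exists_nbrs hy.1.1
    have : 2 ≤ {z | (y, z) ∈ {a | a ∈ S ∧ a.1 ∈ D₂}}.ncard := by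
      rw [← Set.ncard_pair hpq]
      refine Set.ncard_le_ncard ?_ (Set.toFinite _)
      rintro k (rfl | rfl)
      · exact ⟨hy.2 _ hp, hy⟩
      · exact ⟨hy.2 _ hq, hy⟩
    exact_mod_cast this
  have h4 : ({a | a ∈ S ∧ a.1 ∈ D₂} : Set (V × V)).ncard +
      ({a | a ∈ S ∧ a.1 ∉ D₂} : Set (V × V)).ncard = S.ncard := by
    exact Set.ncard_inter_add_ncard_sdiff_eq_ncard S {a | a.1 ∈ D₂} (Set.toFinite _)
  have h5 : (𝒟 \ D₂).ncard + D₂.ncard = Set.ncard 𝒟 :=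
    Set.ncard_sdiff_add_ncard_of_subset (fun y hy => hy.1) (Set.toFinite _)
  have h6 : 𝒟 ⊆ (𝒜 ∪ D₁) ∪ D₂ := by
    intro y hy
    by_cases e1 : y ∈ D₁
    · exact Or.inl (Or.inr e1)
    by_cases e2 : y ∈ D₂
    · exact Or.inr e2
    refine Or.inl (Or.inl ⟨hy, ?_, ?_⟩)
    · by_contra! hcon
      exact e1 ⟨hy, hcon⟩
    · by_contra! hcon
      exact e2 ⟨hy, hcon⟩
  have h7 := Set.ncard_le_ncard h6 (Set.toFinite _)
  have h8 := Set.ncard_union_le (𝒜 ∪ D₁) D₂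
  have h9 := Set.ncard_union_le 𝒜 D₁
  have g1 : (D₁.ncard : ℝ) + Set.ncard ℛ ≤ S.ncard := by exact_mod_cast h1
  have g4 : (({a | a ∈ S ∧ a.1 ∈ D₂} : Set (V × V)).ncard : ℝ) +
      ({a | a ∈ S ∧ a.1 ∉ D₂} : Set (V × V)).ncard = S.ncard := by exact_mod_cast h4
  have g5 : ((𝒟 \ D₂).ncard : ℝ) + D₂.ncard = Set.ncard 𝒟 := by exact_mod_cast h5
  have g6 : (Set.ncard 𝒟 : ℝ) ≤ Set.ncard 𝒜 + D₁.ncard + D₂.ncard := by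
    exact_mod_cast h7.trans (by omega)
  have g7 := h.grow
  have g8 := hf.ncard_reach_le_heads_add
  have g9 : (Set.ncard ℬ : ℝ) ≤ Set.ncard 𝒵 := by
    exact_mod_cast Set.ncard_le_ncard (show ℬ ⊆ 𝒵 from fun _ hb => hb.1) (Set.toFinite _)
  have g10 := h.heads_le
  have g11 := h.le_popular
  linarith

/-- At least about `d` arrows end in at most about `d/2` heads, and only hubs receive two. -/
theorem IsStable.le_ncard_hubs (h : IsStable G c ℓ F₀ U x x' E E₁ κ r d m) :
    (d : ℝ) / 2 - 3 * m ≤ Set.ncard ℬ := by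
  have g1 := h.frame.ncard_reach_le_heads_add
  have g2 : (Set.ncard 𝒟 : ℝ) ≤ (Reach G c F₀ E κ x (r + 1)).ncard := by
    exact_mod_cast h.frame.ncard_popular_le
  have g3 := h.grow
  have g4 := h.heads_le
  have g5 := h.le_popular
  linarith

/-- Nearly all pairs of a hub and an emitter are joined by an edge of the colour of the arrow at the
emitter. -/
theorem IsStable.ncard_bad_le (h : IsStable G c ℓ F₀ U x x' E E₁ κ r d m) {t s : V → V}
    (ht : ∀ a ∈ 𝒜, F₀.Adj a (t a)) (hs : ∀ a ∈ 𝒜, F₀.Adj a (s a)) (hts : ∀ a ∈ 𝒜, t a ≠ s a)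
    (hsR : ∀ a ∈ 𝒜, (a, s a) ∉ Reach G c F₀ E κ x (r + 1)) :
    (({p | p.1 ∈ ℬ ∧ p.2 ∈ 𝒜 ∧ ¬ (G.Adj p.1 p.2 ∧ c s(p.1, p.2) = c s(p.2, t p.2))} :
      Set (V × V)).ncard : ℝ) ≤ 3 * m * Nat.card V := by
  have hf := h.frame
  have hd := hf.base.isMax.conf.deg
  have hm : 0 ≤ m := κ.cast_nonneg.trans h.threshold_le
  have le_card : ∀ A : Set V, (A.ncard : ℝ) ≤ Nat.card V := by
    intro A
    rw [← Set.ncard_univ]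
    exact_mod_cast Set.ncard_le_ncard (Set.subset_univ A) (Set.toFinite _)
  have hg : ∀ v, ∃ y, v ∈ ℬ → (y, v) ∈ ℛ := by
    intro v
    by_cases hv : v ∈ ℬ
    · obtain ⟨y, hy⟩ := hv.1; exact ⟨y, fun _ => hy⟩
    · exact ⟨v, fun h => absurd h hv⟩
  choose g hg using hg
  set P₁ : Set (V × V) := {p | p.1 ∈ ℬ ∧ p.2 ∈ 𝒟 ∧ ¬ Free G c F₀ (g p.1, p.1) p.2} with hP₁
  set P₂ : Set (V × V) := {p | p.1 ∈ ℬ ∧ p.2 ∈ 𝒜 ∧ Free G c F₀ (g p.1, p.1) p.2 ∧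
    c s(p.1, p.2) ≠ c s(p.2, t p.2)} with hP₂
  set Q : Set (V × V) := {p | p.1 ∈ ℬ ∧ Free G c F₀ (g p.1, p.1) p.2} with hQ
  have hsub : {p : V × V | p.1 ∈ ℬ ∧ p.2 ∈ 𝒜 ∧
      ¬ (G.Adj p.1 p.2 ∧ c s(p.1, p.2) = c s(p.2, t p.2))} ⊆ P₁ ∪ P₂ := by
    rintro ⟨v, a⟩ ⟨hv, ha, hn⟩
    by_cases hfr : Free G c F₀ (g v, v) a
    · exact Or.inr ⟨hv, ha, hfr, fun e => hn ⟨hfr.1, e⟩⟩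
    · exact Or.inl ⟨hv, ha.1, hfr⟩
  have h1 := (Set.ncard_le_ncard hsub (Set.toFinite _)).trans (Set.ncard_union_le _ _)
  -- A hub that is free to `a` in a colour other than that of `a (t a)` steps to the arrow `(a, s
  -- a)`, which keeps the edge `a (t a)`. Fewer than `κ` arrows can do so, because this arrow is not
  -- reachable in the next round.
  have h2 : (P₂.ncard : ℝ) ≤ Set.ncard 𝒜 * m := by
    refine ncard_le_mul_of_snd (fun p hp => hp.2.1) fun a ha => ?_
    have hn := hsR a ha
    have haE : a ∉ E := fun hE => ha.1.1.2 (hf.subset hE)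
    have hsE : s a ∉ E := fun hE => ha.1.1.2 (hf.adj_mem _ _ (hs a ha) hE)
    have h3 : ¬ κ ≤ {a₀ | a₀ ∈ ℛ ∧ Step G c F₀ a₀ (a, s a)}.ncard := fun hle =>
      hn ⟨haE, hsE, Or.inr hle⟩
    have h4 : {v | (v, a) ∈ P₂}.ncard ≤ {a₀ | a₀ ∈ ℛ ∧ Step G c F₀ a₀ (a, s a)}.ncard := by
      refine Set.ncard_le_ncard_of_injOn (fun v => (g v, v)) ?_
        (fun v _ w _ e => congrArg Prod.snd e) (Set.toFinite _)
      rintro v ⟨hv, -, hfr, hne⟩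
      refine ⟨hg v hv, hs a ha, hfr, fun k hk hks => ?_⟩
      rcases hd a k (t a) (s a) hk (ht a ha) (hs a ha) with e | e | e
      · rw [e]; exact hne
      · exact absurd e hks
      · exact absurd e (hts a ha)
    refine le_trans ?_ h.threshold_le
    have : {v | (v, a) ∈ P₂}.ncard ≤ κ := by omega
    exact_mod_cast this
  -- A hub is free to at least `d` vertices, mostly in `𝒟`, and `|𝒟| ≤ d + m`; so on average few
  -- vertices of `𝒟` are not free for it.
  have h5 : (Set.ncard ℬ : ℝ) * d ≤ Q.ncard := by
    refine mul_le_ncard_of_fst fun v hv => ?_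
    have e1 : {u | (v, u) ∈ Q} = {u | Free G c F₀ (g v, v) u} := by
      ext u; exact ⟨fun hu => hu.2, fun hu => ⟨hv, hu⟩⟩
    rw [e1]
    exact_mod_cast hf.le_ncard_free (hg v hv)
  have h6 : Q.ncard + P₁.ncard ≤ Set.ncard ℬ * Set.ncard 𝒟 +
      (Stray G c F₀ E κ x (U \ E₁) r).ncard := by
    have e1 : (Q ∩ {p | p.2 ∈ 𝒟}) ∪ P₁ ⊆ ℬ ×ˢ 𝒟 := by
      rintro ⟨v, u⟩ (⟨⟨hv, -⟩, hu⟩ | ⟨hv, hu, -⟩)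
      · exact ⟨hv, hu⟩
      · exact ⟨hv, hu⟩
    have e2 := Set.ncard_le_ncard e1 (Set.toFinite _)
    rw [Set.ncard_union_eq (by
      rw [Set.disjoint_left]
      rintro ⟨v, u⟩ ⟨⟨-, h7⟩, -⟩ ⟨-, -, h8⟩
      exact h8 h7) (Set.toFinite _) (Set.toFinite _), Set.ncard_prod] at e2
    have e3 : (Q \ {p | p.2 ∈ 𝒟}).ncard ≤ (Stray G c F₀ E κ x (U \ E₁) r).ncard := by
      refine Set.ncard_le_ncard_of_injOn (fun p => ((g p.1, p.1), p.2)) ?_ ?_ (Set.toFinite _)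
      · rintro ⟨v, u⟩ ⟨⟨hv, hfr⟩, hu⟩
        exact ⟨hg v hv, hfr, hu⟩
      · rintro ⟨v, u⟩ _ ⟨v', u'⟩ _ e
        simp only [Prod.mk.injEq] at e
        exact Prod.ext e.1.2 e.2
    have e4 := Set.ncard_inter_add_ncard_sdiff_eq_ncard Q {p | p.2 ∈ 𝒟} (Set.toFinite _)
    omega
  have h6' : (Q.ncard : ℝ) + P₁.ncard ≤ Set.ncard ℬ * Set.ncard 𝒟 +
      (Stray G c F₀ E κ x (U \ E₁) r).ncard := by exact_mod_cast h6
  have h7 := mul_le_mul_of_nonneg_left h.popular_le (Nat.cast_nonneg (α := ℝ) (Set.ncard ℬ))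
  have h8 := h.stray
  have h9 := mul_le_mul_of_nonneg_right (le_card ℬ) hm
  have h10 := mul_le_mul_of_nonneg_right (le_card 𝒜) hm
  have h1' : (({p | p.1 ∈ ℬ ∧ p.2 ∈ 𝒜 ∧
      ¬ (G.Adj p.1 p.2 ∧ c s(p.1, p.2) = c s(p.2, t p.2))} : Set (V × V)).ncard : ℝ) ≤
      P₁.ncard + P₂.ncard := by exact_mod_cast h1
  linarith

theorem IsStable.exists_isHubSystem (h : IsStable G c ℓ F₀ U x x' E E₁ κ r d m) :
    ∃ D B A t s, IsHubSystem G c ℓ F₀ U D B A t s d m := by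
  have hf := h.frame
  have hd := hf.base.isMax.conf.deg
  have hm : 0 ≤ m := κ.cast_nonneg.trans h.threshold_le
  have hts : ∀ a, ∃ p q, a ∈ 𝒜 → (a, p) ∈ ℛ ∧ F₀.Adj a q ∧
      (a, q) ∉ Reach G c F₀ E κ x (r + 1) := by
    intro a
    by_cases ha : a ∈ 𝒜
    · obtain ⟨-, ⟨p, hp⟩, q, hq, hn⟩ := ha
      exact ⟨p, q, fun _ => ⟨hp, hq, hn⟩⟩
    · exact ⟨a, a, fun h => absurd h ha⟩
  choose t s hts using hts
  have ht : ∀ a ∈ 𝒜, F₀.Adj a (t a) := fun a ha => Reach.adj hf.pos (hts a ha).1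
  have hs : ∀ a ∈ 𝒜, F₀.Adj a (s a) := fun a ha => (hts a ha).2.1
  have hne : ∀ a ∈ 𝒜, t a ≠ s a := fun a ha e =>
    (hts a ha).2.2 (e ▸ Reach.subset_succ r (hts a ha).1)
  have hsB : ∀ a ∈ 𝒜, s a ∉ ℬ := fun a ha hB =>
    (hts a ha).2.2 (Reach.subset_succ r (hB.2 a (hs a ha)))
  have other : ∀ a ∈ 𝒜, ∀ u, F₀.Adj a u → u ≠ t a → u = s a := by
    intro a ha u hu hne'
    rcases hd a u (t a) (s a) hu (ht a ha) (hs a ha) with e | e | e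
    · exact absurd e hne'
    · exact e
    · exact absurd e (hne a ha)
  have hnotE : ∀ u ∈ 𝒟, u ∉ E := fun u hu hE => hu.1.2 (hf.subset hE)
  refine ⟨𝒟, ℬ, 𝒜, t, s, hf.base.isMax, hf.deg, ?_, IsFrame.popular_subset,
    fun b hb => hf.heads_subset hb.1, fun a ha => ha.1, ht, hs, hne, hsB, h.card_le,
    h.le_card, h.popular_le, h.le_ncard_emitters, h.le_ncard_hubs, ?_,
    h.ncard_bad_le ht hs hne fun a ha => (hts a ha).2.2, ?_,
    fun b hb w hw => hf.not_adj_of_hub hb hw, ?_, ?_⟩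
  · refine le_trans ?_ h.threshold_le
    exact_mod_cast hf.two_mul_lt.le
  · have h1 : {a | a ∈ 𝒜 ∧ t a ∉ ℬ}.ncard ≤ ({a | a ∈ ℛ ∧ a.2 ∉ ℬ} : Set (V × V)).ncard :=
      Set.ncard_le_ncard_of_injOn (fun a => (a, t a)) (fun a ha => ⟨(hts a ha.1).1, ha.2⟩)
        (fun a _ b _ e => congrArg Prod.fst e) (Set.toFinite _)
    have h1' : ({a | a ∈ 𝒜 ∧ t a ∉ ℬ}.ncard : ℝ) ≤
      ({a | a ∈ ℛ ∧ a.2 ∉ ℬ} : Set (V × V)).ncard := by exact_mod_cast h1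
    have h2 := hf.ncard_reach_notMem_hubs_le
    have h4 : ((𝒵 \ ℬ).ncard : ℝ) + Set.ncard ℬ = Set.ncard 𝒵 := by
      exact_mod_cast Set.ncard_sdiff_add_ncard_of_subset
        (show ℬ ⊆ 𝒵 from fun _ hb => hb.1) (Set.toFinite _)
    have h5 := h.le_ncard_hubs
    have h6 := h.heads_le
    linarith
  · refine le_trans ?_ h.stray
    exact_mod_cast hf.ncard_hub_stray_le
  · intro a ha htB w w' hw hw' haw hc hww' hc'
    -- The arrow into the hub `t a` from its other neighbour `a₂` makes `t a` an end that keeps its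
    -- edge to `a`.
    obtain ⟨a₂, ha₂, -, hR⟩ := hf.exists_other_nbr htB a
    refine hf.base.false_of_truncate hf.near hR (ht a ha).symm ha₂.symm hw haw ?_ hw' hww' hc'
      (hf.large_of_le (by omega))
    intro u hu hut
    rw [other a ha u hu hut]; exact hc
  · intro a ha htB w w' p q hw hw' hww' haw hc hp hq hpq hwp hqw' hcol₁ hcolp hcolq hnp hnq
    obtain ⟨a₂, ha₂, hb, hR⟩ := hf.exists_other_nbr htB a
    refine hf.base.false_of_swap_rotate hf.near hR (ht a ha).symm ha₂.symm hw haw ?_ hw' hww' hpq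
      hwp hqw' hcol₁ hcolp hcolq ?_ (hf.large_of_le (by omega))
    · intro u hu hut
      rw [other a ha u hu hut]; exact hc
    -- The vertex `a₂` is two steps from `a`, whence the radius `ℓ + 2`.
    · have key : ∀ u ∈ 𝒟, ¬ Near F₀ (ℓ + 2) a u →
          ∀ t' ∈ ({x, x', a₂, t a} : Set V), ¬ Near F₀ ℓ t' u := by
        rintro u hu hn t' (rfl | rfl | rfl | rfl) hnear
        · exact hnotE u hu (hf.near _ (Or.inl hnear))
        · exact hnotE u hu (hf.near _ (Or.inr hnear))
        · exact hn ((((Near.of_adj (ht a ha)).trans (Near.of_adj hb)).trans hnear).mono (by omega))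
        · exact hn (((Near.of_adj (ht a ha)).trans hnear).mono (by omega))
      exact fun t' ht' => ⟨key p hp hnp t' ht', key q hq hnq t' ht'⟩

end Hubs

/-! ### Cleaning up: tame emitters matched in pairs -/

/-- The edge `ba` is present and has the same colour as the edge from `a` to `t a`. -/
def Matches {V K : Type*} (G : SimpleGraph V) (c : Sym2 V → K) (t : V → V) (b a : V) : Prop :=
  G.Adj b a ∧ c s(b, a) = c s(a, t a)

/-- A set `C` of vertices matched in pairs by `s`, almost all of whose edges to `B` have the colour
of the edge from `a` to `t a`. -/
structure IsCore {V K : Type*} (G : SimpleGraph V) (c : Sym2 V → K) (ℓ : ℕ) (F₀ : SimpleGraph V)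
    (U B C : Set V) (t s : V → V) (d : ℕ) (T : ℝ) : Prop where
  isMax : IsMaxConfig G c ℓ F₀ U
  deg : ∀ v, d + 1 ≤ colourDegree G c v
  near_le : (2 * ℓ + 5 : ℝ) ≤ T
  C_subset : C ⊆ U
  adj_t : ∀ a ∈ C, F₀.Adj a (t a)
  adj_s : ∀ a ∈ C, F₀.Adj a (s a)
  t_ne_s : ∀ a ∈ C, t a ≠ s a
  s_mem : ∀ a ∈ C, s a ∈ C
  s_s : ∀ a ∈ C, s (s a) = a
  tame : ∀ a ∈ C, ({b | b ∈ B ∧ ¬ Matches G c t b a}.ncard : ℝ) ≤ T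
  le_C : (d : ℝ) - 10 * T ≤ C.ncard
  C_le : (C.ncard : ℝ) ≤ d + T
  rest_le : (((U \ B) \ C).ncard : ℝ) ≤ 11 * T
  le_U : 3 / 2 * (d : ℝ) - T ≤ U.ncard
  dense : (Nat.card V : ℝ) + 40 * T ≤ 2 * d
  large : 50 * T ≤ d
  not_adj : ∀ b ∈ B, ∀ w, w ∉ U → ¬ G.Adj b w
  truncate : ∀ a ∈ C, ∀ w w', w ∉ U → w' ∉ U → G.Adj a w → c s(a, w) ≠ c s(a, s a) →
    G.Adj w w' → c s(w, w') ≠ c s(w, a) → False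
  swap : ∀ a ∈ C, ∀ w w' p q, w ∉ U → w' ∉ U → w' ≠ w → G.Adj a w →
    c s(a, w) ≠ c s(a, s a) → p ∈ C → q ∈ C → F₀.Adj p q → G.Adj w p → G.Adj q w' →
    c s(w, p) ≠ c s(w, a) → (∀ u, F₀.Adj p u → u ≠ q → c s(w, p) ≠ c s(p, u)) →
    (∀ u, F₀.Adj q u → u ≠ p → c s(q, w') ≠ c s(q, u)) → ¬ Near F₀ (ℓ + 2) a p →
    ¬ Near F₀ (ℓ + 2) a q → False

section Tame

variable {V K : Type*} [Fintype V] {G : SimpleGraph V} {c : Sym2 V → K} {ℓ : ℕ}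
  {F₀ : SimpleGraph V} {U D B A : Set V} {t s : V → V} {d : ℕ} {m T : ℝ}

/-- The vertices of `A` matched with all but at most `T` vertices of `B`. -/
def Tame {V K : Type*} (G : SimpleGraph V) (c : Sym2 V → K) (t : V → V) (A B : Set V) (T : ℝ) :
    Set V :=
  {a | a ∈ A ∧ ({b | b ∈ B ∧ ¬ Matches G c t b a}.ncard : ℝ) ≤ T}

theorem ncard_le_card (A : Set V) : (A.ncard : ℝ) ≤ Nat.card V := by
  rw [← Set.ncard_univ]
  exact_mod_cast Set.ncard_le_ncard (Set.subset_univ A) (Set.toFinite _)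

/-- Markov's inequality: each vertex removed accounts for more than `T` of the at most `T * T` bad
pairs. -/
theorem ncard_sdiff_tame_le {q : ℝ} (hT : 0 < T) (hq : q ≤ T * T)
    (h : (({p | p.1 ∈ B ∧ p.2 ∈ A ∧ ¬ Matches G c t p.1 p.2} : Set (V × V)).ncard : ℝ) ≤ q) :
    ((A \ Tame G c t A B T).ncard : ℝ) ≤ T := by
  refine le_of_mul_le_mul_right ?_ hT
  refine le_trans ?_ (h.trans hq)
  refine mul_le_ncard_of_snd fun a ha => ?_
  have h1 : T < {b | b ∈ B ∧ ¬ Matches G c t b a}.ncard := by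
    by_contra! hle
    exact ha.2 ⟨ha.1, hle⟩
  have h2 : {b | b ∈ B ∧ ¬ Matches G c t b a} =
      {b | (b, a) ∈ ({p | p.1 ∈ B ∧ p.2 ∈ A ∧ ¬ Matches G c t p.1 p.2} : Set (V × V))} := by
    ext b; exact ⟨fun hb => ⟨hb.1, ha.1, hb.2⟩, fun hb => ⟨hb.1, hb.2.2⟩⟩
  rw [← h2]
  exact h1.le

/-- If `a₁` and `a₂` had the same colour, choose `v` in `B` matched with both and another `v'` in
`B` matched with `a₁`. The edge `va₁` then has the colour of `va₂` at one end and of `v'a₁` at the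
other, against criticality. -/
theorem injOn_tame (hG : IsCritical G c) (hB : 2 * T + 1 < B.ncard) :
    Set.InjOn (fun a => c s(a, t a)) (Tame G c t A B T) := by
  intro a₁ h₁ a₂ h₂ he
  dsimp only at he
  by_contra hne
  have key : ∀ X : Set V, (X.ncard : ℝ) < B.ncard → ∃ b ∈ B, b ∉ X := by
    intro X hX
    by_contra! hcon
    have : B.ncard ≤ X.ncard := Set.ncard_le_ncard hcon (Set.toFinite _)
    exact absurd hX (not_lt.2 (by exact_mod_cast this))
  have e1 := h₁.2
  have e2 := h₂.2
  have hT : 0 ≤ T := (Nat.cast_nonneg _).trans e1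
  obtain ⟨v, hv, hvn⟩ := key ({b | b ∈ B ∧ ¬ Matches G c t b a₁} ∪
    {b | b ∈ B ∧ ¬ Matches G c t b a₂}) (by
      have : (({b | b ∈ B ∧ ¬ Matches G c t b a₁} ∪
        {b | b ∈ B ∧ ¬ Matches G c t b a₂}).ncard : ℝ) ≤ {b | b ∈ B ∧ ¬ Matches G c t b a₁}.ncard +
        {b | b ∈ B ∧ ¬ Matches G c t b a₂}.ncard := by exact_mod_cast Set.ncard_union_le _ _
      linarith)
  obtain ⟨v', hv', hvn'⟩ := key ({b | b ∈ B ∧ ¬ Matches G c t b a₁} ∪ {v}) (by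
      have : (({b | b ∈ B ∧ ¬ Matches G c t b a₁} ∪ {v}).ncard : ℝ) ≤
        {b | b ∈ B ∧ ¬ Matches G c t b a₁}.ncard + ({v} : Set V).ncard := by
          exact_mod_cast Set.ncard_union_le _ _
      rw [Set.ncard_singleton] at this
      push_cast at this
      linarith)
  simp only [Set.mem_union, Set.mem_ofPred_eq, not_or, not_and, not_not,
    Set.mem_singleton_iff] at hvn hvn'
  have m1 := hvn.1 hv
  have m2 := hvn.2 hv
  have m3 := hvn'.1 hv'
  refine hG.false_of_repeated (u := v) (v := a₁) m1.1 m2.1 m3.1.symm (Ne.symm hne) hvn'.2 ?_ ?_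
  · rw [m1.2, m2.2, he]
  · rw [Sym2.eq_swap, m3.2, m1.2]

/-- Inside the intersection a pair cannot match in both directions, since the two colours would
coincide. So at most half of the ordered pairs match, while tameness leaves at most `T` non-matching
partners per vertex. -/
theorem ncard_tame_inter_le (hT : 0 ≤ T)
    (hinj : Set.InjOn (fun a => c s(a, t a)) (Tame G c t A B T)) :
    ((Tame G c t A B T ∩ B).ncard : ℝ) ≤ 2 * T := by
  set S := Tame G c t A B T ∩ B with hS
  set P : Set (V × V) := {p | p ∈ S ×ˢ S ∧ Matches G c t p.1 p.2} with hP
  set Q : Set (V × V) := {p | p ∈ S ×ˢ S ∧ ¬ Matches G c t p.1 p.2} with hQ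
  have h1 : (Q.ncard : ℝ) ≤ S.ncard * T := by
    refine ncard_le_mul_of_snd (fun p hp => hp.1.2) fun a ha => ?_
    refine le_trans ?_ ha.1.2
    have : {b | (b, a) ∈ Q}.ncard ≤ {b | b ∈ B ∧ ¬ Matches G c t b a}.ncard :=
      Set.ncard_le_ncard (fun b hb => ⟨hb.1.1.2, hb.2⟩) (Set.toFinite _)
    exact_mod_cast this
  have h2 : P.ncard + Q.ncard = S.ncard * S.ncard := by
    rw [← Set.ncard_prod]
    exact Set.ncard_inter_add_ncard_sdiff_eq_ncard (S ×ˢ S) {p | Matches G c t p.1 p.2}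
      (Set.toFinite _)
  have h3 : Disjoint P (Prod.swap ⁻¹' P) := by
    rw [Set.disjoint_left]
    rintro ⟨a, b⟩ ⟨⟨ha, hb⟩, h4⟩ ⟨-, h5⟩
    have := hinj ha.1 hb.1 (show c s(a, t a) = c s(b, t b) from
      h5.2.symm.trans ((congrArg c Sym2.eq_swap).trans h4.2))
    exact h4.1.ne this
  have h4 : P ∪ Prod.swap ⁻¹' P ⊆ S ×ˢ S := by
    rintro ⟨a, b⟩ (h5 | h5)
    · exact h5.1
    · exact ⟨h5.1.2, h5.1.1⟩
  have h5 := Set.ncard_le_ncard h4 (Set.toFinite _)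
  rw [Set.ncard_union_eq h3 (Set.toFinite _) (Set.toFinite _), ncard_preimage_swap,
    Set.ncard_prod] at h5
  by_contra! hlt
  have h2' : (P.ncard : ℝ) + Q.ncard = S.ncard * S.ncard := by exact_mod_cast h2
  have h5' : (P.ncard : ℝ) + P.ncard ≤ S.ncard * S.ncard := by exact_mod_cast h5
  have h6 : (0 : ℝ) < S.ncard := by linarith
  have h7 := mul_lt_mul_of_pos_left hlt h6
  linarith

/-- `A₃` consists of the tame emitters outside `B` whose arrow ends in `B`; it is nearly all of `U \
B`. Since `s a` is in `U \ B`, few `a` have `s a` outside `A₃`, and removing them leaves `C`. There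
`s` is an involution: of the neighbours of `s a`, one is in `B` and `a` is not. -/
theorem IsHubSystem.exists_isCore (h : IsHubSystem G c ℓ F₀ U D B A t s d m) (hG : IsCritical G c)
    (hT : 0 < T) (hmT : 40 * m ≤ T) (hmN : 3 * m * Nat.card V ≤ T * T)
    (hd : (Nat.card V : ℝ) + 40 * T ≤ 2 * d) (hN : 100 * T ≤ Nat.card V) :
    ∃ C ⊆ Tame G c t A B T, Disjoint C B ∧ IsCore G c ℓ F₀ U B C t s d T ∧
      Set.InjOn (fun a => c s(a, t a)) C := by
  have hd2 := h.isMax.conf.deg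
  have hℓ0 : (0 : ℝ) ≤ ℓ := Nat.cast_nonneg _
  have hm5 : 5 ≤ m := by linarith [h.near_le]
  set A₁ := Tame G c t A B T with hA₁
  have t1 : ((A \ A₁).ncard : ℝ) ≤ T := ncard_sdiff_tame_le hT hmN h.bad
  have hinj : Set.InjOn (fun a => c s(a, t a)) A₁ :=
    injOn_tame hG (by linarith [h.le_B])
  have t3 : ((A₁ ∩ B).ncard : ℝ) ≤ 2 * T := ncard_tame_inter_le hT.le hinj
  set A₃ : Set V := {a | a ∈ A₁ ∧ t a ∈ B ∧ a ∉ B} with hA₃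
  set C : Set V := {a | a ∈ A₃ ∧ s a ∈ A₃} with hC
  have hA₃A : A₃ ⊆ A := fun a ha => ha.1.1
  have hA₃U : A₃ ⊆ U \ B := fun a ha => ⟨h.D_subset (h.A_subset ha.1.1), ha.2.2⟩
  have hCA₃ : C ⊆ A₃ := fun a ha => ha.1
  have t4 : (d : ℝ) - 10 * m - 3 * T ≤ A₃.ncard := by
    have e1 : A ⊆ ((A₃ ∪ (A \ A₁)) ∪ {a | a ∈ A ∧ t a ∉ B}) ∪ (A₁ ∩ B) := by
      intro a ha
      by_cases h1 : a ∈ A₁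
      · by_cases h2 : t a ∈ B
        · by_cases h3 : a ∈ B
          · exact Or.inr ⟨h1, h3⟩
          · exact Or.inl (Or.inl (Or.inl ⟨h1, h2, h3⟩))
        · exact Or.inl (Or.inr ⟨ha, h2⟩)
      · exact Or.inl (Or.inl (Or.inr ⟨ha, h1⟩))
    have e2 := Set.ncard_le_ncard e1 (Set.toFinite _)
    have e3 := Set.ncard_union_le ((A₃ ∪ (A \ A₁)) ∪ {a | a ∈ A ∧ t a ∉ B}) (A₁ ∩ B)
    have e4 := Set.ncard_union_le (A₃ ∪ (A \ A₁)) {a | a ∈ A ∧ t a ∉ B}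
    have e5 := Set.ncard_union_le A₃ (A \ A₁)
    have e6 : (A.ncard : ℝ) ≤ A₃.ncard + (A \ A₁).ncard + {a | a ∈ A ∧ t a ∉ B}.ncard +
      (A₁ ∩ B).ncard := by exact_mod_cast e2.trans (by omega)
    linarith [h.le_A, h.t_notMem]
  have t5 : ((U \ B).ncard : ℝ) ≤ d + 4 * m := by
    have e1 : ((U \ B).ncard : ℝ) + B.ncard = U.ncard := by
      exact_mod_cast Set.ncard_sdiff_add_ncard_of_subset h.B_subset (Set.toFinite _)
    linarith [h.U_le, h.le_B]
  have t6 : (((U \ B) \ A₃).ncard : ℝ) ≤ 14 * m + 3 * T := by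
    have e1 : (((U \ B) \ A₃).ncard : ℝ) + A₃.ncard = (U \ B).ncard := by
      exact_mod_cast Set.ncard_sdiff_add_ncard_of_subset hA₃U (Set.toFinite _)
    linarith
  have t7 : ((A₃ \ C).ncard : ℝ) ≤ 28 * m + 6 * T := by
    have e1 : (A₃ \ C).ncard ≤
        {p : V × V | F₀.Adj p.1 p.2 ∧ p.1 ∈ (U \ B) \ A₃}.ncard := by
      refine Set.ncard_le_ncard_of_injOn (fun a => (s a, a)) ?_
        (fun a _ b _ e => congrArg Prod.snd e) (Set.toFinite _)
      rintro a ⟨ha, hn⟩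
      have e2 := h.adj_s a (hA₃A ha)
      exact ⟨e2.symm, ⟨h.isMax.conf.supp _ _ e2.symm, h.s_notMem a (hA₃A ha)⟩,
        fun e => hn ⟨ha, e⟩⟩
    have e2 : ((A₃ \ C).ncard : ℝ) ≤ 2 * ((U \ B) \ A₃).ncard := by
      exact_mod_cast e1.trans (ncard_arrows_fst_le hd2 _)
    linarith
  have t8 : ((A₃ \ C).ncard : ℝ) + C.ncard = A₃.ncard := by
    exact_mod_cast Set.ncard_sdiff_add_ncard_of_subset hCA₃ (Set.toFinite _)
  have t9 : (((U \ B) \ C).ncard : ℝ) + C.ncard = (U \ B).ncard := by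
    exact_mod_cast Set.ncard_sdiff_add_ncard_of_subset (hCA₃.trans hA₃U) (Set.toFinite _)
  have t10 : (C.ncard : ℝ) ≤ D.ncard := by
    exact_mod_cast Set.ncard_le_ncard (fun a ha => h.A_subset (hA₃A (hCA₃ ha))) (Set.toFinite _)
  have hCA : ∀ a ∈ C, a ∈ A := fun a ha => hA₃A ha.1
  have hss : ∀ a ∈ C, s (s a) = a := by
    intro a ha
    have e1 := h.adj_s a (hCA a ha)
    rcases hd2 _ _ _ _ (h.adj_t _ (hA₃A ha.2)) (h.adj_s _ (hA₃A ha.2)) e1.symm with e | e | e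
    · exact absurd e (h.t_ne_s _ (hA₃A ha.2))
    · exact absurd (e ▸ ha.2.2.1) ha.1.2.2
    · exact e
  refine ⟨C, fun a ha => ha.1.1, ?_, ?_, hinj.mono fun a ha => ha.1.1⟩
  · rw [Set.disjoint_left]
    exact fun a ha => ha.1.2.2
  refine ⟨h.isMax, h.deg, by linarith [h.near_le], fun a ha => (hA₃U ha.1).1,
    fun a ha => h.adj_t a (hCA a ha), fun a ha => h.adj_s a (hCA a ha),
    fun a ha => h.t_ne_s a (hCA a ha), fun a ha => ⟨ha.2, by rw [hss a ha]; exact ha.1⟩, hss,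
    fun a ha => ha.1.1.2, by linarith, by linarith [h.D_le], by linarith, by linarith [h.le_U], hd,
    by linarith, h.not_adj, ?_, ?_⟩
  · exact fun a ha => h.truncate a (hCA a ha) ha.1.2.1
  · intro a ha w w' p q hw hw' hne h1 h2 hp hq
    exact h.swap a (hCA a ha) ha.1.2.1 w w' p q hw hw' hne h1 h2 (h.A_subset (hCA p hp))
      (h.A_subset (hCA q hq))

end Tame

/-! ### The vertices outside the configuration -/

section Core

variable {V K : Type*} [Fintype V] {G : SimpleGraph V} {c : Sym2 V → K} {ℓ : ℕ}
  {F₀ : SimpleGraph V} {U B C : Set V} {t s : V → V} {d : ℕ} {T : ℝ}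

theorem exists_rainbow (G : SimpleGraph V) (c : Sym2 V → K) (v : V) :
    ∃ S : Set V, (∀ u ∈ S, G.Adj v u) ∧ Set.InjOn (fun u => c s(v, u)) S ∧
      S.ncard = colourDegree G c v := by
  obtain ⟨S, hS, he⟩ := (Set.surjOn_image (fun u => c s(v, u))
    (G.neighborSet v)).exists_bijOn_subset
  exact ⟨S, fun u hu => hS hu, he.injOn, by rw [colourDegree, ← he.image_eq,
    he.injOn.ncard_image]⟩

theorem exists_rainbow_avoiding (hdeg : ∀ v, d + 1 ≤ colourDegree G c v) (v : V) (γ : K) :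
    ∃ S : Set V, (∀ u ∈ S, G.Adj v u ∧ c s(v, u) ≠ γ) ∧ Set.InjOn (fun u => c s(v, u)) S ∧
      d ≤ S.ncard := by
  obtain ⟨S, h1, h2, h3⟩ := exists_rainbow G c v
  refine ⟨{u | u ∈ S ∧ c s(v, u) ≠ γ}, fun u hu => ⟨h1 u hu.1, hu.2⟩, h2.mono fun u hu => hu.1, ?_⟩
  have h4 : {u | u ∈ S ∧ c s(v, u) = γ}.ncard ≤ 1 :=
    (Set.ncard_le_one_iff (Set.toFinite _)).2 fun ha hb => h2 ha.1 hb.1 (ha.2.trans hb.2.symm)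
  have h5 : {u | u ∈ S ∧ c s(v, u) = γ}.ncard + {u | u ∈ S ∧ c s(v, u) ≠ γ}.ncard = S.ncard :=
    Set.ncard_inter_add_ncard_sdiff_eq_ncard S {u | c s(v, u) = γ} (Set.toFinite _)
  have h6 := hdeg v
  omega

theorem IsCore.nbr (h : IsCore G c ℓ F₀ U B C t s d T) {a u : V} (ha : a ∈ C) (hu : F₀.Adj a u) :
    u = t a ∨ u = s a := by
  rcases h.isMax.conf.deg a u (t a) (s a) hu (h.adj_t a ha) (h.adj_s a ha) with e | e | e
  · exact Or.inl e
  · exact Or.inr e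
  · exact absurd e (h.t_ne_s a ha)

theorem IsCore.pos (h : IsCore G c ℓ F₀ U B C t s d T) : 5 ≤ T := by
  have : (0 : ℝ) ≤ ℓ := Nat.cast_nonneg _
  linarith [h.near_le]

/-- The involution `s` maps `S ∩ C` injectively into `C`; if no pair lay in `S`, the image would be
disjoint from `S ∩ C`. -/
theorem IsCore.exists_pair (h : IsCore G c ℓ F₀ U B C t s d T) {S : Set V}
    (hS : (C.ncard : ℝ) < 2 * (S ∩ C).ncard) : ∃ a ∈ C, a ∈ S ∧ s a ∈ S := by
  by_contra! hcon
  have h1 : (s '' (S ∩ C)).ncard = (S ∩ C).ncard := by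
    refine Set.InjOn.ncard_image fun a ha b hb e => ?_
    rw [← h.s_s a ha.2, ← h.s_s b hb.2, e]
  have h2 : Disjoint (S ∩ C) (s '' (S ∩ C)) := by
    rw [Set.disjoint_left]
    rintro _ h3 ⟨a, ha, rfl⟩
    exact hcon a ha.2 ha.1 h3.1
  have h3 : (S ∩ C) ∪ s '' (S ∩ C) ⊆ C := by
    rintro a (ha | ⟨a, ha, rfl⟩)
    · exact ha.2
    · exact h.s_mem a ha.2
  have h4 := Set.ncard_le_ncard h3 (Set.toFinite _)
  rw [Set.ncard_union_eq h2 (Set.toFinite _) (Set.toFinite _), h1] at h4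
  have h5 : ((S ∩ C).ncard : ℝ) + (S ∩ C).ncard ≤ C.ncard := by exact_mod_cast h4
  linarith

/-- Of two matched vertices with different colours to `w`, one can be separated from its partner. -/
theorem IsCore.exists_ne (h : IsCore G c ℓ F₀ U B C t s d T) {w : V} {S : Set V}
    (hinj : Set.InjOn (fun u => c s(w, u)) S) (hS : (C.ncard : ℝ) < 2 * (S ∩ C).ncard) :
    ∃ a ∈ C, a ∈ S ∧ c s(a, w) ≠ c s(a, s a) := by
  obtain ⟨a, ha, h1, h2⟩ := h.exists_pair hS
  by_cases hc : c s(a, w) = c s(a, s a)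
  · refine ⟨s a, h.s_mem a ha, h2, fun hc' => ?_⟩
    rw [h.s_s a ha, Sym2.eq_swap (a := s a) (b := a), ← hc, Sym2.eq_swap, Sym2.eq_swap (a := a)]
      at hc'
    exact (h.adj_s a ha).ne (hinj h1 h2 hc'.symm)
  · exact ⟨a, ha, h1, hc⟩

theorem IsCore.nbr_notMem (h : IsCore G c ℓ F₀ U B C t s d T) {w u : V} (hw : w ∉ U)
    (hu : G.Adj w u) : u ∉ B := fun hB => h.not_adj u hB w hw hu.symm

/-- A rainbow set of `d` neighbours of `w` avoids `B`, and at most about `n - 3d/2` of it lies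
outside `U`; as `2d` exceeds `n`, it covers more than half of `C`. This gives an `a` through which
`w` can replace the hub `t a`, and the new end `w` is then extended to `w'`. -/
theorem IsCore.not_adj_outside (h : IsCore G c ℓ F₀ U B C t s d T) {w w' : V} (hw : w ∉ U)
    (hw' : w' ∉ U) : ¬ G.Adj w w' := by
  intro hG
  obtain ⟨S, hS, hinj, hcard⟩ := exists_rainbow_avoiding h.deg w (c s(w, w'))
  have h1 : S ⊆ ((S ∩ C) ∪ ((U \ B) \ C)) ∪ Uᶜ := by
    intro u hu
    by_cases h2 : u ∈ U
    · by_cases h3 : u ∈ C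
      · exact Or.inl (Or.inl ⟨hu, h3⟩)
      · exact Or.inl (Or.inr ⟨⟨h2, h.nbr_notMem hw (hS u hu).1⟩, h3⟩)
    · exact Or.inr h2
  have h2 := Set.ncard_le_ncard h1 (Set.toFinite _)
  have h3 := Set.ncard_union_le ((S ∩ C) ∪ ((U \ B) \ C)) Uᶜ
  have h4 := Set.ncard_union_le (S ∩ C) ((U \ B) \ C)
  have h5 : (U.ncard : ℝ) + Uᶜ.ncard = Nat.card V := by
    exact_mod_cast Set.ncard_add_ncard_compl U (Set.toFinite _) (Set.toFinite _)
  have h6 : (d : ℝ) ≤ (S ∩ C).ncard + ((U \ B) \ C).ncard + Uᶜ.ncard := by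
    exact_mod_cast hcard.trans (h2.trans (by omega))
  obtain ⟨a, ha, haS, hc⟩ := h.exists_ne hinj (by
    linarith [h.C_le, h.rest_le, h.le_U, h.dense, h.pos])
  exact h.truncate a ha w w' hw hw' (hS a haS).1.symm hc hG (hS a haS).2.symm

theorem IsCore.le_ncard_inter (h : IsCore G c ℓ F₀ U B C t s d T) {w : V} (hw : w ∉ U) {S : Set V}
    (hS : ∀ u ∈ S, G.Adj w u) : (S.ncard : ℝ) - 11 * T ≤ (S ∩ C).ncard := by
  have h1 : S ⊆ (S ∩ C) ∪ ((U \ B) \ C) := by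
    intro u hu
    have h2 : u ∈ U := by
      by_contra h2
      exact h.not_adj_outside hw h2 (hS u hu)
    by_cases h3 : u ∈ C
    · exact Or.inl ⟨hu, h3⟩
    · exact Or.inr ⟨⟨h2, h.nbr_notMem hw (hS u hu)⟩, h3⟩
  have h2 : (S.ncard : ℝ) ≤ (S ∩ C).ncard + ((U \ B) \ C).ncard := by
    exact_mod_cast (Set.ncard_le_ncard h1 (Set.toFinite _)).trans (Set.ncard_union_le _ _)
  linarith [h.rest_le]

theorem ncard_near_le_real (hd : DegLeTwo F₀) (v : V) (hT : (2 * ℓ + 5 : ℝ) ≤ T) :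
    ({u | Near F₀ (ℓ + 2) v u}.ncard : ℝ) ≤ T := by
  refine le_trans ?_ hT
  have := ncard_near_le hd v (ℓ + 2)
  have h2 : {u | Near F₀ (ℓ + 2) v u}.ncard ≤ 2 * ℓ + 5 := this.trans (by omega)
  exact_mod_cast h2

/-- If `w` sees `p` in the wrong colour then the partner of `p` sees all other outside vertices in
the right colour. -/
theorem IsCore.eq_of_adj_partner (h : IsCore G c ℓ F₀ U B C t s d T) {w w' p : V} (hw : w ∉ U)
    (hw' : w' ∉ U) (hne : w' ≠ w) {S : Set V} (hS : ∀ u ∈ S, G.Adj w u)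
    (hinj : Set.InjOn (fun u => c s(w, u)) S) (hcard : d ≤ S.ncard) (hp : p ∈ C) (hpS : p ∈ S)
    (hc : c s(w, p) ≠ c s(p, t p)) (hG : G.Adj (s p) w') : c s(s p, w') = c s(s p, t (s p)) := by
  by_contra hc'
  -- Excluding the vertices near `p` or its partner costs at most `2T`, so `S` still covers more
  -- than half of `C` and provides an `a` at which `w` replaces a hub. Rotating from `w` along `p (s
  -- p)` would then reach `w'`.
  set X := {u | Near F₀ (ℓ + 2) p u} ∪ {u | Near F₀ (ℓ + 2) (s p) u} with hX
  have h1 := h.le_ncard_inter hw hS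
  have h2 : ((S ∩ C).ncard : ℝ) ≤ ((S \ X) ∩ C).ncard + {u | Near F₀ (ℓ + 2) p u}.ncard +
      {u | Near F₀ (ℓ + 2) (s p) u}.ncard := by
    have e1 : S ∩ C ⊆ (((S \ X) ∩ C) ∪ {u | Near F₀ (ℓ + 2) p u}) ∪
        {u | Near F₀ (ℓ + 2) (s p) u} := by
      intro u hu
      by_cases e : u ∈ X
      · exact e.elim (fun e => Or.inl (Or.inr e)) Or.inr
      · exact Or.inl (Or.inl ⟨⟨hu.1, e⟩, hu.2⟩)
    have e2 := Set.ncard_le_ncard e1 (Set.toFinite _)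
    have e3 := Set.ncard_union_le (((S \ X) ∩ C) ∪ {u | Near F₀ (ℓ + 2) p u})
      {u | Near F₀ (ℓ + 2) (s p) u}
    have e4 := Set.ncard_union_le ((S \ X) ∩ C) {u | Near F₀ (ℓ + 2) p u}
    exact_mod_cast e2.trans (by omega)
  have h3 := ncard_near_le_real h.isMax.conf.deg p h.near_le
  have h4 := ncard_near_le_real h.isMax.conf.deg (s p) h.near_le
  have h5 : (d : ℝ) ≤ S.ncard := by exact_mod_cast hcard
  obtain ⟨a, ha, haS, hca⟩ := h.exists_ne (S := S \ X) (hinj.mono Set.sdiff_subset) (by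
    linarith [h.C_le, h.large, h.pos])
  have hna : ¬ Near F₀ (ℓ + 2) a p := fun hn => haS.2 (Or.inl hn.symm)
  refine h.swap a ha w w' p (s p) hw hw' hne (hS a haS.1).symm hca hp (h.s_mem p hp)
    (h.adj_s p hp) (hS p hpS) hG ?_ ?_ ?_ hna fun hn => haS.2 (Or.inr hn.symm)
  · intro e
    exact hna (hinj hpS haS.1 e ▸ Near.refl _ _ _)
  · intro u hu hus
    rcases h.nbr hp hu with rfl | rfl
    · exact hc
    · exact absurd rfl hus
  · intro u hu hup
    rcases h.nbr (h.s_mem p hp) hu with rfl | rfl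
    · exact hc'
    · exact absurd (h.s_s p hp) hup

/-- If `w` sees `p` in the wrong colour then the partner of `p` sees almost all vertices of `C` in
an unusual colour. -/
theorem IsCore.ncard_sdiff_le (h : IsCore G c ℓ F₀ U B C t s d T) {w q : V} (hq : q ∈ C)
    (hout : ∀ w', w' ∉ U → w' ≠ w → G.Adj q w' → c s(q, w') = c s(q, t q)) :
    ({u | u ∈ C ∧ ¬ (G.Adj q u ∧ c s(q, u) ≠ c s(q, t q))}.ncard : ℝ) ≤ 14 * T := by
  -- The edges from `q` into `S` avoid the usual colour, so they avoid the matched vertices of `B`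
  -- and all outside vertices except possibly `w`. Hence most of them go to `C`.
  obtain ⟨S, hS, -, hcard⟩ := exists_rainbow_avoiding h.deg q (c s(q, t q))
  set X := {u | u ∈ C ∧ (G.Adj q u ∧ c s(q, u) ≠ c s(q, t q))} with hX
  have h1 : S ⊆ ((X ∪ ((U \ B) \ C)) ∪ {b | b ∈ B ∧ ¬ Matches G c t b q}) ∪ {w} := by
    intro u hu
    obtain ⟨h2, h3⟩ := hS u hu
    by_cases h4 : u ∈ U
    · by_cases h5 : u ∈ B
      · refine Or.inl (Or.inr ⟨h5, fun hm => h3 ?_⟩)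
        rw [Sym2.eq_swap]; exact hm.2
      · by_cases h6 : u ∈ C
        · exact Or.inl (Or.inl (Or.inl ⟨h6, h2, h3⟩))
        · exact Or.inl (Or.inl (Or.inr ⟨⟨h4, h5⟩, h6⟩))
    · right
      by_contra hne
      exact h3 (hout u h4 hne h2)
  have h2 := Set.ncard_le_ncard h1 (Set.toFinite _)
  have h3 := Set.ncard_union_le ((X ∪ ((U \ B) \ C)) ∪ {b | b ∈ B ∧ ¬ Matches G c t b q}) {w}
  have h4 := Set.ncard_union_le (X ∪ ((U \ B) \ C)) {b | b ∈ B ∧ ¬ Matches G c t b q}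
  have h5 := Set.ncard_union_le X ((U \ B) \ C)
  rw [Set.ncard_singleton] at h3
  have h6 : (d : ℝ) ≤ X.ncard + ((U \ B) \ C).ncard + {b | b ∈ B ∧ ¬ Matches G c t b q}.ncard + 1 :=
    by exact_mod_cast hcard.trans (h2.trans (by omega))
  have h7 : (X.ncard : ℝ) + {u | u ∈ C ∧ ¬ (G.Adj q u ∧ c s(q, u) ≠ c s(q, t q))}.ncard =
      C.ncard := by
    exact_mod_cast Set.ncard_inter_add_ncard_sdiff_eq_ncard C
      {u | G.Adj q u ∧ c s(q, u) ≠ c s(q, t q)} (Set.toFinite _)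
  linarith [h.rest_le, h.tame q hq, h.C_le, h.pos]

/-- For two far apart vertices `p₁`, `p₂` seen by `w` in a wrong colour, inserting `w` between them
and joining their partners would enlarge the configuration. The partners are nearly always joined by
an edge whose colour is unusual at both of them, so the set `J` of such vertices satisfies `|J|² ≤
29T|J|`: `14T` from each direction and `T` from near pairs. -/
theorem IsCore.ncard_wrong_le (h : IsCore G c ℓ F₀ U B C t s d T) {w : V} (hw : w ∉ U) {S : Set V}
    (hS : ∀ u ∈ S, G.Adj w u) (hinj : Set.InjOn (fun u => c s(w, u)) S) (hcard : d ≤ S.ncard) :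
    ({p | p ∈ S ∩ C ∧ c s(w, p) ≠ c s(p, t p)}.ncard : ℝ) ≤ 29 * T := by
  set J := {p | p ∈ S ∩ C ∧ c s(w, p) ≠ c s(p, t p)} with hJ
  set Y : Set (V × V) := {p | p ∈ J ×ˢ J ∧ ¬ (G.Adj (s p.1) (s p.2) ∧
    c s(s p.1, s p.2) ≠ c s(s p.1, t (s p.1)))} with hY
  set N : Set (V × V) := {p | p ∈ J ×ˢ J ∧ Near F₀ (ℓ + 2) p.1 p.2} with hN
  have h1 : (Y.ncard : ℝ) ≤ J.ncard * (14 * T) := by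
    refine ncard_le_mul_of_fst (fun p hp => hp.1.1) fun p hp => ?_
    refine le_trans ?_ (h.ncard_sdiff_le (w := w) (h.s_mem p hp.1.2) fun w' hw' hne hG =>
      h.eq_of_adj_partner hw hw' hne hS hinj hcard hp.1.2 hp.1.1 hp.2 hG)
    have e1 : {p₂ | (p, p₂) ∈ Y}.ncard ≤ {u | u ∈ C ∧ ¬ (G.Adj (s p) u ∧
        c s(s p, u) ≠ c s(s p, t (s p)))}.ncard := by
      refine Set.ncard_le_ncard_of_injOn s (fun p₂ hp₂ => ⟨h.s_mem _ hp₂.1.2.1.2, hp₂.2⟩) ?_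
        (Set.toFinite _)
      intro a ha b hb e
      rw [← h.s_s a ha.1.2.1.2, ← h.s_s b hb.1.2.1.2, e]
    exact_mod_cast e1
  have h2 : (N.ncard : ℝ) ≤ J.ncard * T := by
    refine ncard_le_mul_of_fst (fun p hp => hp.1.1) fun p hp => ?_
    refine le_trans ?_ (ncard_near_le_real h.isMax.conf.deg p h.near_le)
    have e1 : {p₂ | (p, p₂) ∈ N}.ncard ≤ {u | Near F₀ (ℓ + 2) p u}.ncard :=
      Set.ncard_le_ncard (fun u hu => hu.2) (Set.toFinite _)
    exact_mod_cast e1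
  have h3 : J ×ˢ J ⊆ (Y ∪ Prod.swap ⁻¹' Y) ∪ N := by
    rintro ⟨p₁, p₂⟩ hp
    by_contra hcon
    simp only [Set.mem_union, not_or] at hcon
    obtain ⟨⟨n1, n2⟩, n3⟩ := hcon
    obtain ⟨hp1, hp2⟩ := hp
    dsimp only at hp1 hp2
    have far : ¬ Near F₀ (ℓ + 2) p₁ p₂ := fun hn => n3 ⟨⟨hp1, hp2⟩, hn⟩
    have g1 : G.Adj (s p₁) (s p₂) ∧ c s(s p₁, s p₂) ≠ c s(s p₁, t (s p₁)) := by
      by_contra e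
      exact n1 ⟨⟨hp1, hp2⟩, e⟩
    have g2 : G.Adj (s p₂) (s p₁) ∧ c s(s p₂, s p₁) ≠ c s(s p₂, t (s p₂)) := by
      by_contra e
      exact n2 ⟨⟨hp2, hp1⟩, e⟩
    have other : ∀ p ∈ C, ∀ γ, γ ≠ c s(p, t p) → ∀ u, F₀.Adj p u → u ≠ s p → γ ≠ c s(p, u) := by
      intro p hp γ hγ u hu hne
      rcases h.nbr hp hu with rfl | rfl
      · exact hγ
      · exact absurd rfl hne
    refine h.isMax.false_of_insert_join hw (h.adj_s p₁ hp1.1.2) (h.adj_s p₂ hp2.1.2) far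
      (hS p₁ hp1.1.1) (hS p₂ hp2.1.1) g1.1 ?_ (other p₁ hp1.1.2 _ hp1.2) (other p₂ hp2.1.2 _ hp2.2)
      ?_ ?_
    · exact fun e => far (hinj hp1.1.1 hp2.1.1 e ▸ Near.refl _ _ _)
    · intro u hu hne
      exact other (s p₁) (h.s_mem _ hp1.1.2) _ g1.2 u hu (by rwa [h.s_s _ hp1.1.2])
    · intro u hu hne
      rw [Sym2.eq_swap]
      exact other (s p₂) (h.s_mem _ hp2.1.2) _ g2.2 u hu (by rwa [h.s_s _ hp2.1.2])
  have h4 := Set.ncard_le_ncard h3 (Set.toFinite _)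
  have h5 := Set.ncard_union_le (Y ∪ Prod.swap ⁻¹' Y) N
  have h6 := Set.ncard_union_le Y (Prod.swap ⁻¹' Y)
  rw [ncard_preimage_swap] at h6
  rw [Set.ncard_prod] at h4
  have h7 : (J.ncard : ℝ) * J.ncard ≤ Y.ncard + Y.ncard + N.ncard := by
    exact_mod_cast h4.trans (by omega)
  by_contra! hlt
  have hT := h.pos
  have h8 : (0 : ℝ) < J.ncard := by linarith
  have h9 := mul_lt_mul_of_pos_left hlt h8
  linarith

/-- Outside vertices are matched with almost all of `C`. -/
theorem IsCore.ncard_not_matches_le (h : IsCore G c ℓ F₀ U B C t s d T) {w : V} (hw : w ∉ U) :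
    ({a | a ∈ C ∧ ¬ Matches G c t w a}.ncard : ℝ) ≤ 41 * T := by
  obtain ⟨S, hS, hinj, hcard⟩ := exists_rainbow G c w
  have hd : d ≤ S.ncard := by
    have := h.deg w
    omega
  have h1 := h.le_ncard_inter hw hS
  have h2 := h.ncard_wrong_le hw hS hinj hd
  have h3 : S ∩ C ⊆ {a | a ∈ C ∧ Matches G c t w a} ∪
      {p | p ∈ S ∩ C ∧ c s(w, p) ≠ c s(p, t p)} := by
    intro u hu
    by_cases e : c s(w, u) = c s(u, t u)
    · exact Or.inl ⟨hu.2, hS u hu.1, e⟩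
    · exact Or.inr ⟨hu, e⟩
  have h4 : ((S ∩ C).ncard : ℝ) ≤ {a | a ∈ C ∧ Matches G c t w a}.ncard +
      {p | p ∈ S ∩ C ∧ c s(w, p) ≠ c s(p, t p)}.ncard := by
    exact_mod_cast (Set.ncard_le_ncard h3 (Set.toFinite _)).trans (Set.ncard_union_le _ _)
  have h5 : ({a | a ∈ C ∧ Matches G c t w a}.ncard : ℝ) +
      {a | a ∈ C ∧ ¬ Matches G c t w a}.ncard = C.ncard := by
    exact_mod_cast Set.ncard_inter_add_ncard_sdiff_eq_ncard C {a | Matches G c t w a}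
      (Set.toFinite _)
  have h6 : (d : ℝ) ≤ S.ncard := by exact_mod_cast hd
  linarith [h.C_le]

end Core

/-! ### Assembling the extremal structure -/

section Extremal

variable {V K : Type*} [Fintype V] {G : SimpleGraph V} {c : Sym2 V → K} {ℓ : ℕ}
  {F₀ : SimpleGraph V} {U D B A : Set V} {t s : V → V} {d : ℕ} {m T P δ ε : ℝ}

/-- The first class is `C` without the few vertices that miss many outside vertices. The second is
`Uᶜ` together with the hubs, except those that miss many emitters (`B₁`) or have many neighbours
outside `D` (`B₂`); discarding `B₂` gives the upper bound on degrees. -/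
theorem IsHubSystem.isExtremal (h : IsHubSystem G c ℓ F₀ U D B A t s d m) (hG : IsCritical G c)
    (hT : 0 < T) (hmT : 40 * m ≤ T) (hmN : 3 * m * Nat.card V ≤ T * T)
    (hd : (Nat.card V : ℝ) + 40 * T ≤ 2 * d) (hN : 100 * T ≤ Nat.card V) (hP : 0 < P)
    (hTP : 41 * T * Nat.card V ≤ P * P) (hδ : δ * Nat.card V ≤ d) (hδ' : (d : ℝ) ≤ δ * Nat.card V + 1)
    (hε : P + 42 * T + 1 ≤ ε * Nat.card V) : IsExtremal G c δ ε := by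
  obtain ⟨C, hCA, hCB, k, hinj⟩ := h.exists_isCore hG hT hmT hmN hd hN
  have hT5 := k.pos
  have hm0 : 0 ≤ m := by
    have : (0 : ℝ) ≤ ℓ := Nat.cast_nonneg _
    linarith [h.near_le]
  have hN0 : (0 : ℝ) ≤ Nat.card V := Nat.cast_nonneg _
  set A' := Tame G c t C Uᶜ P with hA'
  have hA'C : A' ⊆ C := fun a ha => ha.1
  have hA'le : (C.ncard : ℝ) ≤ A'.ncard + P := by
    have e1 := ncard_sdiff_tame_le (G := G) (c := c) (t := t) (A := C) (B := Uᶜ) hP hTP (by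
      refine le_trans (ncard_le_mul_of_fst (A := Uᶜ) (m := 41 * T) (fun p hp => hp.1)
        fun w hw => ?_) (by
          have := mul_le_mul_of_nonneg_right (ncard_le_card Uᶜ) (show 0 ≤ 41 * T by linarith)
          linarith)
      have e2 : {a | (w, a) ∈ ({p | p.1 ∈ Uᶜ ∧ p.2 ∈ C ∧ ¬ Matches G c t p.1 p.2} :
          Set (V × V))} = {a | a ∈ C ∧ ¬ Matches G c t w a} := by
        ext a; exact ⟨fun ha => ha.2, fun ha => ⟨hw, ha⟩⟩
      rw [e2]
      exact k.ncard_not_matches_le hw)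
    have e3 : ((C \ A').ncard : ℝ) + A'.ncard = C.ncard := by
      exact_mod_cast Set.ncard_sdiff_add_ncard_of_subset hA'C (Set.toFinite _)
    linarith
  set B₁ : Set V := {v | v ∈ B ∧ T < {a | a ∈ A ∧ ¬ Matches G c t v a}.ncard} with hB₁
  set B₂ : Set V := {v | v ∈ B ∧ T < {u | G.Adj v u ∧ u ∉ D}.ncard} with hB₂
  set B₀ : Set V := {v | v ∈ B ∧ v ∉ B₁ ∧ v ∉ B₂} with hB₀
  have hB₁le : (B₁.ncard : ℝ) ≤ T := by
    refine le_of_mul_le_mul_right ?_ hT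
    refine le_trans ?_ (h.bad.trans hmN)
    refine mul_le_ncard_of_fst fun v hv => ?_
    have e1 : {a | (v, a) ∈ ({p | p.1 ∈ B ∧ p.2 ∈ A ∧
        ¬ (G.Adj p.1 p.2 ∧ c s(p.1, p.2) = c s(p.2, t p.2))} : Set (V × V))} =
        {a | a ∈ A ∧ ¬ Matches G c t v a} := by
      ext a; exact ⟨fun ha => ha.2, fun ha => ⟨hv.1, ha⟩⟩
    rw [e1]
    exact hv.2.le
  have hB₂le : (B₂.ncard : ℝ) ≤ T := by
    refine le_of_mul_le_mul_right ?_ hT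
    refine le_trans ?_ (h.stray.trans (le_trans (by nlinarith) hmN))
    refine mul_le_ncard_of_fst fun v hv => ?_
    have e1 : {u | (v, u) ∈ ({p | p.1 ∈ B ∧ G.Adj p.1 p.2 ∧ p.2 ∉ D} : Set (V × V))} =
        {u | G.Adj v u ∧ u ∉ D} := by
      ext a; exact ⟨fun ha => ha.2, fun ha => ⟨hv.1, ha⟩⟩
    rw [e1]
    exact hv.2.le
  have hB₀le : (B.ncard : ℝ) ≤ B₀.ncard + 2 * T := by
    have e1 : B ⊆ (B₀ ∪ B₁) ∪ B₂ := by
      intro v hv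
      by_cases e2 : v ∈ B₁
      · exact Or.inl (Or.inr e2)
      by_cases e3 : v ∈ B₂
      · exact Or.inr e3
      exact Or.inl (Or.inl ⟨hv, e2, e3⟩)
    have e2 := Set.ncard_le_ncard e1 (Set.toFinite _)
    have e3 := Set.ncard_union_le (B₀ ∪ B₁) B₂
    have e4 := Set.ncard_union_le B₀ B₁
    have e5 : (B.ncard : ℝ) ≤ B₀.ncard + B₁.ncard + B₂.ncard := by
      exact_mod_cast e2.trans (by omega)
    linarith
  have hdisj : Disjoint B₀ Uᶜ := by
    rw [Set.disjoint_left]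
    exact fun v hv hn => hn (h.B_subset hv.1)
  have hcardB : (B₀ ∪ Uᶜ).ncard = B₀.ncard + Uᶜ.ncard :=
    Set.ncard_union_eq hdisj (Set.toFinite _) (Set.toFinite _)
  have hcardB' : ((B₀ ∪ Uᶜ).ncard : ℝ) = B₀.ncard + Uᶜ.ncard := by exact_mod_cast hcardB
  have hUc : (U.ncard : ℝ) + Uᶜ.ncard = Nat.card V := by
    exact_mod_cast Set.ncard_add_ncard_compl U (Set.toFinite _) (Set.toFinite _)
  have hmatch : ∀ a b, Matches G c t b a → G.Adj a b ∧ c s(a, b) = c s(a, t a) := fun a b hab =>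
    ⟨hab.1.symm, by rw [Sym2.eq_swap]; exact hab.2⟩
  have split : ∀ (X : Set V) (p : V → Prop), (X.ncard : ℝ) =
      {v | v ∈ X ∧ p v}.ncard + {v | v ∈ X ∧ ¬ p v}.ncard := by
    intro X p
    exact_mod_cast (Set.ncard_inter_add_ncard_sdiff_eq_ncard X {v | p v} (Set.toFinite _)).symm
  have mono : ∀ {X Y : Set V}, X ⊆ Y → (X.ncard : ℝ) ≤ Y.ncard := fun hXY => by
    exact_mod_cast Set.ncard_le_ncard hXY (Set.toFinite _)
  refine ⟨A', B₀ ∪ Uᶜ, fun a => c s(a, t a), ?_, ?_, ?_, hinj.mono hA'C, ?_, ?_⟩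
  · rw [Set.disjoint_left]
    rintro a ha (hb | hb)
    · exact Set.disjoint_left.1 hCB (hA'C ha) hb.1
    · exact hb (k.C_subset (hA'C ha))
  · linarith [k.le_C]
  · linarith [h.le_B, h.U_le]
  · intro a ha
    have e1 := split (B₀ ∪ Uᶜ) fun b => Matches G c t b a
    have e2 : ({b | b ∈ B₀ ∪ Uᶜ ∧ ¬ Matches G c t b a}.ncard : ℝ) ≤
        {b | b ∈ B ∧ ¬ Matches G c t b a}.ncard + {b | b ∈ Uᶜ ∧ ¬ Matches G c t b a}.ncard := by
      have : {b | b ∈ B₀ ∪ Uᶜ ∧ ¬ Matches G c t b a} ⊆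
          {b | b ∈ B ∧ ¬ Matches G c t b a} ∪ {b | b ∈ Uᶜ ∧ ¬ Matches G c t b a} := by
        rintro b ⟨hb | hb, hn⟩
        · exact Or.inl ⟨hb.1, hn⟩
        · exact Or.inr ⟨hb, hn⟩
      exact_mod_cast (Set.ncard_le_ncard this (Set.toFinite _)).trans (Set.ncard_union_le _ _)
    have e3 : ({b | b ∈ B₀ ∪ Uᶜ ∧ Matches G c t b a}.ncard : ℝ) ≤
        {b | b ∈ B₀ ∪ Uᶜ ∧ G.Adj a b ∧ c s(a, b) = c s(a, t a)}.ncard :=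
      mono fun b hb => ⟨hb.1, hmatch a b hb.2⟩
    have e4 := k.tame a (hA'C ha)
    have e5 := ha.2
    linarith
  · intro b hb
    have e1 := split A' fun a => Matches G c t b a
    have e3 : ({a | a ∈ A' ∧ Matches G c t b a}.ncard : ℝ) ≤
        {a | a ∈ A' ∧ G.Adj a b ∧ c s(a, b) = c s(a, t a)}.ncard :=
      mono fun a ha => ⟨ha.1, hmatch a b ha.2⟩
    rcases hb with hb | hb
    · have e4 : {a | a ∈ A ∧ ¬ Matches G c t b a}.ncard ≤ T := by
        by_contra! hlt
        exact hb.2.1 ⟨hb.1, hlt⟩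
      have e5 : ({u | G.Adj b u ∧ u ∉ D}.ncard : ℝ) ≤ T := by
        by_contra! hlt
        exact hb.2.2 ⟨hb.1, hlt⟩
      have e6 : ({a | a ∈ A' ∧ ¬ Matches G c t b a}.ncard : ℝ) ≤
          {a | a ∈ A ∧ ¬ Matches G c t b a}.ncard :=
        mono fun a ha => ⟨(hCA (hA'C ha.1)).1, ha.2⟩
      have e7 : ((G.neighborSet b).ncard : ℝ) ≤ D.ncard + {u | G.Adj b u ∧ u ∉ D}.ncard := by
        have : G.neighborSet b ⊆ D ∪ {u | G.Adj b u ∧ u ∉ D} := by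
          intro u hu
          by_cases hD : u ∈ D
          · exact Or.inl hD
          · exact Or.inr ⟨hu, hD⟩
        exact_mod_cast (Set.ncard_le_ncard this (Set.toFinite _)).trans (Set.ncard_union_le _ _)
      exact ⟨by linarith [h.D_le], by linarith⟩
    · have e4 := k.ncard_not_matches_le hb
      have e6 : ({a | a ∈ A' ∧ ¬ Matches G c t b a}.ncard : ℝ) ≤
          {a | a ∈ C ∧ ¬ Matches G c t b a}.ncard := mono fun a ha => ⟨hA'C ha.1, ha.2⟩
      have e7 : ((G.neighborSet b).ncard : ℝ) ≤ C.ncard + ((U \ B) \ C).ncard := by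
        have : G.neighborSet b ⊆ C ∪ ((U \ B) \ C) := by
          intro u hu
          by_cases hC : u ∈ C
          · exact Or.inl hC
          · refine Or.inr ⟨⟨?_, k.nbr_notMem hb hu⟩, hC⟩
            by_contra hU
            exact k.not_adj_outside hb hU hu
        exact_mod_cast (Set.ncard_le_ncard this (Set.toFinite _)).trans (Set.ncard_union_le _ _)
      exact ⟨by linarith [k.C_le, k.rest_le], by linarith⟩

end Extremal

section Main

variable {V K : Type*} [Fintype V] {G : SimpleGraph V} {c : Sym2 V → K}

/-- The errors form a hierarchy `μ ≪ α ≪ ρ ≪ θ ≪ ε`, with one quadratic loss at each use of a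
counting argument: `μ` for growth and strays, `α` for the excess of popular sets, `ρ` for their
overlap with heads, `θ` for tameness. -/
theorem isExtremal_of_max {ε η θ ρ α μ β δ : ℝ} {ℓ R : ℕ} {F : SimpleGraph V} {U : Set V}
    (hε₀ : 0 < ε) (hε₁ : ε ≤ 1) (hθ₀ : 0 < θ) (hθε : θ ≤ ε ^ 2 / 200) (hθη : θ ≤ η / 20)
    (hρ : ρ = θ ^ 2 / 6) (hα : α = ρ ^ 2 / 6) (hμ : μ = α ^ 2 / 20) (hR : 1 ≤ R)
    (hμR : 4 ≤ μ * R) (hβμ : β ≤ μ) (hδ : 1 / 2 + η ≤ δ) (hℓ : 1 ≤ ℓ)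
    (hℓμ : 184 * (R + 2) * (2 * ℓ + 1 : ℝ) ≤ μ * Nat.card V) (hNε : 4 ≤ ε * Nat.card V)
    (hG : IsCritical G c) (hdeg : ∀ v, δ * Nat.card V + 1 ≤ colourDegree G c v)
    (hF : IsConfig G c ℓ F U) (hmax : ∀ F' U', IsConfig G c ℓ F' U' → U'.ncard ≤ U.ncard)
    (hU : U ≠ Set.univ) (hUlt : (U.ncard : ℝ) < (3 * δ + β) * Nat.card V / 2) :
    IsExtremal G c δ ε := by
  set N : ℝ := (Nat.card V : ℝ) with hN
  have hN0 : 0 < N := by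
    refine lt_of_le_of_ne (Nat.cast_nonneg _) fun e => ?_
    rw [← e] at hNε
    linarith
  have hεε : ε ^ 2 ≤ ε := pow_le_of_le_one hε₀.le hε₁ two_ne_zero
  have hθ1 : θ ≤ 1 / 200 := by linarith
  have hρ0 : 0 < ρ := by rw [hρ]; positivity
  have hρθ : 1200 * ρ ≤ θ := by
    have := mul_le_mul_of_nonneg_right hθ1 hθ₀.le
    rw [hρ]
    linarith
  have hα0 : 0 < α := by rw [hα]; positivity
  have hα1 : α ≤ 1 := by
    have := pow_le_of_le_one hρ0.le (by linarith : ρ ≤ 1) two_ne_zero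
    linarith
  have hμ0 : 0 < μ := by rw [hμ]; positivity
  have hμ1 : μ ≤ 1 := by
    have := pow_le_of_le_one hα0.le hα1 two_ne_zero
    linarith
  have hη : 0 < η := by linarith
  have hδ0 : 0 < δ := by linarith
  -- Colour degrees are integers, so they are at least `d + 1` after rounding up.
  set d := ⌈δ * N⌉₊ with hd
  have hd1 : δ * N ≤ d := Nat.le_ceil _
  have hd2 : (d : ℝ) ≤ δ * N + 1 := (Nat.ceil_lt_add_one (by positivity)).le
  have hdeg' : ∀ v, d + 1 ≤ colourDegree G c v := by
    intro v
    have h1 := hdeg v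
    have h2 : 1 ≤ colourDegree G c v := by
      have : (1 : ℝ) ≤ colourDegree G c v := by
        have : 0 ≤ δ * N := by positivity
        linarith
      exact_mod_cast this
    have h3 : d ≤ colourDegree G c v - 1 := by
      rw [hd, Nat.ceil_le, Nat.cast_sub h2]
      push_cast
      linarith
    omega
  have hηN : θ * N ≤ η / 20 * N := mul_le_mul_of_nonneg_right hθη hN0.le
  have hδN : (1 / 2 + η) * N ≤ δ * N := mul_le_mul_of_nonneg_right hδ hN0.le
  have hdN : N + 40 * (θ * N) ≤ 2 * d := by linarith
  have hθN : 0 < θ * N := by positivity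
  have hℓR : (1 : ℝ) ≤ ℓ := by exact_mod_cast hℓ
  have hR1 : (1 : ℝ) ≤ R := by exact_mod_cast hR
  -- The least threshold that permits `R` rounds; it stays below `μN` because `ℓ` is a small
  -- multiple of `N`.
  obtain ⟨κ, hκ⟩ : ∃ κ, κ = 4 * ((4 * R + 8) * (2 * ℓ + 1)) + 1 := ⟨_, rfl⟩
  have hκR : (κ : ℝ) = 4 * ((4 * R + 8) * (2 * ℓ + 1)) + 1 := by rw [hκ]; push_cast; ring
  have hκμ : 8 * ((4 * ℓ + 6 : ℝ) + κ) ≤ μ * N := by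
    rw [hκR]
    linarith [mul_nonneg (sub_nonneg.2 hR1) (sub_nonneg.2 hℓR)]
  have hμN : μ * N ≤ N := mul_le_of_le_one_left hN0.le hμ1
  have hκ0 : (0 : ℝ) ≤ κ := Nat.cast_nonneg _
  have hsmall : ∀ v, 4 * ℓ + 12 ≤ colourDegree G c v := by
    intro v
    have h1 : (4 * ℓ + 12 : ℝ) ≤ d := by linarith
    have h2 : 4 * ℓ + 12 ≤ d := by exact_mod_cast h1
    have := hdeg' v
    omega
  obtain ⟨F₁, x, x', hbase⟩ := (hF.isMaxConfig hmax hU hℓ).exists_isBase hU hsmall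
  have hβN : β * N ≤ μ * N := mul_le_mul_of_nonneg_right hβμ hN0.le
  obtain ⟨y, y', E, E₁, r, hst⟩ := hbase.exists_isStable (κ := κ) (T := R) (d := d) (μ := μ)
    (α := α) (ρ := ρ) hdeg' hN0 (by linarith) hR hμR (by rw [hκ]; omega) hκμ
    (by rw [← hN]; linarith [mul_pos hμ0 hN0]) hμ0.le hμ1 hα0 hα1 (by rw [hμ]; linarith) hρ0.le
    (by linarith)
    (by rw [hα]; linarith)
  obtain ⟨D, B, A, t, s, hsys⟩ := hst.exists_isHubSystem
  refine hsys.isExtremal (T := θ * N) (P := ε * N / 2) hG hθN ?_ ?_ hdN ?_ (by positivity) ?_ hd1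
    hd2 ?_
  · rw [← hN]
    have := mul_le_mul_of_nonneg_right hρθ hN0.le
    linarith
  · rw [← hN, hρ]
    exact le_of_eq (by ring)
  · rw [← hN]
    have := mul_le_mul_of_nonneg_right hθ1 hN0.le
    linarith
  · rw [← hN]
    have := mul_le_mul_of_nonneg_right hθε (mul_pos hN0 hN0).le
    have h2 : 0 ≤ ε ^ 2 * (N * N) := by positivity
    linarith
  · rw [← hN]
    have h1 : θ ≤ ε / 200 := by linarith
    have := mul_le_mul_of_nonneg_right h1 hN0.le
    linarith

end Main

end EdgeColoured

/-! ### The theorem: choice of constants and conclusion -/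

theorem lemma5p1 :
    ∃ ε₀ : ℝ, 0 < ε₀ ∧ ∀ ε : ℝ, 0 < ε → ε ≤ ε₀ →
    ∀ η : ℝ, 0 < η →
    ∃ β₀ : ℝ, 0 < β₀ ∧ ∀ β : ℝ, 0 < β → β ≤ β₀ →
    ∃ n₀ : ℕ, ∀ n : ℕ, n₀ ≤ n →
    ∀ δ : ℝ, 1 / 2 + η ≤ δ →
    ∀ (V K : Type*) [Fintype V] (G : SimpleGraph V) (c : Sym2 V → K),
      Fintype.card V = n →
      EdgeColoured.IsCritical G c →
      δ * (n : ℝ) + 1 ≤ (EdgeColoured.minColourDegree G c : ℝ) →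
      (EdgeColoured.IsExtremal G c δ ε ∨
        ∃ H : G.Subgraph, EdgeColoured.IsOnePathCycle H ∧
          EdgeColoured.IsProperlyColoured c H ∧
          min ((3 * δ + β) * (n : ℝ) / 2) (n : ℝ) ≤ (H.verts.ncard : ℝ) ∧
          ∀ (x : V) (p : G.Walk x x), p.IsCycle → p.toSubgraph ≤ H →
            β * (n : ℝ) / 100 ≤ (p.length : ℝ)) ∧
      (¬ EdgeColoured.IsExtremal G c δ ε →
        ∃ (k : ℕ) (P : Fin k → G.Subgraph), (k : ℝ) ≤ 100 / β ∧
          (∀ i, EdgeColoured.IsPathSubgraph (P i) ∧ EdgeColoured.IsProperlyColoured c (P i)) ∧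
          (∀ i j, i ≠ j → Disjoint (P i).verts (P j).verts) ∧
          min ((3 * δ + β) * (n : ℝ) / 2) (n : ℝ) ≤ ((⋃ i, (P i).verts).ncard : ℝ)) := by
  refine ⟨1, one_pos, fun ε hε₀ hε₁ η hη => ?_⟩
  obtain ⟨θ, hθ⟩ : ∃ θ, θ = min (ε ^ 2 / 200) (η / 20) := ⟨_, rfl⟩
  have hθ₀ : 0 < θ := by rw [hθ]; exact lt_min (by positivity) (by positivity)
  have hθε : θ ≤ ε ^ 2 / 200 := hθ ▸ min_le_left _ _
  have hθη : θ ≤ η / 20 := hθ ▸ min_le_right _ _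
  have hθ1 : θ ≤ 1 := by
    have := pow_le_of_le_one hε₀.le hε₁ two_ne_zero
    linarith
  obtain ⟨ρ, hρ⟩ : ∃ ρ, ρ = θ ^ 2 / 6 := ⟨_, rfl⟩
  obtain ⟨α, hα⟩ : ∃ α, α = ρ ^ 2 / 6 := ⟨_, rfl⟩
  obtain ⟨μ, hμ⟩ : ∃ μ, μ = α ^ 2 / 20 := ⟨_, rfl⟩
  have hρ0 : 0 < ρ := by rw [hρ]; positivity
  have hα0 : 0 < α := by rw [hα]; positivity
  have hμ0 : 0 < μ := by rw [hμ]; positivity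
  have hρ1 : ρ ≤ 1 := by
    have := pow_le_of_le_one hθ₀.le hθ1 two_ne_zero
    linarith
  have hα1 : α ≤ 1 := by
    have := pow_le_of_le_one hρ0.le hρ1 two_ne_zero
    linarith
  have hμ1 : μ ≤ 1 := by
    have := pow_le_of_le_one hα0.le hα1 two_ne_zero
    linarith
  -- Each side has at most `2n` arrows, so among `4 / μ` rounds one adds at most `μn` arrows in
  -- total.
  obtain ⟨R, hR⟩ := exists_nat_ge (4 / μ)
  have hμR : 4 ≤ μ * R := by
    rw [div_le_iff₀ hμ0] at hR
    linarith
  have hR1 : 1 ≤ R := by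
    by_contra! h
    obtain rfl : R = 0 := by omega
    simp at hμR
    linarith
  -- With `ℓ` about `βn/50`, this choice and that of `n₀` each use up at most half of the allowance
  -- `μn` for `184(R + 2)(2ℓ + 1)`.
  refine ⟨μ / (16 * (R + 2)), by positivity, fun β hβ₀ hβ₁ => ?_⟩
  have hβR : 16 * (R + 2) * β ≤ μ := by
    rw [le_div_iff₀ (by positivity)] at hβ₁
    linarith
  have hβμ : β ≤ μ := by nlinarith
  obtain ⟨n₀, hn₀⟩ := exists_nat_ge (4 / ε + 1840 * (R + 2) / μ)
  refine ⟨n₀, fun n hn δ hδ V K _ G c hcard hG hdeg => ?_⟩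
  have hN : (Nat.card V : ℝ) = n := by rw [Nat.card_eq_fintype_card, hcard]
  have hn' : 4 / ε + 1840 * (R + 2) / μ ≤ n := hn₀.trans (by exact_mod_cast hn)
  have hq1 : 0 < 4 / ε := by positivity
  have hq2 : 0 < 1840 * ((R : ℝ) + 2) / μ := by positivity
  have hnε : 4 ≤ ε * n := by
    have : 4 / ε ≤ n := by linarith
    rw [div_le_iff₀ hε₀] at this
    linarith
  have hnμ : 1840 * (R + 2) ≤ μ * n := by
    have : 1840 * ((R : ℝ) + 2) / μ ≤ n := by linarith
    rw [div_le_iff₀ hμ0] at this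
    linarith
  have hn0 : (0 : ℝ) < n := by linarith
  -- Twice the required cycle length: the number of paths is then at most `50/β + 1`, which is at
  -- most `100/β`. The summand `1` makes `1 ≤ ℓ` evident.
  obtain ⟨ℓ, hℓ⟩ : ∃ ℓ, ℓ = ⌈β * n / 50⌉₊ + 1 := ⟨_, rfl⟩
  have hℓ1 : β * n / 50 ≤ ℓ := by
    rw [hℓ]
    push_cast
    linarith [Nat.le_ceil (β * n / 50)]
  have hℓ2 : (ℓ : ℝ) ≤ β * n / 50 + 2 := by
    rw [hℓ]
    push_cast
    linarith [Nat.ceil_lt_add_one (show 0 ≤ β * n / 50 by positivity)]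
  have hdeg' : ∀ v, δ * n + 1 ≤ EdgeColoured.colourDegree G c v := by
    intro v
    refine hdeg.trans ?_
    exact_mod_cast ciInf_le (OrderBot.bddBelow _) v
  obtain ⟨F, U, hF, hmax⟩ := EdgeColoured.exists_max_isConfig G c ℓ
  by_cases hU : min ((3 * δ + β) * (n : ℝ) / 2) (n : ℝ) ≤ (U.ncard : ℝ)
  · refine ⟨Or.inr ?_, fun _ => ?_⟩
    · obtain ⟨H, h1, h2, h3, h4⟩ := hF.exists_onePathCycle
      refine ⟨H, h1, h2, by rw [h3]; exact hU, fun x p hp hpH => ?_⟩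
      have h5 : (ℓ : ℝ) ≤ p.length := by exact_mod_cast h4 x p hp hpH
      have : 0 ≤ β * n := by positivity
      linarith
    · obtain ⟨k, P, h1, h2, h3, h4⟩ := hF.exists_paths
      refine ⟨k, P, ?_, h2, h3, by rw [h4]; exact hU⟩
      have h5 : ((k - 1 : ℕ) : ℝ) * ℓ ≤ n := by
        have h6 : (U.ncard : ℝ) ≤ n := hN ▸ EdgeColoured.ncard_le_card U
        refine le_trans ?_ h6
        exact_mod_cast h1
      have h6 : ((k - 1 : ℕ) : ℝ) * (β / 50) ≤ 1 := by
        refine le_of_mul_le_mul_right ?_ hn0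
        refine le_trans ?_ (h5.trans (one_mul (n : ℝ)).ge)
        have := mul_le_mul_of_nonneg_left hℓ1 (Nat.cast_nonneg (α := ℝ) (k - 1))
        linarith
      have h7 : (k : ℝ) ≤ (k - 1 : ℕ) + 1 := by
        have : k ≤ k - 1 + 1 := by omega
        exact_mod_cast this
      rw [le_div_iff₀ hβ₀]
      nlinarith
  · rw [not_le, lt_min_iff] at hU
    have hext : EdgeColoured.IsExtremal G c δ ε := by
      refine EdgeColoured.isExtremal_of_max hε₀ hε₁ hθ₀ hθε hθη hρ hα hμ hR1 hμR hβμ hδ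
        (hℓ ▸ Nat.le_add_left 1 _) ?_ (hN ▸ hnε) hG (hN ▸ hdeg') hF hmax ?_ (hN ▸ hU.1)
      · rw [hN]
        have h1 := mul_le_mul_of_nonneg_right hβR hn0.le
        have h2 : (2 * ℓ + 1 : ℝ) ≤ β * n / 25 + 5 := by linarith
        have h3 := mul_le_mul_of_nonneg_left h2 (show (0 : ℝ) ≤ 184 * (R + 2) by positivity)
        linarith
      · rintro rfl
        rw [Set.ncard_univ, hN] at hU
        exact lt_irrefl _ hU.2
    exact ⟨Or.inl hext, fun hn => absurd hext hn⟩
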